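/- Let $\mathfrak M$ be a complex Hilbert space and put $D=\mathbb C\setminus\{(-\infty,-1]\cup[1,+\infty)\}$. The class $\mathcal{RS}(\mathfrak M)$ consists of the functions $\Omega:D\to\mathbf B(\mathfrak M)$ that are holomorphic on $D$ and satisfy $\Omega(z)^*=\Omega(\bar z)$ and $\operatorname{Im}z\,\operatorname{Im}\Omega(z)\ge 0$ for $z\in\mathbb C\setminus\mathbb R$, and $-I\le\Omega(x)\le I$ for $x\in(-1,1)$. A function that is holomorphic and contractive on the open unit disk is called inner (co-inner) if its strong radial boundary values are isometric (co-isometric) almost everywhere on the unit circle, and bi-inner if it is both. 1) Let $\Omega\in\mathcal{RS}(\mathfrak M)$. Then there exist a Hilbert space $\widetilde{\mathfrak M}$ containing $\mathfrak M$ as a (closed) subspace and a selfadjoint contraction $\widetilde A$ in $\widetilde{\mathfrak M}$ such that $$\Omega(z)=P_{\mathfrak M}(zI+\widetilde A)(I+z\widetilde A)^{-1}\!\upharpoonright\!\mathfrak M,\qquad z\in D, \tag{1}$$ where $I+z\widetilde A$ is boundedly invertible for every $z\in D$ and the function $z\mapsto(zI+\widetilde A)(I+z\widetilde A)^{-1}$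 belongs to $\mathcal{RS}(\widetilde{\mathfrak M})$ and is bi-inner. Moreover, the pair $\{\widetilde{\mathfrak M},\widetilde A\}$ can be chosen such that $\widetilde A$ is $\mathfrak M$-simple, i.e. $\overline{\operatorname{span}}\{\widetilde A^n\mathfrak M: n=0,1,2,\dots\}=\widetilde{\mathfrak M}$. For every representation (1) with a selfadjoint contraction $\widetilde A$ that is $\mathfrak M$-simple, $\Omega$ is inner if and only if $\widetilde{\mathfrak M}=\mathfrak M$. If $\{\widetilde{\mathfrak M}_1,\widetilde A_1\}$ and $\{\widetilde{\mathfrak M}_2,\widetilde A_2\}$ are two pairs giving representations (1) of $\Omega$ with $\mathfrak M$-simple selfadjoint contractions, then there is a unitary operator $\widetilde U$ from $\widetilde{\mathfrak M}_1$ onto $\widetilde{\mathfrak M}_2$ with $\widetilde U\!\upharpoonright\!\mathfrak M=I_{\mathfrak M}$ and $\widetilde A_2\widetilde U=\widetilde U\widetilde A_1$. 2) The formula $$\Omega(z)=\int_{-1}^{1}\frac{z+t}{1+zt}\,d\sigma(t),\qquad z\in D,$$ where the integral is the limit in operator norm of the Riemann–Stieltjes sums, gives a one-to-one correspondence between the functions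 $\Omega\in\mathcal{RS}(\mathfrak M)$ and the nondecreasing functions $\sigma:[-1,1]\to\mathbf B(\mathfrak M)$ that satisfy $\sigma(-1)=0$ and $\sigma(1)=I$ and are strongly left-continuous at every point of $(-1,1)$. -/

import Mathlib

open scoped ComplexStarModule Topology InnerProductSpace

universe u v w

noncomputable section

namespace NevanlinnaSchur

variable {M : Type u} [NormedAddCommGroup M] [InnerProductSpace ℂ M] [CompleteSpace M]
variable {K : Type v} [NormedAddCommGroup K] [InnerProductSpace ℂ K] [CompleteSpace K]

/-- The domain `ℂ ∖ ((-∞,-1] ∪ [1,+∞))`. Operator functions on it are represented by total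
functions on `ℂ`, of which only the values on the domain matter. -/
def slitDomain : Set ℂ := {z | ¬ (z.im = 0 ∧ (z.re ≤ -1 ∨ 1 ≤ z.re))}

/-- `B(M)`-valued Nevanlinna functions: holomorphic off the real axis, symmetric, and
`Im z · Im Ω(z) ≥ 0`, where `Im T = (T - T*) / (2i)` and `≤` is the Loewner order. -/
structure IsNevanlinna (Ω : ℂ → M →L[ℂ] M) : Prop where
  holo : DifferentiableOn ℂ Ω {z | z.im ≠ 0}
  symm : ∀ z : ℂ, z.im ≠ 0 → ContinuousLinearMap.adjoint (Ω z) = Ω (starRingEnd ℂ z)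
  im_nonneg : ∀ z : ℂ, z.im ≠ 0 → 0 ≤ z.im • (ℑ (Ω z) : M →L[ℂ] M)

/-- The combined Nevanlinna-Schur class `RS(M)`. -/
structure IsRS (Ω : ℂ → M →L[ℂ] M) : Prop where
  nevanlinna : IsNevanlinna Ω
  holo : DifferentiableOn ℂ Ω slitDomain
  bounds : ∀ x : ℝ, x ∈ Set.Ioo (-1 : ℝ) 1 → -1 ≤ Ω (x : ℂ) ∧ Ω (x : ℂ) ≤ 1

/-- The Schur class on the open unit disk. -/
structure IsSchur (Θ : ℂ → M →L[ℂ] M) : Prop where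
  holo : DifferentiableOn ℂ Θ (Metric.ball 0 1)
  contr : ∀ z ∈ Metric.ball (0 : ℂ) 1, ‖Θ z‖ ≤ 1

/-- `V` is the strong radial boundary value of `Θ` at `exp (iθ)`. -/
def IsBoundaryValue (Θ : ℂ → M →L[ℂ] M) (θ : ℝ) (V : M →L[ℂ] M) : Prop :=
  ∀ x : M, Filter.Tendsto (fun r : ℝ => Θ ((r : ℂ) * Complex.exp (θ * Complex.I)) x)
    (𝓝[<] 1) (𝓝 (V x))

/-- Inner functions: Schur functions with isometric boundary values almost everywhere. -/
def IsInner (Θ : ℂ → M →L[ℂ] M) : Prop :=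
  IsSchur Θ ∧ ∀ᵐ θ : ℝ, ∃ V : M →L[ℂ] M, IsBoundaryValue Θ θ V ∧
    ContinuousLinearMap.adjoint V * V = 1

/-- Co-inner functions: Schur functions with co-isometric boundary values almost everywhere. -/
def IsCoInner (Θ : ℂ → M →L[ℂ] M) : Prop :=
  IsSchur Θ ∧ ∀ᵐ θ : ℝ, ∃ V : M →L[ℂ] M, IsBoundaryValue Θ θ V ∧
    V * ContinuousLinearMap.adjoint V = 1

/-- Bi-inner functions. -/
def IsBiInner (Θ : ℂ → M →L[ℂ] M) : Prop := IsInner Θ ∧ IsCoInner Θ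

/-- Selfadjoint contractions. -/
def IsSelfAdjointContraction (A : K →L[ℂ] K) : Prop := IsSelfAdjoint A ∧ ‖A‖ ≤ 1

/-- The operator function `z ↦ (z I + A)(I + z A)⁻¹`. -/
def mobius (A : K →L[ℂ] K) (z : ℂ) : K →L[ℂ] K :=
  (z • (1 : K →L[ℂ] K) + A) * Ring.inverse (1 + z • A)

/-- The compression `P_M T |_M` to `M` of an operator `T` in `K`, where `M` is regarded as a
closed subspace of `K` through the isometric embedding `J`. The orthogonal projection, as an
operator from `K` onto `M`, is then the adjoint of `J`. -/
def compression (J : M →ₗᵢ[ℂ] K) (T : K →L[ℂ] K) : M →L[ℂ] M :=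
  (ContinuousLinearMap.adjoint J.toContinuousLinearMap).comp (T.comp J.toContinuousLinearMap)

/-- `Ω(z) = P_M (z I + A)(I + z A)⁻¹ |_M` on the whole domain. -/
def IsCompressionOf (Ω : ℂ → M →L[ℂ] M) (J : M →ₗᵢ[ℂ] K) (A : K →L[ℂ] K) : Prop :=
  ∀ z ∈ slitDomain, Ω z = compression J (mobius A z)

/-- `A` is `M`-simple: the closed linear span of the subspaces `Aⁿ M`, `n ≥ 0`, is `K`. -/
def IsSimple (J : M →ₗᵢ[ℂ] K) (A : K →L[ℂ] K) : Prop :=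
  (Submodule.span ℂ {y : K | ∃ (n : ℕ) (x : M), y = (A ^ n) (J x)}).topologicalClosure = ⊤

/-- Nondecreasing `B(M)`-valued functions on `[-1,1]` that are strongly left-continuous at the
interior points and satisfy `σ(-1) = 0`, `σ(1) = I`. -/
structure IsDistribution (σ : ℝ → M →L[ℂ] M) : Prop where
  mono : MonotoneOn σ (Set.Icc (-1) 1)
  left_cont : ∀ t ∈ Set.Ioo (-1 : ℝ) 1, ∀ x : M,
    ContinuousWithinAt (fun s => σ s x) (Set.Iic t) t
  left_end : σ (-1) = 0
  right_end : σ 1 = 1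

/-- `S` is the Riemann-Stieltjes integral of `f` over `[a,b]` with respect to the operator
function `σ`: the tagged Riemann-Stieltjes sums tend to `S` in operator norm as the mesh of the
partition `a = t 0 ≤ t 1 ≤ ⋯ ≤ t n = b` tends to zero. -/
def HasRSIntegral (f : ℝ → ℂ) (σ : ℝ → M →L[ℂ] M) (a b : ℝ) (S : M →L[ℂ] M) : Prop :=
  ∀ ε > 0, ∃ δ > 0, ∀ (n : ℕ) (t s : ℕ → ℝ), Monotone t → t 0 = a → t n = b →
    (∀ i < n, t (i + 1) - t i < δ) → (∀ i < n, s i ∈ Set.Icc (t i) (t (i + 1))) →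
    ‖∑ i ∈ Finset.range n, f (s i) • (σ (t (i + 1)) - σ (t i)) - S‖ < ε

/-- `Ω(z) = ∫_{-1}^{1} (z + t)/(1 + z t) dσ(t)` on the whole domain. -/
def IsIntegralOf (Ω : ℂ → M →L[ℂ] M) (σ : ℝ → M →L[ℂ] M) : Prop :=
  ∀ z ∈ slitDomain,
    HasRSIntegral (fun t : ℝ => (z + (t : ℂ)) / (1 + z * (t : ℂ))) σ (-1) 1 (Ω z)

end NevanlinnaSchur

end

open NevanlinnaSchur

/-!
Everything is reduced to positive unital linear maps `Φ` from the continuous functions on `[-1, 1]`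
to the bounded operators on `M`. With `incl` the function `t ↦ t` and `mob incl z` the function
`t ↦ (z + t) / (1 + z t)`, the three descriptions of a function `Ω` of class `RS` (by its defining
properties, by a dilation `A`, by a distribution function `σ`) all amount to
`Ω z = Φ (mob incl z)` for such a `Φ`.

* From `Ω` to `Φ` (`exists_isPosUnital_of_isRS`). The map `ζ ↦ -2 ζ / (1 + ζ ^ 2)` sends the unit
  disk onto the slit domain, and a combination of `Ω` with it has nonnegative real part, by the
  maximum principle (`isCaratheodory_caratheodory`). Averaging the real part over circles of radius
  `ρ < 1` gives positive unital maps, whose values on the Herglotz kernels converge for `ρ → 1`.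
  Since the resolvents of `incl` span a dense subspace and positive unital maps are uniformly
  bounded, the maps themselves converge.
* From `Φ` to `σ` and back. The value of `σ` at `t` is the strong limit of `Φ` along continuous
  functions increasing to the indicator function of `[-1, t)` (`IsCutLimit`), and partitions of
  unity show that Riemann-Stieltjes sums converge in norm to `Φ`
  (`IsCutLimit.hasRSIntegral`). Conversely, the Riemann-Stieltjes sums of a continuous function for
  two fine partitions are close in norm (`norm_rsSum_sub_rsSum_le`), so they converge to a positive
  unital map (`IsDistribution.exists_isPosUnital`). The norm estimates rest on
  `‖∑ c i • P i‖ ≤ 2 max ‖c i‖` for nonnegative `P i` with sum at most `1`. Left-continuity makes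
  `σ` unique (`IsDistribution.eqOn`).
* From `Φ` to `A` (`IsPosUnital.exists_dilation`). Positive maps on a commutative algebra are
  completely positive, so `Φ (incl ^ (m + n))` is a positive semidefinite kernel on `ℕ`. On its
  reproducing kernel Hilbert space the shift is a selfadjoint contraction, and it dilates `Φ`.
  Conversely, compressions of `mobius A` are of class `RS` by direct computation
  (`isRS_compression`).

In a representation of `Ω` the operator function determines the compressions of all powers of `A`,
that is, the Gram matrix of the vectors `A ^ n (J x)`, whence the uniqueness
(`exists_unitary_of_isSimple`). If `Ω` is inner, then its boundary values at a conjugate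
pair of points of the circle are isometric, so the unitary operators `mobius A ζ` and
`mobius A (conj ζ)` map the range of `J` into itself, and then `A` does too
(`surjective_of_isInner`).
-/

namespace NevanlinnaSchur

open scoped ComplexOrder

/-! ### Inequalities and strong limits for operators -/

section Operators

variable {M : Type*} [NormedAddCommGroup M] [InnerProductSpace ℂ M]

lemma re_inner_le_of_le {S T : M →L[ℂ] M} (h : S ≤ T) (x : M) :
    (⟪S x, x⟫_ℂ).re ≤ (⟪T x, x⟫_ℂ).re := by
  have h2 := ((ContinuousLinearMap.le_def _ _).1 h).re_inner_nonneg_left x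
  rw [sub_apply, inner_sub_left] at h2
  have h3 : 0 ≤ (⟪T x, x⟫_ℂ - ⟪S x, x⟫_ℂ).re := h2
  simpa using h3

lemma re_inner_nonneg_of_nonneg {T : M →L[ℂ] M} (h : 0 ≤ T) (x : M) :
    0 ≤ (⟪T x, x⟫_ℂ).re := by
  simpa using re_inner_le_of_le h x

lemma le_of_tendsto_apply {ι : Type*} {l : Filter ι} [l.NeBot] {f g : ι → M →L[ℂ] M}
    {S T : M →L[ℂ] M} (hf : ∀ x, Filter.Tendsto (fun n => f n x) l (𝓝 (S x)))
    (hg : ∀ x, Filter.Tendsto (fun n => g n x) l (𝓝 (T x))) (h : ∀ᶠ n in l, f n ≤ g n) :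
    S ≤ T := by
  rw [ContinuousLinearMap.le_def, ContinuousLinearMap.isPositive_iff_complex]
  intro x
  have ht : Filter.Tendsto (fun n => ⟪(g n - f n) x, x⟫_ℂ) l (𝓝 ⟪(T - S) x, x⟫_ℂ) := by
    simp only [sub_apply]
    exact ((hg x).sub (hf x)).inner tendsto_const_nhds
  have hc : IsClosed ({w : ℂ | (w.re : ℂ) = w} ∩ {w : ℂ | 0 ≤ w.re}) :=
    (isClosed_eq (Complex.continuous_ofReal.comp Complex.continuous_re) continuous_id).inter
      (isClosed_le continuous_const Complex.continuous_re)
  refine hc.mem_of_tendsto ht (h.mono fun n hn => ?_)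
  exact (ContinuousLinearMap.isPositive_iff_complex _).1 ((ContinuousLinearMap.le_def _ _).1 hn) x

lemma le_of_tendsto_op {ι : Type*} {l : Filter ι} [l.NeBot] {f g : ι → M →L[ℂ] M}
    {S T : M →L[ℂ] M} (hf : Filter.Tendsto f l (𝓝 S)) (hg : Filter.Tendsto g l (𝓝 T))
    (h : ∀ᶠ n in l, f n ≤ g n) : S ≤ T :=
  le_of_tendsto_apply (fun x => ((ContinuousLinearMap.apply ℂ M x).continuous.tendsto S).comp hf)
    (fun x => ((ContinuousLinearMap.apply ℂ M x).continuous.tendsto T).comp hg) h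

variable [CompleteSpace M]

lemma nonneg_of_isSelfAdjoint {T : M →L[ℂ] M} (hT : IsSelfAdjoint T)
    (h : ∀ x, 0 ≤ (⟪T x, x⟫_ℂ).re) : 0 ≤ T :=
  (ContinuousLinearMap.nonneg_iff_isPositive T).2 (ContinuousLinearMap.isPositive_def'.2 ⟨hT, h⟩)

lemma isSelfAdjoint_of_nonneg {T : M →L[ℂ] M} (h : 0 ≤ T) : IsSelfAdjoint T :=
  ((ContinuousLinearMap.nonneg_iff_isPositive T).1 h).isSelfAdjoint

lemma isSelfAdjoint_of_le {S T : M →L[ℂ] M} (hS : IsSelfAdjoint S) (h : S ≤ T) :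
    IsSelfAdjoint T := by
  simpa using (isSelfAdjoint_of_nonneg (sub_nonneg.2 h)).add hS

lemma norm_le_of_neg_le_of_le {T : M →L[ℂ] M} {r : ℝ} (hr : 0 ≤ r)
    (h1 : -(r • (1 : M →L[ℂ] M)) ≤ T) (h2 : T ≤ r • (1 : M →L[ℂ] M)) : ‖T‖ ≤ r := by
  have hT : IsSelfAdjoint T := by
    refine isSelfAdjoint_of_le ?_ h1
    exact (IsSelfAdjoint.smul (isSelfAdjoint_iff.2 (by simp)) (IsSelfAdjoint.one _)).neg
  rw [ContinuousLinearMap.norm_eq_iSup_rayleighQuotient T hT.isSymmetric]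
  refine ciSup_le fun x => ?_
  have e : ∀ x : M, (⟪(r • (1 : M →L[ℂ] M)) x, x⟫_ℂ).re = r * ‖x‖ ^ 2 := by
    intro x
    have : (r • (1 : M →L[ℂ] M)) x = (r : ℂ) • x := by simp
    rw [this, inner_smul_left, inner_self_eq_norm_sq_to_K]
    simp [← Complex.ofReal_pow]
  have a1 := re_inner_le_of_le h1 x
  have a2 := re_inner_le_of_le h2 x
  rw [e] at a2
  rw [neg_apply, inner_neg_left, Complex.neg_re, e] at a1
  have : |T.reApplyInnerSelf x| ≤ r * ‖x‖ ^ 2 := abs_le.2 ⟨a1, a2⟩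
  rw [ContinuousLinearMap.rayleighQuotient, abs_div, abs_of_nonneg (sq_nonneg ‖x‖)]
  exact div_le_of_le_mul₀ (sq_nonneg _) hr this

/-- The bound holds because `-ε P i ≤ Re (c i) P i ≤ ε P i`, and likewise for the imaginary
parts. -/
lemma norm_sum_smul_le_of_nonneg {ι : Type*} (s : Finset ι) (P : ι → M →L[ℂ] M)
    (hP : ∀ i ∈ s, 0 ≤ P i) (hsum : ∑ i ∈ s, P i ≤ 1) (c : ι → ℂ) {ε : ℝ} (hε : 0 ≤ ε)
    (hc : ∀ i ∈ s, P i ≠ 0 → ‖c i‖ ≤ ε) :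
    ‖∑ i ∈ s, c i • P i‖ ≤ 2 * ε := by
  have real : ∀ r : ι → ℝ, (∀ i ∈ s, P i ≠ 0 → |r i| ≤ ε) → ‖∑ i ∈ s, r i • P i‖ ≤ ε := by
    intro r hr
    have h2 : ∑ i ∈ s, ε • P i ≤ ε • (1 : M →L[ℂ] M) := by
      rw [← Finset.smul_sum]
      exact smul_le_smul_of_nonneg_left hsum hε
    have key : ∀ i ∈ s, r i • P i ≤ ε • P i ∧ -(ε • P i) ≤ r i • P i := by
      intro i hi
      by_cases h0 : P i = 0
      · simp [h0]
      · have := abs_le.mp (hr i hi h0)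
        rw [← neg_smul]
        exact ⟨smul_le_smul_of_nonneg_right this.2 (hP i hi),
          smul_le_smul_of_nonneg_right this.1 (hP i hi)⟩
    refine norm_le_of_neg_le_of_le hε ?_
      ((Finset.sum_le_sum fun i hi => (key i hi).1).trans h2)
    refine (neg_le_neg h2).trans ?_
    rw [← Finset.sum_neg_distrib]
    exact Finset.sum_le_sum fun i hi => (key i hi).2
  have hsplit : ∑ i ∈ s, c i • P i
      = ∑ i ∈ s, (c i).re • P i + Complex.I • ∑ i ∈ s, (c i).im • P i := by
    rw [Finset.smul_sum, ← Finset.sum_add_distrib]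
    refine Finset.sum_congr rfl fun i _ => ?_
    conv_lhs => rw [← Complex.re_add_im (c i)]
    rw [add_smul, mul_comm, mul_smul]
    rfl
  rw [hsplit, two_mul]
  refine (norm_add_le _ _).trans (add_le_add (real _ fun i hi h0 => ?_) ?_)
  · exact (Complex.abs_re_le_norm _).trans (hc i hi h0)
  · rw [norm_smul, Complex.norm_I, one_mul]
    exact real _ fun i hi h0 => (Complex.abs_im_le_norm _).trans (hc i hi h0)

lemma norm_apply_sq_le {P : M →L[ℂ] M} (h0 : 0 ≤ P) (h1 : P ≤ 1) (x : M) :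
    ‖P x‖ ^ 2 ≤ (⟪P x, x⟫_ℂ).re := by
  have hs := (ContinuousLinearMap.nonneg_iff_isPositive P).1 h0
  have h : P * P ≤ P := by
    have := CStarAlgebra.pow_antitone h0 h1 (show 1 ≤ 2 by norm_num)
    simpa [pow_two] using this
  have h2 := re_inner_le_of_le h x
  have h3 : ⟪(P * P) x, x⟫_ℂ = ⟪P x, P x⟫_ℂ := hs.inner_left_eq_inner_right (P x) x
  rw [h3, inner_self_eq_norm_sq_to_K] at h2
  simpa [← Complex.ofReal_pow] using h2

/-- A bounded nondecreasing sequence of positive contractions converges strongly: the quadratic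
forms converge, and `‖P x‖² ≤ ⟪P x, x⟫` for the differences `P`. -/
lemma exists_strong_limit_of_monotone {T : ℕ → M →L[ℂ] M} (hmono : Monotone T)
    (h0 : ∀ n, 0 ≤ T n) (h1 : ∀ n, T n ≤ 1) :
    ∃ S : M →L[ℂ] M, ∀ x, Filter.Tendsto (fun n => T n x) Filter.atTop (𝓝 (S x)) := by
  have hC : ∀ x, CauchySeq fun n => T n x := by
    intro x
    have hm : Monotone fun n => (⟪T n x, x⟫_ℂ).re := fun m n h => re_inner_le_of_le (hmono h) x
    have hb : BddAbove (Set.range fun n => (⟪T n x, x⟫_ℂ).re) :=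
      ⟨(⟪(1 : M →L[ℂ] M) x, x⟫_ℂ).re, by rintro _ ⟨n, rfl⟩; exact re_inner_le_of_le (h1 n) x⟩
    have hcau := (tendsto_atTop_ciSup hm hb).cauchySeq
    have hle : ∀ m n, m ≤ n → ‖T n x - T m x‖ ^ 2 ≤ (⟪T n x, x⟫_ℂ).re - (⟪T m x, x⟫_ℂ).re := by
      intro m n h
      have := norm_apply_sq_le (P := T n - T m) (sub_nonneg.2 (hmono h))
        ((sub_le_self _ (h0 m)).trans (h1 n)) x
      simpa [inner_sub_left] using this
    rw [Metric.cauchySeq_iff'] at hcau ⊢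
    intro ε hε
    obtain ⟨N, hN⟩ := hcau (ε ^ 2) (by positivity)
    refine ⟨N, fun n hn => ?_⟩
    have h2 := hN n hn
    rw [Real.dist_eq] at h2
    rw [dist_eq_norm]
    exact lt_of_pow_lt_pow_left₀ 2 hε.le
      ((hle N n hn).trans_lt ((le_abs_self _).trans_lt h2))
  choose f hf using fun x => cauchySeq_tendsto_of_complete (hC x)
  refine ⟨continuousLinearMapOfTendsto T (tendsto_pi_nhds.2 hf), hf⟩

end Operators

/-! ### Positive unital maps on the continuous functions -/

/-- The parameter interval `[-1, 1]`. -/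
abbrev UI : Type := Set.Icc (-1 : ℝ) 1

/-- The inclusion of `[-1, 1]` into `ℂ`, as an element of the algebra of continuous functions. -/
def incl : C(UI, ℂ) := ⟨fun t => ((t : ℝ) : ℂ), by fun_prop⟩

@[simp] lemma incl_apply (t : UI) : incl t = ((t : ℝ) : ℂ) := rfl

lemma norm_incl_le : ‖incl‖ ≤ 1 := by
  refine (ContinuousMap.norm_le _ zero_le_one).2 fun t => ?_
  rw [incl_apply, Complex.norm_real, Real.norm_eq_abs]
  exact abs_le.2 t.2

section Positive

variable {M : Type*} [NormedAddCommGroup M] [InnerProductSpace ℂ M] [CompleteSpace M]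

/-- Positive unital linear maps from the continuous functions on `[-1, 1]` to the bounded
operators. These are the integrals with respect to the distribution functions `σ`. -/
structure IsPosUnital (Φ : C(UI, ℂ) →ₗ[ℂ] (M →L[ℂ] M)) : Prop where
  one : Φ 1 = 1
  nonneg : ∀ f : C(UI, ℂ), (∀ t, 0 ≤ f t) → 0 ≤ Φ f

variable {Φ : C(UI, ℂ) →ₗ[ℂ] (M →L[ℂ] M)}

lemma IsPosUnital.mono (h : IsPosUnital Φ) {f g : C(UI, ℂ)} (hfg : ∀ t, f t ≤ g t) :
    Φ f ≤ Φ g := by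
  rw [← sub_nonneg, ← map_sub]
  exact h.nonneg _ fun t => sub_nonneg.2 (hfg t)

lemma IsPosUnital.norm_le_of_real (h : IsPosUnital Φ) (r : C(UI, ℝ)) {f : C(UI, ℂ)}
    (hf : ∀ t, f t = r t) {C : ℝ} (hC : ∀ t, |r t| ≤ C) : ‖Φ f‖ ≤ C := by
  have hC0 : 0 ≤ C := (abs_nonneg _).trans (hC ⟨0, by norm_num⟩)
  have e : Φ ((C : ℂ) • 1) = C • (1 : M →L[ℂ] M) := by
    rw [map_smul, h.one]; rfl
  refine norm_le_of_neg_le_of_le hC0 ?_ ?_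
  · rw [← e, ← map_neg]
    refine h.mono fun t => ?_
    simp only [ContinuousMap.neg_apply, ContinuousMap.smul_apply, ContinuousMap.one_apply,
      smul_eq_mul, mul_one, hf]
    exact_mod_cast (abs_le.1 (hC t)).1
  · rw [← e]
    refine h.mono fun t => ?_
    simp only [ContinuousMap.smul_apply, ContinuousMap.one_apply, smul_eq_mul, mul_one, hf]
    exact_mod_cast (abs_le.1 (hC t)).2

lemma IsPosUnital.norm_le (h : IsPosUnital Φ) (f : C(UI, ℂ)) : ‖Φ f‖ ≤ 2 * ‖f‖ := by
  let r : C(UI, ℝ) := ⟨fun t => (f t).re, by fun_prop⟩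
  let s : C(UI, ℝ) := ⟨fun t => (f t).im, by fun_prop⟩
  let r' : C(UI, ℂ) := ⟨fun t => (r t : ℂ), by fun_prop⟩
  let s' : C(UI, ℂ) := ⟨fun t => (s t : ℂ), by fun_prop⟩
  have e : f = r' + Complex.I • s' := by
    ext t
    simp only [ContinuousMap.add_apply, ContinuousMap.smul_apply, smul_eq_mul]
    change f t = ((f t).re : ℂ) + Complex.I * ((f t).im : ℂ)
    rw [mul_comm, Complex.re_add_im]
  have h1 : ‖Φ r'‖ ≤ ‖f‖ := h.norm_le_of_real r (fun _ => rfl) fun t =>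
    (Complex.abs_re_le_norm _).trans (f.norm_coe_le_norm t)
  have h2 : ‖Φ s'‖ ≤ ‖f‖ := h.norm_le_of_real s (fun _ => rfl) fun t =>
    (Complex.abs_im_le_norm _).trans (f.norm_coe_le_norm t)
  rw [e, map_add, map_smul, ← e, two_mul]
  refine (norm_add_le _ _).trans (add_le_add h1 ?_)
  rwa [norm_smul, Complex.norm_I, one_mul]

lemma IsPosUnital.continuous (h : IsPosUnital Φ) : Continuous Φ :=
  (Φ.mkContinuous 2 h.norm_le).continuous

end Positive

/-! ### Resolvents and Möbius functions in a Banach algebra -/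

section BanachAlgebra

variable {B : Type*} [NormedRing B] [NormedAlgebra ℂ B]

/-- `z ↦ (z + a)(1 + z a)⁻¹` in an arbitrary Banach algebra; for operators this is `mobius`. -/
noncomputable def mob (a : B) (z : ℂ) : B := (z • (1 : B) + a) * Ring.inverse (1 + z • a)

lemma mem_slitDomain_of_norm_lt_one {z : ℂ} (hz : ‖z‖ < 1) : z ∈ slitDomain := by
  rintro ⟨-, h⟩
  have := (abs_lt.1 ((Complex.abs_re_le_norm z).trans_lt hz))
  rcases h with h | h <;> linarith

lemma smul_mob {a : B} {z : ℂ} (h : IsUnit (1 + z • a)) :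
    z • mob a z = 1 + (z ^ 2 - 1) • Ring.inverse (1 + z • a) := by
  have e : z • (z • (1 : B) + a) = (1 + z • a) + (z ^ 2 - 1) • 1 := by
    rw [smul_add, smul_smul, sub_smul, one_smul, ← pow_two]; abel
  rw [mob, ← smul_mul_assoc, e, add_mul, Ring.mul_inverse_cancel _ h, smul_mul_assoc, one_mul]

lemma eq_smul_of_resolvent {a b : B} {z : ℂ} (hz : ‖z‖ < 1) (h : IsUnit (1 + z • a))
    (hb : (1 + z • a) * b = 1) : b = (z ^ 2 - 1)⁻¹ • (z • mob a z - 1) := by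
  have hb' : b = Ring.inverse (1 + z • a) := by
    have := congrArg (Ring.inverse (1 + z • a) * ·) hb
    simpa [← mul_assoc, Ring.inverse_mul_cancel _ h] using this
  have hz1 : z ^ 2 - 1 ≠ 0 := by
    intro h0
    have h2 : ‖z ^ 2‖ = 1 := by rw [sub_eq_zero.1 h0, norm_one]
    rw [norm_pow] at h2
    have : ‖z‖ ^ 2 < 1 := pow_lt_one₀ (norm_nonneg _) hz two_ne_zero
    linarith
  rw [smul_mob h, add_sub_cancel_left, inv_smul_smul₀ hz1, hb']

variable [CompleteSpace B]

lemma isUnit_one_add_smul_of_norm_lt {a : B} (ha : ‖a‖ ≤ 1) {z : ℂ} (hz : ‖z‖ < 1) :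
    IsUnit (1 + z • a) := by
  have h : ‖-(z • a)‖ < 1 := by
    rw [norm_neg, norm_smul]
    exact (mul_le_of_le_one_right (norm_nonneg _) ha).trans_lt hz
  simpa using isUnit_one_sub_of_norm_lt_one h

/-- The Taylor expansion of the Möbius function at the origin. -/
lemma hasSum_mob {a : B} (ha : ‖a‖ ≤ 1) {z : ℂ} (hz : ‖z‖ < 1) :
    HasSum (fun n : ℕ => (-z) ^ n • (z • a ^ n + a ^ (n + 1))) (mob a z) := by
  have h : ‖(-z) • a‖ < 1 := by
    rw [norm_smul, norm_neg]
    exact (mul_le_of_le_one_right (norm_nonneg _) ha).trans_lt hz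
  have hs := (hasSum_geom_series_inverse _ h).mul_left (z • (1 : B) + a)
  rw [neg_smul, sub_neg_eq_add] at hs
  have e : (fun n : ℕ => (-z) ^ n • (z • a ^ n + a ^ (n + 1)))
      = fun n : ℕ => (z • (1 : B) + a) * (-(z • a)) ^ n := by
    funext n
    rw [← neg_smul, smul_pow, mul_smul_comm, add_mul, smul_mul_assoc, one_mul, pow_succ']
  rw [e]
  exact hs

lemma differentiableAt_mob {a : B} {z : ℂ} (h : IsUnit (1 + z • a)) :
    DifferentiableAt ℂ (mob a) z := by
  have h1 : DifferentiableAt ℂ (fun w : ℂ => w • (1 : B) + a) z := by fun_prop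
  have h2 : DifferentiableAt ℂ (fun w : ℂ => 1 + w • a) z := by fun_prop
  obtain ⟨u, hu⟩ := h
  have h3 : DifferentiableAt ℂ (Ring.inverse : B → B) (1 + z • a) := by
    rw [← hu]; exact differentiableAt_inverse u.isUnit
  exact h1.mul (DifferentiableAt.comp (f := fun w : ℂ => 1 + w • a) z h3 h2)

/-- A closed subspace that contains the resolvents `(1 + z a)⁻¹` near the origin contains all
powers of `a`: inductively, `aⁿ (1 + z a)⁻¹` lies in the subspace for `z ≠ 0`, and tends to `aⁿ`
as `z → 0`. -/
lemma pow_mem_of_resolvent_mem {a : B} (ha : ‖a‖ ≤ 1) (V : Submodule ℂ B)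
    (hV : IsClosed (V : Set B))
    (h : ∀ (z : ℂ) (b : B), ‖z‖ < 1 → (1 + z • a) * b = 1 → b ∈ V) (n : ℕ) : a ^ n ∈ V := by
  have hu : ∀ᶠ z : ℂ in 𝓝[≠] 0, ‖z‖ < 1 ∧ z ≠ 0 := by
    refine Filter.Eventually.and ?_ self_mem_nhdsWithin
    refine nhdsWithin_le_nhds ?_
    filter_upwards [Metric.ball_mem_nhds (0 : ℂ) one_pos] with z hz using by simpa using hz
  have hlim : ∀ n : ℕ, Filter.Tendsto (fun z : ℂ => a ^ n * Ring.inverse (1 + z • a)) (𝓝[≠] 0)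
      (𝓝 (a ^ n)) := by
    intro n
    have h1 : ContinuousAt (Ring.inverse : B → B) (1 + (0 : ℂ) • a) := by
      simpa using NormedRing.inverse_continuousAt (1 : Bˣ)
    have h2 : ContinuousAt (fun z : ℂ => 1 + z • a) 0 := by fun_prop
    have h3 : ContinuousAt (fun z : ℂ => Ring.inverse (1 + z • a)) 0 :=
      ContinuousAt.comp (f := fun z : ℂ => 1 + z • a) h1 h2
    have h4 := (h3.tendsto.mono_left (nhdsWithin_le_nhds (s := {0}ᶜ))).const_mul (a ^ n)
    simpa using h4
  have key : ∀ n : ℕ, (∀ z : ℂ, ‖z‖ < 1 → z ≠ 0 → a ^ n * Ring.inverse (1 + z • a) ∈ V) := by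
    intro n
    induction n with
    | zero =>
      intro z hz _
      rw [pow_zero, one_mul]
      exact h z _ hz (Ring.mul_inverse_cancel _ (isUnit_one_add_smul_of_norm_lt ha hz))
    | succ n ih =>
      intro z hz hz0
      have hn : a ^ n ∈ V := hV.mem_of_tendsto (hlim n) (hu.mono fun w hw => ih w hw.1 hw.2)
      have e : a ^ n * Ring.inverse (1 + z • a) + z • (a ^ (n + 1) * Ring.inverse (1 + z • a))
          = a ^ n := by
        rw [← smul_mul_assoc, ← add_mul]
        have : a ^ n + z • a ^ (n + 1) = a ^ n * (1 + z • a) := by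
          rw [mul_add, mul_one, mul_smul_comm, pow_succ]
        rw [this, mul_assoc, Ring.mul_inverse_cancel _ (isUnit_one_add_smul_of_norm_lt ha hz),
          mul_one]
      have e2 : a ^ (n + 1) * Ring.inverse (1 + z • a)
          = z⁻¹ • (a ^ n - a ^ n * Ring.inverse (1 + z • a)) := by
        rw [eq_inv_smul_iff₀ hz0, eq_sub_iff_add_eq']
        exact e
      rw [e2]
      exact V.smul_mem _ (V.sub_mem hn (ih z hz hz0))
  exact hV.mem_of_tendsto (hlim n) (hu.mono fun w hw => key n w hw.1 hw.2)

end BanachAlgebra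

/-! ### Density in the continuous functions on `[-1, 1]` -/

lemma eq_top_of_pow_mem (V : Submodule ℂ C(UI, ℂ)) (hV : IsClosed (V : Set C(UI, ℂ)))
    (h : ∀ n : ℕ, incl ^ n ∈ V) : V = ⊤ := by
  have real : ∀ (r : C(UI, ℝ)) (f : C(UI, ℂ)), (∀ t, f t = r t) → f ∈ V := by
    intro r f hf
    rw [← SetLike.mem_coe, ← hV.closure_eq, Metric.mem_closure_iff]
    intro ε hε
    obtain ⟨p, hp⟩ := exists_polynomial_near_continuousMap (-1 : ℝ) 1 r (ε / 2) (by positivity)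
    refine ⟨∑ i ∈ p.support, (p.coeff i : ℂ) • incl ^ i,
      V.sum_mem fun i _ => V.smul_mem _ (h i), ?_⟩
    refine lt_of_le_of_lt ((ContinuousMap.dist_le (by positivity)).2 fun t => ?_) (half_lt_self hε)
    have h1 := (p.toContinuousMapOn (Set.Icc (-1) 1) - r).norm_coe_le_norm t
    have h2 : (∑ i ∈ p.support, (p.coeff i : ℂ) • incl ^ i) t = ((p.eval (t : ℝ) : ℝ) : ℂ) := by
      rw [Polynomial.eval_eq_sum, Polynomial.sum]
      simp [ContinuousMap.coe_sum]
    rw [h2, hf, dist_comm, dist_eq_norm, ← Complex.ofReal_sub, Complex.norm_real]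
    exact h1.trans hp.le
  refine Submodule.eq_top_iff'.2 fun f => ?_
  let r : C(UI, ℝ) := ⟨fun t => (f t).re, by fun_prop⟩
  let s : C(UI, ℝ) := ⟨fun t => (f t).im, by fun_prop⟩
  let r' : C(UI, ℂ) := ⟨fun t => (r t : ℂ), by fun_prop⟩
  let s' : C(UI, ℂ) := ⟨fun t => (s t : ℂ), by fun_prop⟩
  have e : f = r' + Complex.I • s' := by
    ext t
    simp only [ContinuousMap.add_apply, ContinuousMap.smul_apply, smul_eq_mul]
    change f t = ((f t).re : ℂ) + Complex.I * ((f t).im : ℂ)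
    rw [mul_comm, Complex.re_add_im]
  rw [e]
  exact V.add_mem (real r r' fun _ => rfl) (V.smul_mem _ (real s s' fun _ => rfl))

lemma one_add_mul_ne_zero {z : ℂ} (hz : z ∈ slitDomain) (t : UI) : 1 + z * ((t : ℝ) : ℂ) ≠ 0 := by
  intro h
  have hre := congrArg Complex.re h
  have him := congrArg Complex.im h
  simp only [Complex.add_re, Complex.one_re, Complex.mul_re, Complex.ofReal_re, Complex.ofReal_im,
    mul_zero, sub_zero, Complex.zero_re, Complex.add_im, Complex.one_im, Complex.mul_im, zero_add,
    Complex.zero_im] at hre him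
  have ht0 : (t : ℝ) ≠ 0 := by rintro h0; rw [h0] at hre; norm_num at hre
  have him' : z.im = 0 := by simpa [ht0] using him
  refine hz ⟨him', ?_⟩
  by_contra! hc
  have h1 := t.2.1
  have h2 := t.2.2
  have : |z.re * (t : ℝ)| < 1 := by
    rw [abs_mul]
    exact mul_lt_one_of_nonneg_of_lt_one_left (abs_nonneg _) (abs_lt.2 hc) (abs_le.2 ⟨h1, h2⟩)
  have := (abs_lt.1 this).1
  linarith

lemma isUnit_one_add_smul_incl {z : ℂ} (hz : z ∈ slitDomain) : IsUnit (1 + z • incl) := by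
  rw [ContinuousMap.isUnit_iff_forall_ne_zero]
  intro t
  simpa using one_add_mul_ne_zero hz t

lemma inverse_one_add_smul_incl_apply {z : ℂ} (hz : z ∈ slitDomain) (t : UI) :
    Ring.inverse (1 + z • incl) t = (1 + z * ((t : ℝ) : ℂ))⁻¹ := by
  have h := congrArg (fun f : C(UI, ℂ) => f t)
    (Ring.mul_inverse_cancel _ (isUnit_one_add_smul_incl hz))
  simp only [ContinuousMap.mul_apply, ContinuousMap.add_apply, ContinuousMap.one_apply,
    ContinuousMap.smul_apply, incl_apply, smul_eq_mul] at h
  exact eq_inv_of_mul_eq_one_right h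

lemma mob_incl_apply {z : ℂ} (hz : z ∈ slitDomain) (t : UI) :
    mob incl z t = (z + ((t : ℝ) : ℂ)) / (1 + z * ((t : ℝ) : ℂ)) := by
  rw [mob, ContinuousMap.mul_apply, inverse_one_add_smul_incl_apply hz, div_eq_mul_inv]
  simp

/-- Continuous linear maps on the continuous functions are determined by their values on the
functions `t ↦ (z + t) / (1 + z t)` and on the constants. -/
lemma eq_of_eq_on_mob {E : Type*} [NormedAddCommGroup E] [NormedSpace ℂ E]
    {Φ Ψ : C(UI, ℂ) →ₗ[ℂ] E} (hΦ : Continuous Φ) (hΨ : Continuous Ψ) (h1 : Φ 1 = Ψ 1)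
    (h : ∀ z ∈ slitDomain, Φ (mob incl z) = Ψ (mob incl z)) : Φ = Ψ := by
  have hV : IsClosed ((LinearMap.eqLocus Φ Ψ : Submodule ℂ C(UI, ℂ)) : Set C(UI, ℂ)) :=
    isClosed_eq hΦ hΨ
  have := eq_top_of_pow_mem _ hV (pow_mem_of_resolvent_mem norm_incl_le _ hV fun z b hz hb => ?_)
  · exact LinearMap.eqLocus_eq_top.1 this
  · have hz' := mem_slitDomain_of_norm_lt_one hz
    change Φ b = Ψ b
    rw [eq_smul_of_resolvent hz (isUnit_one_add_smul_incl hz') hb]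
    simp only [map_smul, map_sub, h1, h z hz']

/-! ### The slit domain -/

lemma mem_slitDomain_of_im_ne_zero {z : ℂ} (hz : z.im ≠ 0) : z ∈ slitDomain := fun h => hz h.1

lemma ofReal_mem_slitDomain {x : ℝ} (hx : x ∈ Set.Ioo (-1 : ℝ) 1) : (x : ℂ) ∈ slitDomain := by
  refine mem_slitDomain_of_norm_lt_one ?_
  rw [Complex.norm_real, Real.norm_eq_abs]
  exact abs_lt.2 hx

lemma isOpen_slitDomain : IsOpen slitDomain := by
  have h : slitDomain = ({z : ℂ | z.im = 0} ∩ ({z : ℂ | z.re ≤ -1} ∪ {z : ℂ | 1 ≤ z.re}))ᶜ := rfl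
  rw [h, isOpen_compl_iff]
  refine (isClosed_eq Complex.continuous_im continuous_const).inter (IsClosed.union ?_ ?_)
  · exact isClosed_le Complex.continuous_re continuous_const
  · exact isClosed_le continuous_const Complex.continuous_re

lemma zero_mem_slitDomain : (0 : ℂ) ∈ slitDomain :=
  mem_slitDomain_of_norm_lt_one (by simp)

lemma conj_mem_slitDomain {z : ℂ} (hz : z ∈ slitDomain) : starRingEnd ℂ z ∈ slitDomain := by
  simpa [slitDomain] using hz

lemma isPreconnected_slitDomain : IsPreconnected slitDomain := by
  have h : StarConvex ℝ (0 : ℂ) slitDomain := by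
    rw [starConvex_zero_iff]
    intro z hz a ha0 ha1 ⟨him, hre⟩
    simp only [Complex.real_smul, Complex.mul_im, Complex.ofReal_re, Complex.ofReal_im, zero_mul,
      add_zero, Complex.mul_re, sub_zero] at him hre
    have ha : a ≠ 0 := by rintro rfl; norm_num at hre
    refine hz ⟨by simpa [ha] using him, ?_⟩
    rcases hre with h | h
    · left
      by_contra! hc
      have : a * z.re > a * -1 := mul_lt_mul_of_pos_left hc (lt_of_le_of_ne ha0 (Ne.symm ha))
      linarith
    · right
      by_contra! hc
      have : a * z.re < a * 1 := mul_lt_mul_of_pos_left hc (lt_of_le_of_ne ha0 (Ne.symm ha))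
      linarith
  exact (h.isPathConnected zero_mem_slitDomain).isConnected.isPreconnected

/-- The identity theorem on the slit domain. -/
lemma eqOn_slitDomain {E : Type*} [NormedAddCommGroup E] [NormedSpace ℂ E] [CompleteSpace E]
    {f g : ℂ → E} (hf : DifferentiableOn ℂ f slitDomain) (hg : DifferentiableOn ℂ g slitDomain)
    (h : ∀ z, ‖z‖ < 1 → f z = g z) : Set.EqOn f g slitDomain := by
  refine (hf.analyticOnNhd isOpen_slitDomain).eqOn_of_preconnected_of_eventuallyEq
    (hg.analyticOnNhd isOpen_slitDomain) isPreconnected_slitDomain zero_mem_slitDomain ?_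
  filter_upwards [Metric.ball_mem_nhds (0 : ℂ) one_pos] with z hz
  exact h z (by simpa using hz)

section

variable {K : Type*} [NormedAddCommGroup K] [InnerProductSpace ℂ K]

lemma mobius_apply {A : K →L[ℂ] K} {z : ℂ} (h : IsUnit (1 + z • A)) (y : K) :
    mobius A z (y + z • A y) = z • y + A y := by
  have e : mobius A z * (1 + z • A) = z • 1 + A := by
    rw [mobius, mul_assoc, Ring.inverse_mul_cancel _ h, mul_one]
  simpa using congrArg (fun T : K →L[ℂ] K => T y) e

lemma exists_add_smul_eq {A : K →L[ℂ] K} {z : ℂ} (h : IsUnit (1 + z • A)) (x : K) :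
    ∃ y, x = y + z • A y := by
  refine ⟨Ring.inverse (1 + z • A) x, ?_⟩
  simpa using congrArg (fun T : K →L[ℂ] K => T x) (Ring.mul_inverse_cancel _ h).symm

end

section

variable {M : Type*} [NormedAddCommGroup M] [InnerProductSpace ℂ M] [CompleteSpace M]
variable {K : Type*} [NormedAddCommGroup K] [InnerProductSpace ℂ K] [CompleteSpace K]

lemma commute_inverse {R : Type*} [MonoidWithZero R] {a b : R} (hb : IsUnit b) (h : Commute a b) :
    Commute a (Ring.inverse b) := by
  obtain ⟨u, rfl⟩ := hb
  rw [Ring.inverse_unit]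
  exact h.units_inv_right

/-! ### Imaginary parts of operators -/

lemma re_inner_imaginaryPart (T : M →L[ℂ] M) (x : M) :
    (⟪(ℑ T : M →L[ℂ] M) x, x⟫_ℂ).re = (⟪x, T x⟫_ℂ).im := by
  have h : T = (ℜ T : M →L[ℂ] M) + Complex.I • (ℑ T : M →L[ℂ] M) :=
    (realPart_add_I_smul_imaginaryPart T).symm
  have hr : (⟪x, (ℜ T : M →L[ℂ] M) x⟫_ℂ).im = 0 := by
    have h1 := (ContinuousLinearMap.isSelfAdjoint_iff_isSymmetric.1 (ℜ T).2) x x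
    have h2 := inner_conj_symm (𝕜 := ℂ) x ((ℜ T : M →L[ℂ] M) x)
    have h3 : ⟪(ℜ T : M →L[ℂ] M) x, x⟫_ℂ = ⟪x, (ℜ T : M →L[ℂ] M) x⟫_ℂ := h1
    rw [h3] at h2
    exact Complex.conj_eq_iff_im.1 h2
  have h1 := (ContinuousLinearMap.isSelfAdjoint_iff_isSymmetric.1 (ℑ T).2) x x
  have h3 : ⟪(ℑ T : M →L[ℂ] M) x, x⟫_ℂ = ⟪x, (ℑ T : M →L[ℂ] M) x⟫_ℂ := h1
  conv_rhs => rw [h]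
  rw [add_apply, smul_apply, inner_add_right, inner_smul_right, Complex.add_im, hr, h3]
  simp

lemma smul_imaginaryPart_nonneg_iff (T : M →L[ℂ] M) (y : ℝ) :
    0 ≤ y • (ℑ T : M →L[ℂ] M) ↔ ∀ x : M, 0 ≤ y * (⟪x, T x⟫_ℂ).im := by
  have e : ∀ x : M, (⟪(y • (ℑ T : M →L[ℂ] M)) x, x⟫_ℂ).re = y * (⟪x, T x⟫_ℂ).im := by
    intro x
    have : (y • (ℑ T : M →L[ℂ] M)) x = (y : ℂ) • (ℑ T : M →L[ℂ] M) x := rfl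
    rw [this, inner_smul_left, ← re_inner_imaginaryPart]
    simp
  constructor
  · intro h x
    rw [← e]
    exact re_inner_nonneg_of_nonneg h x
  · intro h
    refine nonneg_of_isSelfAdjoint ?_ fun x => by rw [e]; exact h x
    exact IsSelfAdjoint.smul (isSelfAdjoint_iff.2 (by simp)) (ℑ T).2

/-! ### The Möbius function of a selfadjoint contraction -/

lemma isUnit_one_add_smul {A : K →L[ℂ] K} (hA : IsSelfAdjointContraction A) {z : ℂ}
    (hz : z ∈ slitDomain) : IsUnit (1 + z • A) := by
  rcases subsingleton_or_nontrivial K with h | h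
  · exact isUnit_of_subsingleton _
  by_cases hz0 : z = 0
  · simp [hz0]
  have hns : -z⁻¹ ∉ spectrum ℂ A := by
    intro hs
    have h1 := hA.1.mem_spectrum_eq_re hs
    have h2 := (spectrum.norm_le_norm_of_mem hs).trans hA.2
    have h3 : z⁻¹ = (((z⁻¹).re : ℝ) : ℂ) := by
      rw [← neg_inj, h1]; simp
    set r := (z⁻¹).re with hr
    have hz' : z = ((r⁻¹ : ℝ) : ℂ) := by rw [← inv_inv z, h3]; simp
    have hr0 : r ≠ 0 := by rintro h0; rw [h0] at h3; simp [hz0] at h3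
    rw [norm_neg, h3, Complex.norm_real, Real.norm_eq_abs] at h2
    refine hz ⟨by rw [hz', Complex.ofReal_im], ?_⟩
    rw [hz', Complex.ofReal_re]
    have h4 : 1 ≤ |r⁻¹| := by
      rw [abs_inv]; exact (one_le_inv₀ (abs_pos.2 hr0)).2 h2
    rcases le_abs.1 h4 with h | h
    · right; exact h
    · left; linarith
  rw [spectrum.notMem_iff] at hns
  have e : 1 + z • A = (-z) • (algebraMap ℂ (K →L[ℂ] K) (-z⁻¹) - A) := by
    rw [Algebra.algebraMap_eq_smul_one, smul_sub, smul_smul, neg_mul_neg, mul_inv_cancel₀ hz0]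
    simp
  rw [e]
  exact hns.smul (Units.mk0 (-z) (neg_ne_zero.2 hz0))

lemma mobius_eq_mob (A : K →L[ℂ] K) (z : ℂ) : mobius A z = mob A z := rfl

lemma differentiableOn_mobius {A : K →L[ℂ] K} (hA : IsSelfAdjointContraction A) :
    DifferentiableOn ℂ (mobius A) slitDomain := fun _ hz =>
  (differentiableAt_mob (isUnit_one_add_smul hA hz)).differentiableWithinAt

lemma adjoint_mobius {A : K →L[ℂ] K} (hA : IsSelfAdjoint A) {z : ℂ} (h : IsUnit (1 + z • A)) :
    ContinuousLinearMap.adjoint (mobius A z) = mobius A (starRingEnd ℂ z) := by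
  rw [← ContinuousLinearMap.star_eq_adjoint, mobius, mobius, star_mul, ← Ring.inverse_star]
  have e1 : star (z • (1 : K →L[ℂ] K) + A) = starRingEnd ℂ z • 1 + A := by
    rw [star_add, star_smul, star_one, hA.star_eq]; rfl
  have e2 : star (1 + z • A) = 1 + starRingEnd ℂ z • A := by
    rw [star_add, star_smul, star_one, hA.star_eq]; rfl
  rw [e1, e2]
  refine (commute_inverse ?_ ?_).eq.symm
  · rw [← e2]; exact h.star
  refine Commute.add_left ?_ ?_
  · exact (Commute.one_left _).smul_left _
  · exact (Commute.one_right _).add_right ((Commute.refl A).smul_right _)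

lemma norm_add_smul_sq_sub {A : K →L[ℂ] K} (hA : IsSelfAdjoint A) (z : ℂ) (y : K) :
    ‖y + z • A y‖ ^ 2 - ‖z • y + A y‖ ^ 2 = (1 - ‖z‖ ^ 2) * (‖y‖ ^ 2 - ‖A y‖ ^ 2) := by
  have hs : ⟪A y, y⟫_ℂ = ⟪y, A y⟫_ℂ := (ContinuousLinearMap.isSelfAdjoint_iff_isSymmetric.1 hA) y y
  have hs' : (⟪y, A y⟫_ℂ).im = 0 :=
    Complex.conj_eq_iff_im.1 (by rw [inner_conj_symm, hs])
  have h1 := norm_add_sq (𝕜 := ℂ) y (z • A y)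
  have h2 := norm_add_sq (𝕜 := ℂ) (z • y) (A y)
  rw [inner_smul_right, norm_smul] at h1
  rw [inner_smul_left, norm_smul] at h2
  simp only [RCLike.re_eq_complex_re, Complex.mul_re, Complex.conj_re, hs', mul_zero] at h1 h2
  rw [h1, h2]
  ring

lemma norm_mobius_apply_le {A : K →L[ℂ] K} (hA : IsSelfAdjointContraction A) {z : ℂ}
    (hz : z ∈ slitDomain) (hz1 : ‖z‖ ≤ 1) (x : K) : ‖mobius A z x‖ ≤ ‖x‖ := by
  obtain ⟨y, rfl⟩ := exists_add_smul_eq (isUnit_one_add_smul hA hz) x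
  rw [mobius_apply (isUnit_one_add_smul hA hz)]
  have h := norm_add_smul_sq_sub hA.1 z y
  have h1 : ‖A y‖ ≤ ‖y‖ := (A.le_of_opNorm_le hA.2 y).trans_eq (one_mul _)
  have h2 : 0 ≤ (1 - ‖z‖ ^ 2) * (‖y‖ ^ 2 - ‖A y‖ ^ 2) := by
    refine mul_nonneg (sub_nonneg.2 (pow_le_one₀ (norm_nonneg _) hz1)) (sub_nonneg.2 ?_)
    gcongr
  exact le_of_sq_le_sq (by linarith) (norm_nonneg _)

lemma norm_mobius_le {A : K →L[ℂ] K} (hA : IsSelfAdjointContraction A) {z : ℂ}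
    (hz : z ∈ slitDomain) (hz1 : ‖z‖ ≤ 1) : ‖mobius A z‖ ≤ 1 :=
  ContinuousLinearMap.opNorm_le_bound _ zero_le_one fun x => by
    rw [one_mul]; exact norm_mobius_apply_le hA hz hz1 x

lemma adjoint_mul_mobius {A : K →L[ℂ] K} (hA : IsSelfAdjointContraction A) {z : ℂ}
    (hz : z ∈ slitDomain) (hz1 : ‖z‖ = 1) :
    ContinuousLinearMap.adjoint (mobius A z) * mobius A z = 1 := by
  refine (ContinuousLinearMap.norm_map_iff_adjoint_comp_self _).1 fun x => ?_
  obtain ⟨y, rfl⟩ := exists_add_smul_eq (isUnit_one_add_smul hA hz) x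
  rw [mobius_apply (isUnit_one_add_smul hA hz)]
  have h := norm_add_smul_sq_sub hA.1 z y
  rw [hz1] at h
  have h2 : ‖z • y + A y‖ ^ 2 = ‖y + z • A y‖ ^ 2 := by linarith
  exact (sq_eq_sq₀ (norm_nonneg _) (norm_nonneg _)).1 h2

lemma im_inner_mobius {A : K →L[ℂ] K} (hA : IsSelfAdjointContraction A) {z : ℂ}
    (hz : z ∈ slitDomain) (x : K) : 0 ≤ z.im * (⟪x, mobius A z x⟫_ℂ).im := by
  obtain ⟨y, rfl⟩ := exists_add_smul_eq (isUnit_one_add_smul hA hz) x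
  rw [mobius_apply (isUnit_one_add_smul hA hz)]
  have hs : ⟪A y, y⟫_ℂ = ⟪y, A y⟫_ℂ :=
    (ContinuousLinearMap.isSelfAdjoint_iff_isSymmetric.1 hA.1) y y
  have hs' : (⟪y, A y⟫_ℂ).im = 0 :=
    Complex.conj_eq_iff_im.1 (by rw [inner_conj_symm, hs])
  have h1 : ‖A y‖ ≤ ‖y‖ := (A.le_of_opNorm_le hA.2 y).trans_eq (one_mul _)
  have e : (⟪y + z • A y, z • y + A y⟫_ℂ).im = z.im * (‖y‖ ^ 2 - ‖A y‖ ^ 2) := by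
    rw [inner_add_left, inner_add_right, inner_add_right, inner_smul_left, inner_smul_left,
      inner_smul_right, inner_smul_right, hs, inner_self_eq_norm_sq_to_K,
      inner_self_eq_norm_sq_to_K]
    simp only [Complex.coe_algebraMap, ← Complex.ofReal_pow, Complex.add_im, Complex.mul_im,
      Complex.mul_re, Complex.conj_re, Complex.conj_im, Complex.ofReal_re, Complex.ofReal_im, hs']
    ring
  rw [e, ← mul_assoc]
  refine mul_nonneg (mul_self_nonneg _) (sub_nonneg.2 ?_)
  gcongr

/-! ### Compressions -/

/-- The compression as a continuous linear map of the operator. -/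
noncomputable def compressionL (J : M →ₗᵢ[ℂ] K) : (K →L[ℂ] K) →L[ℂ] (M →L[ℂ] M) :=
  (ContinuousLinearMap.compL ℂ M K M (ContinuousLinearMap.adjoint J.toContinuousLinearMap)).comp
    ((ContinuousLinearMap.compL ℂ M K K).flip J.toContinuousLinearMap)

@[simp] lemma compressionL_apply (J : M →ₗᵢ[ℂ] K) (T : K →L[ℂ] K) :
    compressionL J T = compression J T := rfl

lemma inner_compression (J : M →ₗᵢ[ℂ] K) (T : K →L[ℂ] K) (x y : M) :
    ⟪x, compression J T y⟫_ℂ = ⟪J x, T (J y)⟫_ℂ :=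
  ContinuousLinearMap.adjoint_inner_right J.toContinuousLinearMap x (T (J y))

lemma adjoint_compression (J : M →ₗᵢ[ℂ] K) (T : K →L[ℂ] K) :
    ContinuousLinearMap.adjoint (compression J T)
      = compression J (ContinuousLinearMap.adjoint T) := by
  simp only [compression, ContinuousLinearMap.adjoint_comp, ContinuousLinearMap.adjoint_adjoint]
  rfl

lemma adjoint_apply_apply (J : M →ₗᵢ[ℂ] K) (x : M) :
    ContinuousLinearMap.adjoint J.toContinuousLinearMap (J x) = x := by
  refine ext_inner_left ℂ fun y => ?_
  rw [ContinuousLinearMap.adjoint_inner_right]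
  exact J.inner_map_map y x

lemma compression_one (J : M →ₗᵢ[ℂ] K) : compression J 1 = 1 := by
  ext x
  exact adjoint_apply_apply J x

lemma norm_compression_le (J : M →ₗᵢ[ℂ] K) {T : K →L[ℂ] K} (hT : ‖T‖ ≤ 1) :
    ‖compression J T‖ ≤ 1 := by
  have hJ : ‖J.toContinuousLinearMap‖ ≤ 1 := J.norm_toContinuousLinearMap_le
  have hJ' : ‖ContinuousLinearMap.adjoint J.toContinuousLinearMap‖ ≤ 1 := by
    rwa [LinearIsometryEquiv.norm_map]
  refine (ContinuousLinearMap.opNorm_comp_le _ _).trans ?_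
  refine mul_le_one₀ hJ' (norm_nonneg _) ((ContinuousLinearMap.opNorm_comp_le _ _).trans ?_)
  exact mul_le_one₀ hT (norm_nonneg _) hJ

lemma neg_one_le_and_le_one {T : M →L[ℂ] M} (hT : IsSelfAdjoint T) (h : ‖T‖ ≤ 1) :
    -1 ≤ T ∧ T ≤ 1 := by
  have h1 := hT.le_algebraMap_norm_self
  have h2 := hT.neg_algebraMap_norm_le_self
  have h3 : algebraMap ℝ (M →L[ℂ] M) ‖T‖ ≤ 1 := by
    rw [Algebra.algebraMap_eq_smul_one]
    exact smul_le_of_le_one_left zero_le_one h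
  exact ⟨(neg_le_neg h3).trans h2, h1.trans h3⟩

/-- Compressions of Möbius functions of selfadjoint contractions are of class `RS`. -/
lemma isRS_compression {A : K →L[ℂ] K} (hA : IsSelfAdjointContraction A) (J : M →ₗᵢ[ℂ] K) :
    IsRS fun z => compression J (mobius A z) := by
  have hd : DifferentiableOn ℂ (fun z => compression J (mobius A z)) slitDomain :=
    (compressionL J).differentiable.comp_differentiableOn (differentiableOn_mobius hA)
  have hsym : ∀ z ∈ slitDomain, ContinuousLinearMap.adjoint (compression J (mobius A z))
      = compression J (mobius A (starRingEnd ℂ z)) := fun z hz => by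
    rw [adjoint_compression, adjoint_mobius hA.1 (isUnit_one_add_smul hA hz)]
  refine ⟨⟨hd.mono fun z hz => mem_slitDomain_of_im_ne_zero hz,
    fun z hz => hsym z (mem_slitDomain_of_im_ne_zero hz), fun z hz => ?_⟩, hd, fun x hx => ?_⟩
  · rw [smul_imaginaryPart_nonneg_iff]
    intro x
    rw [inner_compression]
    exact im_inner_mobius hA (mem_slitDomain_of_im_ne_zero hz) (J x)
  · have hx' := ofReal_mem_slitDomain hx
    refine neg_one_le_and_le_one ?_ (norm_compression_le J (norm_mobius_le hA hx' ?_))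
    · have := hsym x hx'
      rwa [Complex.conj_ofReal] at this
    · rw [Complex.norm_real, Real.norm_eq_abs]
      exact (abs_lt.2 hx).le

lemma isRS_mobius {A : K →L[ℂ] K} (hA : IsSelfAdjointContraction A) : IsRS (mobius A) := by
  have h := isRS_compression hA (LinearIsometry.id : K →ₗᵢ[ℂ] K)
  have e : (fun z => compression (LinearIsometry.id : K →ₗᵢ[ℂ] K) (mobius A z)) = mobius A := by
    funext z
    ext x
    refine ext_inner_left ℂ fun y => ?_
    rw [inner_compression]
    rfl
  rwa [e] at h

/-! ### Inner functions -/

lemma exp_mem_slitDomain {θ : ℝ} (hθ : Real.sin θ ≠ 0) :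
    Complex.exp (θ * Complex.I) ∈ slitDomain := by
  refine mem_slitDomain_of_im_ne_zero ?_
  rwa [Complex.exp_ofReal_mul_I_im]

lemma ae_sin_ne_zero : ∀ᵐ θ : ℝ, Real.sin θ ≠ 0 := by
  have h : Set.Countable {θ : ℝ | ¬ Real.sin θ ≠ 0} := by
    refine (Set.countable_range fun n : ℤ => (n : ℝ) * Real.pi).mono fun θ hθ => ?_
    obtain ⟨n, hn⟩ := Real.sin_eq_zero_iff.1 (not_not.1 hθ)
    exact ⟨n, hn⟩
  exact h.measure_zero _

/-- The unit circle without `±1` lies in the slit domain, so the boundary values there are the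
values of the function. -/
lemma isBoundaryValue_of_continuousOn {E : Type*} [NormedAddCommGroup E]
    [InnerProductSpace ℂ E] {Θ : ℂ → E →L[ℂ] E} (h : ContinuousOn Θ slitDomain) {θ : ℝ}
    (hθ : Real.sin θ ≠ 0) : IsBoundaryValue Θ θ (Θ (Complex.exp (θ * Complex.I))) := by
  intro x
  have hc : ContinuousAt Θ (Complex.exp (θ * Complex.I)) :=
    h.continuousAt (isOpen_slitDomain.mem_nhds (exp_mem_slitDomain hθ))
  have h2 : Filter.Tendsto (fun r : ℝ => (r : ℂ) * Complex.exp (θ * Complex.I)) (𝓝[<] 1)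
      (𝓝 (Complex.exp (θ * Complex.I))) := by
    have : Continuous fun r : ℝ => (r : ℂ) * Complex.exp (θ * Complex.I) := by fun_prop
    have h3 := this.tendsto 1
    rw [Complex.ofReal_one, one_mul] at h3
    exact h3.mono_left nhdsWithin_le_nhds
  exact ((ContinuousLinearMap.apply ℂ E x).continuous.tendsto _).comp (hc.tendsto.comp h2)

lemma isSchur_mobius {A : K →L[ℂ] K} (hA : IsSelfAdjointContraction A) : IsSchur (mobius A) := by
  have hb : ∀ z ∈ Metric.ball (0 : ℂ) 1, ‖z‖ < 1 := fun z hz => by simpa using hz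
  exact ⟨(differentiableOn_mobius hA).mono fun z hz => mem_slitDomain_of_norm_lt_one (hb z hz),
    fun z hz => norm_mobius_le hA (mem_slitDomain_of_norm_lt_one (hb z hz)) (hb z hz).le⟩

lemma isBiInner_mobius {A : K →L[ℂ] K} (hA : IsSelfAdjointContraction A) :
    IsBiInner (mobius A) := by
  have hc := (differentiableOn_mobius hA).continuousOn
  refine ⟨⟨isSchur_mobius hA, ?_⟩, ⟨isSchur_mobius hA, ?_⟩⟩
  · filter_upwards [ae_sin_ne_zero] with θ hθ
    exact ⟨_, isBoundaryValue_of_continuousOn hc hθ,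
      adjoint_mul_mobius hA (exp_mem_slitDomain hθ) (Complex.norm_exp_ofReal_mul_I θ)⟩
  · filter_upwards [ae_sin_ne_zero] with θ hθ
    refine ⟨_, isBoundaryValue_of_continuousOn hc hθ, ?_⟩
    have hz := exp_mem_slitDomain hθ
    have h := adjoint_mul_mobius hA (conj_mem_slitDomain hz)
      (by rw [RCLike.norm_conj]; exact Complex.norm_exp_ofReal_mul_I θ)
    rw [← adjoint_mobius hA.1 (isUnit_one_add_smul hA hz),
      ContinuousLinearMap.adjoint_adjoint] at h
    exact h

/-- If the compression is inner, its boundary value at a nonreal point `ζ` of the circle is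
isometric, so that `J M` is invariant under the unitary operator `mobius A ζ` and under its inverse
`mobius A (conj ζ)`. The projection onto `J M` thus commutes with `1 + ζ A`, hence with `A`. -/
lemma surjective_of_isInner {Ω : ℂ → M →L[ℂ] M} {J : M →ₗᵢ[ℂ] K} {A : K →L[ℂ] K}
    (hA : IsSelfAdjointContraction A) (hΩ : IsCompressionOf Ω J A) (hs : IsSimple J A)
    (hi : IsInner Ω) : Function.Surjective J := by
  have hΩd : DifferentiableOn ℂ Ω slitDomain := (isRS_compression hA J).holo.congr hΩ
  set Jc := J.toContinuousLinearMap with hJc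
  have hcirc : ∀ θ : ℝ, ‖Complex.exp (θ * Complex.I)‖ = 1 := Complex.norm_exp_ofReal_mul_I
  have hinv : ∀ θ : ℝ, (∃ V : M →L[ℂ] M, IsBoundaryValue Ω θ V ∧
      ContinuousLinearMap.adjoint V * V = 1) → Real.sin θ ≠ 0 → ∃ V : M →L[ℂ] M,
      ∀ x, mobius A (Complex.exp (θ * Complex.I)) (J x) = J (V x) := by
    rintro θ ⟨V, hV, hVV⟩ hθ
    have hD := exp_mem_slitDomain hθ
    refine ⟨V, fun x => ?_⟩
    have hVx : V x = ContinuousLinearMap.adjoint Jc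
        (mobius A (Complex.exp (θ * Complex.I)) (J x)) := by
      rw [tendsto_nhds_unique (hV x) (isBoundaryValue_of_continuousOn hΩd.continuousOn hθ x),
        hΩ _ hD]
      rfl
    have h1 : ‖mobius A (Complex.exp (θ * Complex.I)) (J x)‖ = ‖x‖ := by
      rw [(ContinuousLinearMap.norm_map_iff_adjoint_comp_self _).2
        (adjoint_mul_mobius hA hD (hcirc θ)), J.norm_map]
    have h2 : ‖J (V x)‖ = ‖x‖ := by
      rw [J.norm_map, (ContinuousLinearMap.norm_map_iff_adjoint_comp_self _).2 hVV]
    have h3 : ⟪mobius A (Complex.exp (θ * Complex.I)) (J x), J (V x)⟫_ℂ = ((‖x‖ ^ 2 : ℝ) : ℂ) := by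
      have := ContinuousLinearMap.adjoint_inner_left Jc (V x)
        (mobius A (Complex.exp (θ * Complex.I)) (J x))
      rw [← hVx, inner_self_eq_norm_sq_to_K, ← J.norm_map, h2] at this
      rw [Complex.ofReal_pow]
      exact this.symm
    rw [← sub_eq_zero, ← norm_eq_zero, ← sq_eq_zero_iff, norm_sub_sq (𝕜 := ℂ), h3, h1, h2]
    simp only [RCLike.re_eq_complex_re, Complex.ofReal_re]
    ring
  have hneg : ∀ᵐ θ : ℝ, ∃ V : M →L[ℂ] M, IsBoundaryValue Ω (-θ) V ∧
      ContinuousLinearMap.adjoint V * V = 1 :=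
    (MeasureTheory.Measure.measurePreserving_neg
      (MeasureTheory.volume : MeasureTheory.Measure ℝ)).quasiMeasurePreserving.ae hi.2
  obtain ⟨θ, ⟨h1, h2⟩, hθ⟩ := ((hi.2.and hneg).and ae_sin_ne_zero).exists
  obtain ⟨V, hV⟩ := hinv θ h1 hθ
  obtain ⟨W, hW⟩ := hinv (-θ) h2 (by rwa [Real.sin_neg, neg_ne_zero])
  have hζD : Complex.exp (θ * Complex.I) ∈ slitDomain := exp_mem_slitDomain hθ
  have hconj : Complex.exp ((-θ : ℝ) * Complex.I)
      = starRingEnd ℂ (Complex.exp (θ * Complex.I)) := by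
    rw [← Complex.exp_conj, map_mul, Complex.conj_ofReal, Complex.conj_I]
    push_cast
    ring_nf
  rw [hconj, ← adjoint_mobius hA.1 (isUnit_one_add_smul hA hζD)] at hW
  set ζ := Complex.exp (θ * Complex.I) with hζ
  set E : K →L[ℂ] K := Jc.comp (ContinuousLinearMap.adjoint Jc) with hE
  have hEJ : ∀ x, E (J x) = J x := fun x => congrArg J (adjoint_apply_apply J x)
  have hEs : ContinuousLinearMap.adjoint E = E := by
    rw [hE, ContinuousLinearMap.adjoint_comp, ContinuousLinearMap.adjoint_adjoint]
  have hcomm : Commute E (mobius A ζ) := by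
    have e1 : E * mobius A ζ * E = mobius A ζ * E := by
      ext x
      change E (mobius A ζ (J (ContinuousLinearMap.adjoint Jc x)))
        = mobius A ζ (J (ContinuousLinearMap.adjoint Jc x))
      rw [hV, hEJ]
    have e2 : E * ContinuousLinearMap.adjoint (mobius A ζ) * E
        = ContinuousLinearMap.adjoint (mobius A ζ) * E := by
      ext x
      change E (ContinuousLinearMap.adjoint (mobius A ζ) (J (ContinuousLinearMap.adjoint Jc x)))
        = ContinuousLinearMap.adjoint (mobius A ζ) (J (ContinuousLinearMap.adjoint Jc x))
      rw [hW, hEJ]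
    have e3 := congrArg star e2
    rw [star_mul, star_mul, star_mul, ← ContinuousLinearMap.star_eq_adjoint, star_star] at e3
    rw [ContinuousLinearMap.star_eq_adjoint E, hEs, ← mul_assoc, e1] at e3
    exact e3.symm
  have hu := isUnit_one_add_smul hA hζD
  have hζ0 : ζ ≠ 0 := Complex.exp_ne_zero _
  have hζ1 : ζ ^ 2 - 1 ≠ 0 := by
    intro h0
    rw [sub_eq_zero, pow_two, mul_self_eq_one_iff] at h0
    rcases h0 with h | h
    all_goals
      have him := congrArg Complex.im h
      rw [hζ, Complex.exp_ofReal_mul_I_im] at him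
      exact hθ (by simpa using him)
  have hR : Commute E (Ring.inverse (1 + ζ • A)) := by
    have e : Ring.inverse (1 + ζ • A) = (ζ ^ 2 - 1)⁻¹ • (ζ • mobius A ζ - 1) := by
      rw [mobius_eq_mob, smul_mob hu, add_sub_cancel_left, inv_smul_smul₀ hζ1]
    rw [e]
    exact ((hcomm.smul_right ζ).sub_right (Commute.one_right E)).smul_right _
  have hAE : Commute E A := by
    have h1 : Commute E (1 + ζ • A) := by
      have := commute_inverse hu.ringInverse hR
      rwa [Ring.inverse_inverse hu] at this
    have e : A = ζ⁻¹ • ((1 + ζ • A) - 1) := by rw [add_sub_cancel_left, inv_smul_smul₀ hζ0]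
    rw [e]
    exact (h1.sub_right (Commute.one_right E)).smul_right _
  have hrange : ∀ (n : ℕ) (x : M), (A ^ n) (J x) ∈ LinearMap.range J.toLinearMap := by
    intro n x
    refine ⟨ContinuousLinearMap.adjoint Jc ((A ^ n) (J x)), ?_⟩
    have h := congrArg (fun T : K →L[ℂ] K => T (J x)) (hAE.pow_right n).eq
    change E ((A ^ n) (J x)) = (A ^ n) (E (J x)) at h
    rw [hEJ] at h
    exact h
  have hcl : IsClosed ((LinearMap.range J.toLinearMap : Submodule ℂ K) : Set K) := by
    exact J.isometry.isClosedEmbedding.isClosed_range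
  have htop : (⊤ : Submodule ℂ K) ≤ LinearMap.range J.toLinearMap := by
    rw [← hs]
    refine Submodule.topologicalClosure_minimal _ (Submodule.span_le.2 ?_) hcl
    rintro y ⟨n, x, rfl⟩
    exact hrange n x
  intro y
  obtain ⟨x, hx⟩ := htop (Submodule.mem_top (x := y))
  exact ⟨x, hx⟩

lemma isInner_of_surjective {Ω : ℂ → M →L[ℂ] M} {J : M →ₗᵢ[ℂ] K} {A : K →L[ℂ] K}
    (hA : IsSelfAdjointContraction A) (hΩ : IsCompressionOf Ω J A)
    (hs : Function.Surjective J) : IsInner Ω := by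
  have hΩd : DifferentiableOn ℂ Ω slitDomain := (isRS_compression hA J).holo.congr hΩ
  have hb : ∀ z ∈ Metric.ball (0 : ℂ) 1, z ∈ slitDomain := fun z hz =>
    mem_slitDomain_of_norm_lt_one (by simpa using hz)
  refine ⟨⟨hΩd.mono hb, fun z hz => ?_⟩, ?_⟩
  · rw [hΩ z (hb z hz)]
    exact norm_compression_le J ((isSchur_mobius hA).contr z hz)
  · filter_upwards [ae_sin_ne_zero] with θ hθ
    refine ⟨_, isBoundaryValue_of_continuousOn hΩd.continuousOn hθ, ?_⟩
    have hz := exp_mem_slitDomain hθ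
    refine (ContinuousLinearMap.norm_map_iff_adjoint_comp_self _).1 fun x => ?_
    have h1 := (ContinuousLinearMap.norm_map_iff_adjoint_comp_self _).2
      (adjoint_mul_mobius hA hz (Complex.norm_exp_ofReal_mul_I θ)) (J x)
    obtain ⟨y, hy⟩ := hs (mobius A (Complex.exp (θ * Complex.I)) (J x))
    rw [hΩ _ hz]
    have h2 : compression J (mobius A (Complex.exp (θ * Complex.I))) x = y := by
      change ContinuousLinearMap.adjoint J.toContinuousLinearMap
        (mobius A (Complex.exp (θ * Complex.I)) (J x)) = y
      rw [← hy, adjoint_apply_apply]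
    rw [h2, ← J.norm_map y, hy, h1, J.norm_map]

end

/-! ### Uniqueness of simple representations -/

section

variable {K₁ : Type*} [NormedAddCommGroup K₁] [InnerProductSpace ℂ K₁] [CompleteSpace K₁]
variable {K₂ : Type*} [NormedAddCommGroup K₂] [InnerProductSpace ℂ K₂] [CompleteSpace K₂]

/-- Two total families with the same Gram matrix are unitarily equivalent. -/
lemma exists_linearIsometryEquiv_of_inner_eq {ι : Type*} (e : ι → K₁) (f : ι → K₂)
    (he : (Submodule.span ℂ (Set.range e)).topologicalClosure = ⊤)
    (hf : (Submodule.span ℂ (Set.range f)).topologicalClosure = ⊤)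
    (h : ∀ i j, ⟪e i, e j⟫_ℂ = ⟪f i, f j⟫_ℂ) : ∃ U : K₁ ≃ₗᵢ[ℂ] K₂, ∀ i, U (e i) = f i := by
  let E : (ι →₀ ℂ) →ₗ[ℂ] K₁ := Finsupp.linearCombination ℂ e
  let F : (ι →₀ ℂ) →ₗ[ℂ] K₂ := Finsupp.linearCombination ℂ f
  have dE : DenseRange E := by
    rw [← Submodule.dense_iff_topologicalClosure_eq_top, ← Finsupp.range_linearCombination] at he
    exact he
  have dF : DenseRange F := by
    rw [← Submodule.dense_iff_topologicalClosure_eq_top, ← Finsupp.range_linearCombination] at hf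
    exact hf
  have hn : ∀ v, ‖F v‖ = ‖E v‖ := by
    intro v
    have : ⟪F v, F v⟫_ℂ = ⟪E v, E v⟫_ℂ := by
      simp only [E, F, Finsupp.linearCombination_apply, Finsupp.sum_inner, Finsupp.inner_sum,
        inner_smul_left, inner_smul_right, h]
    rw [inner_self_eq_norm_sq_to_K, inner_self_eq_norm_sq_to_K] at this
    have h2 : ‖F v‖ ^ 2 = ‖E v‖ ^ 2 := by exact_mod_cast this
    exact (sq_eq_sq₀ (norm_nonneg _) (norm_nonneg _)).1 h2
  let T : K₁ →L[ℂ] K₂ := F.extendOfNorm E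
  have hT : ∀ v, T (E v) = F v := fun v =>
    LinearMap.extendOfNorm_eq dE ⟨1, fun v => by rw [one_mul, hn]⟩ v
  have hTn : ∀ x, ‖T x‖ = ‖x‖ := by
    intro x
    refine dE.induction_on (p := fun x => ‖T x‖ = ‖x‖) x ?_ fun v => ?_
    · exact isClosed_eq T.continuous.norm continuous_norm
    · rw [hT, hn]
  let U₀ : K₁ →ₗᵢ[ℂ] K₂ := ⟨T.toLinearMap, hTn⟩
  have hsurj : Function.Surjective U₀ := by
    have hcl : IsClosed (Set.range U₀) := U₀.isometry.isClosedEmbedding.isClosed_range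
    intro y
    refine dF.induction_on (p := fun y => y ∈ Set.range U₀) y hcl fun v => ⟨E v, hT v⟩
  refine ⟨LinearIsometryEquiv.ofSurjective U₀ hsurj, fun i => ?_⟩
  have := hT (Finsupp.single i 1)
  simp only [E, F, Finsupp.linearCombination_single, one_smul] at this
  exact this

variable {M : Type*} [NormedAddCommGroup M] [InnerProductSpace ℂ M] [CompleteSpace M]

lemma inner_pow_apply (J : M →ₗᵢ[ℂ] K₁) {A : K₁ →L[ℂ] K₁} (hA : IsSelfAdjoint A) (m n : ℕ)
    (x y : M) : ⟪(A ^ m) (J x), (A ^ n) (J y)⟫_ℂ = ⟪x, compression J (A ^ (m + n)) y⟫_ℂ := by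
  rw [inner_compression, pow_add]
  exact (ContinuousLinearMap.isSelfAdjoint_iff_isSymmetric.1 (hA.pow m)) _ _

lemma compression_resolvent {Ω : ℂ → M →L[ℂ] M} {J : M →ₗᵢ[ℂ] K₁} {A : K₁ →L[ℂ] K₁}
    (hA : IsSelfAdjointContraction A) (h : IsCompressionOf Ω J A) {z : ℂ} (hz : ‖z‖ < 1)
    {b : K₁ →L[ℂ] K₁} (hb : (1 + z • A) * b = 1) :
    compression J b = (z ^ 2 - 1)⁻¹ • (z • Ω z - 1) := by
  have hz' := mem_slitDomain_of_norm_lt_one hz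
  rw [h z hz', eq_smul_of_resolvent hz (isUnit_one_add_smul hA hz') hb, ← compressionL_apply,
    map_smul, map_sub, map_smul, compressionL_apply, compressionL_apply, compression_one,
    mobius_eq_mob]

/-- The resolvents of `A₁` and `A₂` at the same point have the same compression. As pairs
`(X, Y)` with equal compressions form a closed subspace of the product algebra, the powers of
`A₁` and `A₂` have the same compressions as well. -/
lemma compression_pow_eq {Ω : ℂ → M →L[ℂ] M} {J₁ : M →ₗᵢ[ℂ] K₁} {A₁ : K₁ →L[ℂ] K₁}
    {J₂ : M →ₗᵢ[ℂ] K₂} {A₂ : K₂ →L[ℂ] K₂}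
    (hA₁ : IsSelfAdjointContraction A₁) (h₁ : IsCompressionOf Ω J₁ A₁)
    (hA₂ : IsSelfAdjointContraction A₂) (h₂ : IsCompressionOf Ω J₂ A₂) (n : ℕ) :
    compression J₁ (A₁ ^ n) = compression J₂ (A₂ ^ n) := by
  let B := (K₁ →L[ℂ] K₁) × (K₂ →L[ℂ] K₂)
  let L₁ : B →L[ℂ] (M →L[ℂ] M) := (compressionL J₁).comp (ContinuousLinearMap.fst ℂ _ _)
  let L₂ : B →L[ℂ] (M →L[ℂ] M) := (compressionL J₂).comp (ContinuousLinearMap.snd ℂ _ _)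
  let V : Submodule ℂ B := LinearMap.eqLocus L₁.toLinearMap L₂.toLinearMap
  have hV : IsClosed (V : Set B) := isClosed_eq L₁.continuous L₂.continuous
  have ha : ‖((A₁, A₂) : B)‖ ≤ 1 := by
    rw [Prod.norm_def]; exact max_le hA₁.2 hA₂.2
  have key := pow_mem_of_resolvent_mem ha V hV (fun z b hz hb => ?_) n
  · exact key
  · change compression J₁ b.1 = compression J₂ b.2
    rw [compression_resolvent hA₁ h₁ hz (congrArg Prod.fst hb),
      compression_resolvent hA₂ h₂ hz (congrArg Prod.snd hb)]

lemma isSimple_iff {E F : Type*} [NormedAddCommGroup E] [InnerProductSpace ℂ E]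
    [NormedAddCommGroup F] [InnerProductSpace ℂ F] (J : E →ₗᵢ[ℂ] F) (A : F →L[ℂ] F) :
    IsSimple J A ↔
    (Submodule.span ℂ (Set.range fun p : ℕ × E => (A ^ p.1) (J p.2))).topologicalClosure = ⊤ := by
  have h : {y : F | ∃ (n : ℕ) (x : E), y = (A ^ n) (J x)}
      = Set.range fun p : ℕ × E => (A ^ p.1) (J p.2) := by
    ext y
    constructor
    · rintro ⟨n, x, rfl⟩; exact ⟨(n, x), rfl⟩
    · rintro ⟨⟨n, x⟩, rfl⟩; exact ⟨n, x, rfl⟩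
  rw [IsSimple, h]

lemma exists_unitary_of_isSimple {Ω : ℂ → M →L[ℂ] M} {J₁ : M →ₗᵢ[ℂ] K₁} {A₁ : K₁ →L[ℂ] K₁}
    {J₂ : M →ₗᵢ[ℂ] K₂} {A₂ : K₂ →L[ℂ] K₂}
    (hA₁ : IsSelfAdjointContraction A₁) (h₁ : IsCompressionOf Ω J₁ A₁) (hs₁ : IsSimple J₁ A₁)
    (hA₂ : IsSelfAdjointContraction A₂) (h₂ : IsCompressionOf Ω J₂ A₂) (hs₂ : IsSimple J₂ A₂) :
    ∃ U : K₁ ≃ₗᵢ[ℂ] K₂, (∀ x : M, U (J₁ x) = J₂ x) ∧ ∀ y : K₁, A₂ (U y) = U (A₁ y) := by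
  rw [isSimple_iff] at hs₁ hs₂
  obtain ⟨U, hU⟩ := exists_linearIsometryEquiv_of_inner_eq _ _ hs₁ hs₂ fun p q => by
    rw [inner_pow_apply J₁ hA₁.1, inner_pow_apply J₂ hA₂.1,
      compression_pow_eq hA₁ h₁ hA₂ h₂]
  refine ⟨U, fun x => by simpa using hU (0, x), fun y => ?_⟩
  have hd : Dense (Submodule.span ℂ (Set.range fun p : ℕ × M => (A₁ ^ p.1) (J₁ p.2)) : Set K₁) :=
    Submodule.dense_iff_topologicalClosure_eq_top.2 hs₁
  let L : K₁ →L[ℂ] K₂ := A₂.comp U.toContinuousLinearEquiv.toContinuousLinearMap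
  let R : K₁ →L[ℂ] K₂ := U.toContinuousLinearEquiv.toContinuousLinearMap.comp A₁
  have hLR : L = R := by
    refine ContinuousLinearMap.ext_on hd ?_
    rintro _ ⟨⟨n, x⟩, rfl⟩
    change A₂ (U ((A₁ ^ n) (J₁ x))) = U (A₁ ((A₁ ^ n) (J₁ x)))
    have e1 := hU (n, x)
    have e2 := hU (n + 1, x)
    simp only at e1 e2
    rw [e1]
    rw [pow_succ', pow_succ'] at e2
    exact e2.symm
  exact congrArg (fun T : K₁ →L[ℂ] K₂ => T y) hLR

end

/-! ### The Carathéodory function attached to a function of class `RS` -/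

lemma norm_add_conj_le {ζ w : ℂ} (hζ : ‖ζ‖ = 1) (h : ζ.im * w.im ≤ 0) :
    ‖ζ + w‖ ≤ ‖1 + ζ * w‖ := by
  have h1 : Complex.normSq ζ = 1 := by rw [Complex.normSq_eq_norm_sq, hζ, one_pow]
  rw [← sq_le_sq₀ (norm_nonneg _) (norm_nonneg _), ← Complex.normSq_eq_norm_sq,
    ← Complex.normSq_eq_norm_sq]
  rw [Complex.normSq_apply] at h1 ⊢
  rw [Complex.normSq_apply]
  simp only [Complex.add_re, Complex.add_im, Complex.mul_re, Complex.mul_im, Complex.one_re,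
    Complex.one_im]
  have e : (1 + (ζ.re * w.re - ζ.im * w.im)) * (1 + (ζ.re * w.re - ζ.im * w.im))
      + (0 + (ζ.re * w.im + ζ.im * w.re)) * (0 + (ζ.re * w.im + ζ.im * w.re))
      = 1 + 2 * (ζ.re * w.re - ζ.im * w.im)
        + (ζ.re * ζ.re + ζ.im * ζ.im) * (w.re * w.re + w.im * w.im) := by ring
  rw [e, h1]
  nlinarith

/-- A holomorphic function on the disk whose imaginary part is opposite in sign to that of the
variable, and which is bounded by one on the diameter, satisfies the Schwarz-Pick type inequality
below: the quotient of the two sides is holomorphic in the disk and at most one on the circle. The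
denominator has no zeros, since `1 + ζ f = 0` makes `f = -ζ⁻¹`, with imaginary part of the same
sign as that of `ζ`. -/
lemma norm_mul_add_le {f : ℂ → ℂ} (hf : DifferentiableOn ℂ f (Metric.ball 0 1))
    (him : ∀ ζ ∈ Metric.ball (0 : ℂ) 1, ζ.im * (f ζ).im ≤ 0)
    (hre : ∀ x : ℝ, x ∈ Set.Ioo (-1 : ℝ) 1 → ‖f x‖ ≤ 1) {ζ : ℂ} (hζ : ζ ∈ Metric.ball (0 : ℂ) 1) :
    ‖ζ * (ζ + f ζ)‖ ≤ ‖1 + ζ * f ζ‖ := by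
  have key : ∀ s : ℝ, s ∈ Set.Ioo (0 : ℝ) 1 →
      ‖ζ * (ζ + s * f (s * ζ))‖ ≤ ‖1 + ζ * (s * f (s * ζ))‖ := by
    -- both the variable and the function are shrunk, which makes the function holomorphic on the
    -- closed disk and strictly bounded by one on the closed diameter
    intro s hs
    have hmaps : ∀ w : ℂ, ‖w‖ ≤ 1 → (s : ℂ) * w ∈ Metric.ball (0 : ℂ) 1 := by
      intro w hw
      rw [mem_ball_zero_iff, norm_mul, Complex.norm_real, Real.norm_eq_abs, abs_of_pos hs.1]
      exact (mul_le_of_le_one_right hs.1.le hw).trans_lt hs.2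
    have him' : ∀ w : ℂ, ‖w‖ ≤ 1 → w.im * ((s : ℂ) * f (s * w)).im ≤ 0 := by
      intro w hw
      have := him _ (hmaps w hw)
      rw [Complex.im_ofReal_mul] at this ⊢
      linarith
    have hden : ∀ w : ℂ, ‖w‖ ≤ 1 → 1 + w * (s * f (s * w)) ≠ 0 := by
      intro w hw h0
      have hw0 : w ≠ 0 := by rintro rfl; simp at h0
      have e : (s : ℂ) * f (s * w) = -w⁻¹ := by
        field_simp
        linear_combination h0
      have h1 := him' w hw
      rw [e, Complex.neg_im, Complex.inv_im] at h1
      have hn : 0 < Complex.normSq w := Complex.normSq_pos.2 hw0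
      have h2 : w.im = 0 := by
        have h3 : w.im * -(-w.im / Complex.normSq w) = w.im ^ 2 / Complex.normSq w := by ring
        rw [h3] at h1
        have h4 : w.im ^ 2 ≤ 0 := by
          by_contra! hc
          exact absurd h1 (not_le.2 (div_pos hc hn))
        exact pow_eq_zero_iff two_ne_zero |>.1 (le_antisymm h4 (sq_nonneg _))
      have hwr : w = (w.re : ℂ) := Complex.ext (by simp) (by simp [h2])
      have h3 : ‖f (s * w)‖ ≤ 1 := by
        rw [hwr, ← Complex.ofReal_mul]
        refine hre _ ?_
        have h4 := hmaps w hw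
        rw [hwr, ← Complex.ofReal_mul, mem_ball_zero_iff, Complex.norm_real, Real.norm_eq_abs] at h4
        exact abs_lt.1 h4
      have h5 : ‖w * (s * f (s * w))‖ < 1 := by
        rw [norm_mul, norm_mul, Complex.norm_real, Real.norm_eq_abs, abs_of_pos hs.1]
        calc ‖w‖ * (s * ‖f (s * w)‖) ≤ 1 * (s * 1) := by
              have := hs.1
              gcongr
          _ < 1 := by linarith [hs.2]
      have h6 : w * (s * f (s * w)) = -1 := by linear_combination h0
      rw [h6] at h5
      simp at h5
    let g : ℂ → ℂ := fun w => w * (w + s * f (s * w)) / (1 + w * (s * f (s * w)))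
    have hfs : ∀ w : ℂ, ‖w‖ ≤ 1 → DifferentiableAt ℂ (fun w : ℂ => f (s * w)) w := by
      intro w hw
      have h1 : DifferentiableAt ℂ f (s * w) :=
        hf.differentiableAt (Metric.isOpen_ball.mem_nhds (hmaps w hw))
      exact DifferentiableAt.comp (f := fun w : ℂ => (s : ℂ) * w) w h1 (by fun_prop)
    have hgd : ∀ w : ℂ, ‖w‖ ≤ 1 → DifferentiableAt ℂ g w := by
      intro w hw
      have h1 := hfs w hw
      have h2 := h1.const_mul (s : ℂ)
      exact (differentiableAt_id.mul (differentiableAt_id.add h2)).div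
        ((differentiableAt_id.mul h2).const_add 1) (hden w hw)
    have hcl : DiffContOnCl ℂ g (Metric.ball 0 1) := by
      refine DifferentiableOn.diffContOnCl fun w hw => ?_
      rw [closure_ball _ one_ne_zero] at hw
      exact (hgd w (by simpa using hw)).differentiableWithinAt
    have hfr : ∀ w ∈ frontier (Metric.ball (0 : ℂ) 1), ‖g w‖ ≤ 1 := by
      intro w hw
      rw [frontier_ball _ one_ne_zero, mem_sphere_zero_iff_norm] at hw
      have h1 := norm_add_conj_le hw (him' w hw.le)
      rw [norm_div, norm_mul, hw, one_mul]
      exact div_le_one_of_le₀ h1 (norm_nonneg _)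
    have hle := Complex.norm_le_of_forall_mem_frontier_norm_le Metric.isBounded_ball hcl hfr
      (subset_closure hζ)
    have hζ1 : ‖ζ‖ ≤ 1 := by simpa using (mem_ball_zero_iff.1 hζ).le
    have hpos : 0 < ‖1 + ζ * (s * f (s * ζ))‖ := norm_pos_iff.2 (hden ζ hζ1)
    rw [norm_div] at hle
    exact (div_le_one hpos).1 hle
  have hfc : ContinuousAt (fun s : ℝ => f (s * ζ)) 1 := by
    have h1 : ContinuousAt f (((1 : ℝ) : ℂ) * ζ) := by
      rw [Complex.ofReal_one, one_mul]
      exact (hf.differentiableAt (Metric.isOpen_ball.mem_nhds hζ)).continuousAt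
    exact ContinuousAt.comp (f := fun s : ℝ => (s : ℂ) * ζ) h1 (by fun_prop)
  have hsf : ContinuousAt (fun s : ℝ => (s : ℂ) * f (s * ζ)) 1 :=
    Complex.continuous_ofReal.continuousAt.mul hfc
  have hL : ContinuousAt (fun s : ℝ => ‖ζ * (ζ + s * f (s * ζ))‖) 1 :=
    (continuousAt_const.mul (continuousAt_const.add hsf)).norm
  have hR : ContinuousAt (fun s : ℝ => ‖1 + ζ * (s * f (s * ζ))‖) 1 :=
    (continuousAt_const.add (continuousAt_const.mul hsf)).norm
  have := le_of_tendsto_of_tendsto (hL.tendsto.mono_left (nhdsWithin_le_nhds (s := Set.Iio 1)))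
    (hR.tendsto.mono_left nhdsWithin_le_nhds) (by
      filter_upwards [Ioo_mem_nhdsLT (show (0 : ℝ) < 1 by norm_num)] with s hs using key s hs)
  simpa using this

/-- The map from the unit disk onto the slit domain. -/
noncomputable def diskMap (ζ : ℂ) : ℂ := -(2 * ζ) / (1 + ζ ^ 2)

lemma one_add_sq_ne_zero {ζ : ℂ} (h : ‖ζ‖ < 1) : 1 + ζ ^ 2 ≠ 0 := by
  intro h0
  have h1 : ‖ζ ^ 2‖ = 1 := by rw [eq_neg_of_add_eq_zero_right h0, norm_neg, norm_one]
  rw [norm_pow] at h1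
  have : ‖ζ‖ ^ 2 < 1 := pow_lt_one₀ (norm_nonneg _) h two_ne_zero
  linarith

lemma one_sub_sq_ne_zero {ζ : ℂ} (h : ‖ζ‖ < 1) : 1 - ζ ^ 2 ≠ 0 := by
  intro h0
  have h1 : ‖ζ ^ 2‖ = 1 := by rw [← sub_eq_zero.1 h0, norm_one]
  rw [norm_pow] at h1
  have : ‖ζ‖ ^ 2 < 1 := pow_lt_one₀ (norm_nonneg _) h two_ne_zero
  linarith

lemma diskMap_im {ζ : ℂ} (h : ‖ζ‖ < 1) : ∃ c : ℝ, 0 < c ∧ (diskMap ζ).im = -c * ζ.im := by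
  have hn : 0 < Complex.normSq (1 + ζ ^ 2) := Complex.normSq_pos.2 (one_add_sq_ne_zero h)
  have h1 : Complex.normSq ζ < 1 := by
    rw [Complex.normSq_eq_norm_sq]; exact pow_lt_one₀ (norm_nonneg _) h two_ne_zero
  refine ⟨2 * (1 - Complex.normSq ζ) / Complex.normSq (1 + ζ ^ 2),
    div_pos (by linarith) hn, ?_⟩
  rw [diskMap, Complex.div_im]
  field_simp
  rw [Complex.normSq_apply]
  simp only [pow_two, Complex.add_re, Complex.add_im, Complex.mul_re, Complex.mul_im,
    Complex.one_re, Complex.one_im, Complex.neg_re, Complex.neg_im, Complex.re_ofNat,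
    Complex.im_ofNat]
  ring

lemma diskMap_ofReal_mem {x : ℝ} (hx : x ∈ Set.Ioo (-1 : ℝ) 1) :
    ∃ y ∈ Set.Ioo (-1 : ℝ) 1, diskMap x = y := by
  refine ⟨-(2 * x) / (1 + x ^ 2), ⟨?_, ?_⟩, by rw [diskMap]; push_cast; ring⟩
  · rw [lt_div_iff₀ (by positivity)]
    nlinarith [sq_pos_of_pos (sub_pos.2 hx.2)]
  · rw [div_lt_iff₀ (by positivity)]; nlinarith [sq_pos_of_pos (sub_pos.2 hx.1)]

lemma diskMap_mem {ζ : ℂ} (h : ‖ζ‖ < 1) : diskMap ζ ∈ slitDomain := by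
  by_cases h0 : ζ.im = 0
  · have hr : ζ = (ζ.re : ℂ) := Complex.ext (by simp) (by simp [h0])
    rw [hr, Complex.norm_real, Real.norm_eq_abs] at h
    obtain ⟨y, hy, e⟩ := diskMap_ofReal_mem (abs_lt.1 h)
    rw [hr, e]
    exact ofReal_mem_slitDomain hy
  · obtain ⟨c, hc, e⟩ := diskMap_im h
    refine mem_slitDomain_of_im_ne_zero ?_
    rw [e]
    exact mul_ne_zero (neg_ne_zero.2 hc.ne') h0

lemma exists_diskMap_eq {z : ℂ} (hz : z ∈ slitDomain) : ∃ ζ : ℂ, ‖ζ‖ < 1 ∧ diskMap ζ = z := by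
  by_cases hz0 : z = 0
  · exact ⟨0, by simp, by simp [diskMap, hz0]⟩
  -- the two roots of the quadratic equation `z (1 + ζ²) + 2 ζ = 0` have product one
  obtain ⟨d, hd⟩ := IsAlgClosed.exists_pow_nat_eq (1 - z ^ 2) (n := 2) (by norm_num)
  have main : ∀ ζ : ℂ, z * (1 + ζ ^ 2) + 2 * ζ = 0 → ‖ζ‖ < 1 → diskMap ζ = z := by
    intro ζ h h1
    rw [diskMap, div_eq_iff (one_add_sq_ne_zero h1)]
    linear_combination -h
  have hroot : ∀ e : ℂ, e ^ 2 = 1 - z ^ 2 →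
      z * (1 + ((-1 + e) / z) ^ 2) + 2 * ((-1 + e) / z) = 0 := by
    intro e he
    field_simp
    linear_combination he
  have hprod : ((-1 + d) / z) * ((-1 + -d) / z) = 1 := by
    field_simp
    linear_combination -hd
  have hne : ∀ ζ : ℂ, z * (1 + ζ ^ 2) + 2 * ζ = 0 → ‖ζ‖ ≠ 1 := by
    -- on the unit circle `z = -1 / Re ζ`
    intro ζ h h1
    have hc : ζ * starRingEnd ℂ ζ = 1 := by
      rw [Complex.mul_conj, Complex.normSq_eq_norm_sq, h1]; simp
    have hζ0 : ζ ≠ 0 := by rintro rfl; simp at h1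
    have h2 : z * (ζ.re : ℂ) = -1 := by
      have h3 : ζ + starRingEnd ℂ ζ = 2 * (ζ.re : ℂ) := by rw [Complex.add_conj]; push_cast; ring
      have h4 : ζ * (z * (2 * (ζ.re : ℂ)) + 2) = 0 := by
        rw [← h3]; linear_combination h + z * hc
      have h5 := (mul_eq_zero.1 h4).resolve_left hζ0
      linear_combination h5 / 2
    have hre := congrArg Complex.re h2
    have him := congrArg Complex.im h2
    simp only [Complex.mul_re, Complex.mul_im, Complex.ofReal_re, Complex.ofReal_im, mul_zero,
      sub_zero, zero_add, Complex.neg_re, Complex.neg_im, Complex.one_re, Complex.one_im,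
      neg_zero] at hre him
    have hr0 : ζ.re ≠ 0 := by intro h0; rw [h0] at hre; norm_num at hre
    have hr1 : |ζ.re| ≤ 1 := (Complex.abs_re_le_norm ζ).trans h1.le
    refine hz ⟨by simpa [hr0] using him, ?_⟩
    have h6 : |z.re| * |ζ.re| = 1 := by rw [← abs_mul, hre]; simp
    have h7 : 1 ≤ |z.re| := by
      by_contra! hc
      have := mul_lt_mul_of_pos_right hc (abs_pos.2 hr0)
      linarith
    rcases le_abs.1 h7 with h | h
    · right; exact h
    · left; linarith
  have r1 := hroot d hd
  have r2 := hroot (-d) (by rw [neg_sq, hd])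
  rcases lt_or_ge ‖(-1 + d) / z‖ 1 with h | h
  · exact ⟨_, h, main _ r1 h⟩
  · have h1 : 1 < ‖(-1 + d) / z‖ := lt_of_le_of_ne h (Ne.symm (hne _ r1))
    have h2 := congrArg norm hprod
    rw [norm_mul, norm_one] at h2
    have h3 : ‖(-1 + -d) / z‖ < 1 := by
      by_contra! hc
      have := mul_lt_mul_of_pos_right h1 (lt_of_lt_of_le one_pos hc)
      linarith
    exact ⟨_, h3, main _ r2 h3⟩

section

variable {M : Type*} [NormedAddCommGroup M] [InnerProductSpace ℂ M] [CompleteSpace M]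

/-- Operator-valued Carathéodory functions on the disk which are symmetric with respect to the
real axis and equal to `1` at the origin. Because of the symmetry, `H ζ + H (conj ζ)` is twice the
real part of `H ζ`. -/
structure IsCaratheodory (H : ℂ → M →L[ℂ] M) : Prop where
  holo : DifferentiableOn ℂ H (Metric.ball 0 1)
  zero : H 0 = 1
  nonneg : ∀ ζ ∈ Metric.ball (0 : ℂ) 1, 0 ≤ H ζ + H (starRingEnd ℂ ζ)

/-- The function `ζ ↦ ((1 + ζ²) + 2 ζ Ω(z)) / (1 - ζ²)`, where `z = -2 ζ / (1 + ζ²)`. If `Ω` is the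
integral of `(z + t) / (1 + z t)`, it is the integral of `(1 - ζ²) / (1 - 2 t ζ + ζ²)`. -/
noncomputable def caratheodory {B : Type*} [NormedRing B] [NormedAlgebra ℂ B] (Ω : ℂ → B)
    (ζ : ℂ) : B :=
  (1 - ζ ^ 2)⁻¹ • ((1 + ζ ^ 2) • (1 : B) + (2 * ζ) • Ω (diskMap ζ))

lemma IsRS.symm {Ω : ℂ → M →L[ℂ] M} (h : IsRS Ω) {z : ℂ} (hz : z ∈ slitDomain) :
    ContinuousLinearMap.adjoint (Ω z) = Ω (starRingEnd ℂ z) := by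
  by_cases h0 : z.im = 0
  · have hr : z = (z.re : ℂ) := Complex.ext (by simp) (by simp [h0])
    have hx : z.re ∈ Set.Ioo (-1 : ℝ) 1 := by
      by_contra hc
      refine hz ⟨h0, ?_⟩
      by_contra! h2
      exact hc h2
    rw [hr, Complex.conj_ofReal]
    have h1 : IsSelfAdjoint (-1 : M →L[ℂ] M) := (IsSelfAdjoint.one _).neg
    exact isSelfAdjoint_of_le h1 (h.bounds _ hx).1
  · exact h.nevanlinna.symm z h0

lemma isCaratheodory_caratheodory {Ω : ℂ → M →L[ℂ] M} (h : IsRS Ω) :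
    IsCaratheodory (caratheodory Ω) := by
  have hΩd : DifferentiableOn ℂ (fun ζ => Ω (diskMap ζ)) (Metric.ball 0 1) := by
    refine h.holo.comp (t := slitDomain) (fun ζ hζ => ?_) fun ζ hζ =>
      diskMap_mem (mem_ball_zero_iff.1 hζ)
    have := one_add_sq_ne_zero (mem_ball_zero_iff.1 hζ)
    refine DifferentiableAt.differentiableWithinAt ?_
    exact DifferentiableAt.div (by fun_prop) (by fun_prop) this
  refine ⟨fun ζ hζ => ?_, by simp [caratheodory], fun ζ hζ => ?_⟩
  · have h1 := one_sub_sq_ne_zero (mem_ball_zero_iff.1 hζ)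
    have h2 : DifferentiableWithinAt ℂ (fun ζ : ℂ => (1 - ζ ^ 2)⁻¹) (Metric.ball 0 1) ζ :=
      (DifferentiableAt.inv (h := fun ζ : ℂ => 1 - ζ ^ 2) (by fun_prop) h1).differentiableWithinAt
    have h3 : DifferentiableWithinAt ℂ (fun ζ : ℂ => 2 * ζ) (Metric.ball 0 1) ζ := by fun_prop
    have h4 : DifferentiableWithinAt ℂ (fun ζ : ℂ => (1 + ζ ^ 2) • (1 : M →L[ℂ] M))
        (Metric.ball 0 1) ζ := by fun_prop
    exact h2.smul (h4.add (h3.smul (hΩd ζ hζ)))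
  · have hζ1 := mem_ball_zero_iff.1 hζ
    have hadj : caratheodory Ω (starRingEnd ℂ ζ)
        = ContinuousLinearMap.adjoint (caratheodory Ω ζ) := by
      have e : diskMap (starRingEnd ℂ ζ) = starRingEnd ℂ (diskMap ζ) := by
        rw [diskMap, diskMap, map_div₀, map_neg, map_mul, map_add, map_pow, map_one,
          Complex.conj_ofNat]
      rw [caratheodory, caratheodory, e, ← h.symm (diskMap_mem hζ1),
        ← ContinuousLinearMap.star_eq_adjoint, ← ContinuousLinearMap.star_eq_adjoint]
      simp [star_smul, star_add]
    rw [hadj, ← ContinuousLinearMap.star_eq_adjoint]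
    refine nonneg_of_isSelfAdjoint (IsSelfAdjoint.add_star_self _) fun x => ?_
    have hre : (⟪(caratheodory Ω ζ + star (caratheodory Ω ζ)) x, x⟫_ℂ).re
        = 2 * (⟪x, caratheodory Ω ζ x⟫_ℂ).re := by
      rw [add_apply, inner_add_left, ContinuousLinearMap.star_eq_adjoint,
        ContinuousLinearMap.adjoint_inner_left, ← inner_conj_symm, Complex.add_re,
        Complex.conj_re]
      ring
    rw [hre]
    refine mul_nonneg zero_le_two ?_
    by_cases hx : x = 0
    · simp [hx]
    -- by homogeneity `x` may be normalized
    have main : ∀ u : M, ‖u‖ = 1 → 0 ≤ (⟪u, caratheodory Ω ζ u⟫_ℂ).re := by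
      intro u hu
      let f : ℂ → ℂ := fun ζ => ⟪u, Ω (diskMap ζ) u⟫_ℂ
      have hfd : DifferentiableOn ℂ f (Metric.ball 0 1) := by
        let L : (M →L[ℂ] M) →L[ℂ] ℂ := (innerSL ℂ u).comp (ContinuousLinearMap.apply ℂ M u)
        exact L.differentiable.comp_differentiableOn hΩd
      have key := norm_mul_add_le hfd (fun w hw => ?_) (fun y hy => ?_) hζ
      · have hne := one_sub_sq_ne_zero hζ1
        have e : ⟪u, caratheodory Ω ζ u⟫_ℂ
            = ((1 + ζ * f ζ) + ζ * (ζ + f ζ)) / ((1 + ζ * f ζ) - ζ * (ζ + f ζ)) := by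
          have e1 : (1 + ζ * f ζ) - ζ * (ζ + f ζ) = 1 - ζ ^ 2 := by ring
          rw [e1, caratheodory, smul_apply, add_apply, smul_apply, smul_apply, inner_smul_right,
            inner_add_right, inner_smul_right, inner_smul_right, one_apply_eq_self,
            inner_self_eq_norm_sq_to_K, hu, div_eq_inv_mul]
          simp only [f]
          push_cast
          ring
        have h2 : ∀ p q : ℂ, ‖q‖ ≤ ‖p‖ → 0 ≤ ((p + q) / (p - q)).re := by
          intro p q hpq
          have h3 : Complex.normSq q ≤ Complex.normSq p := by
            rw [Complex.normSq_eq_norm_sq, Complex.normSq_eq_norm_sq]; gcongr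
          rw [Complex.div_re, ← add_div]
          refine div_nonneg ?_ (Complex.normSq_nonneg _)
          rw [Complex.normSq_apply, Complex.normSq_apply] at h3
          simp only [Complex.add_re, Complex.add_im, Complex.sub_re, Complex.sub_im]
          linarith
        rw [e]
        exact h2 _ _ key
      · have hw1 := mem_ball_zero_iff.1 hw
        by_cases h0 : w.im = 0
        · rw [h0, zero_mul]
        obtain ⟨c, hc, e⟩ := diskMap_im hw1
        have h0' : (diskMap w).im ≠ 0 := by
          rw [e]; exact mul_ne_zero (neg_ne_zero.2 hc.ne') h0
        have h1 := (smul_imaginaryPart_nonneg_iff _ _).1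
          (h.nevanlinna.im_nonneg _ h0') u
        rw [e] at h1
        have h2 : 0 ≤ c * -(w.im * (f w).im) := by
          have : c * -(w.im * (f w).im) = -c * w.im * (⟪u, Ω (diskMap w) u⟫_ℂ).im := by
            simp only [f]; ring
          rwa [this]
        have := nonneg_of_mul_nonneg_right h2 hc
        linarith
      · obtain ⟨y', hy', e⟩ := diskMap_ofReal_mem hy
        have hb := h.bounds y' hy'
        have hn : ‖Ω y'‖ ≤ 1 := norm_le_of_neg_le_of_le zero_le_one
          (by rw [one_smul]; exact hb.1) (by rw [one_smul]; exact hb.2)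
        change ‖⟪u, Ω (diskMap y) u⟫_ℂ‖ ≤ 1
        rw [e]
        refine (norm_inner_le_norm _ _).trans ?_
        rw [hu, one_mul]
        exact ((Ω y').le_of_opNorm_le hn u).trans_eq (by rw [hu, one_mul])
    have hx0 : (‖x‖ : ℂ) ≠ 0 := by simpa using hx
    have hu : ‖((‖x‖ : ℂ)⁻¹ • x)‖ = 1 := by
      rw [norm_smul, norm_inv, Complex.norm_real, norm_norm,
        inv_mul_cancel₀ (norm_ne_zero_iff.2 hx)]
    have hm := main _ hu
    have e : ⟪x, caratheodory Ω ζ x⟫_ℂ = ((‖x‖ ^ 2 : ℝ) : ℂ)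
        * ⟪(‖x‖ : ℂ)⁻¹ • x, caratheodory Ω ζ ((‖x‖ : ℂ)⁻¹ • x)⟫_ℂ := by
      rw [map_smul, inner_smul_left, inner_smul_right]
      simp only [map_inv₀, Complex.conj_ofReal]
      push_cast
      field_simp
    rw [e, Complex.re_ofReal_mul]
    exact mul_nonneg (sq_nonneg _) hm

end

/-! ### The Herglotz representation -/

section

variable {M : Type*} [NormedAddCommGroup M] [InnerProductSpace ℂ M] [CompleteSpace M]

lemma IsPosUnital.of_tendsto {Φ : ℕ → C(UI, ℂ) →ₗ[ℂ] (M →L[ℂ] M)} (h : ∀ n, IsPosUnital (Φ n))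
    (hC : ∀ g, CauchySeq fun n => Φ n g) :
    ∃ Ψ : C(UI, ℂ) →ₗ[ℂ] (M →L[ℂ] M), IsPosUnital Ψ ∧
      ∀ g, Filter.Tendsto (fun n => Φ n g) Filter.atTop (𝓝 (Ψ g)) := by
  choose F hF using fun g => cauchySeq_tendsto_of_complete (hC g)
  refine ⟨linearMapOfTendsto F Φ (tendsto_pi_nhds.2 hF), ⟨?_, fun f hf => ?_⟩, hF⟩
  · refine tendsto_nhds_unique (hF 1) ?_
    simp only [(h _).one]
    exact tendsto_const_nhds
  · exact le_of_tendsto_op tendsto_const_nhds (hF f)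
      (Filter.Eventually.of_forall fun n => (h n).nonneg f hf)

/-- For positive unital maps, convergence may be checked on the resolvents, because the uniform
bound makes the set of functions on which the maps converge a closed subspace. -/
lemma IsPosUnital.cauchySeq {Φ : ℕ → C(UI, ℂ) →ₗ[ℂ] (M →L[ℂ] M)} (h : ∀ n, IsPosUnital (Φ n))
    (hr : ∀ (z : ℂ) (b : C(UI, ℂ)), ‖z‖ < 1 → (1 + z • incl) * b = 1 → CauchySeq fun n => Φ n b)
    (g : C(UI, ℂ)) : CauchySeq fun n => Φ n g := by
  let V : Submodule ℂ C(UI, ℂ) :=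
    { carrier := {g | CauchySeq fun n => Φ n g}
      add_mem' := fun {f g} hf hg => by
        change CauchySeq fun n => Φ n (f + g)
        simp only [map_add]
        exact CauchySeq.add hf hg
      zero_mem' := by
        change CauchySeq fun n => Φ n 0
        simp only [map_zero]
        exact cauchySeq_const 0
      smul_mem' := fun c g hg => by
        change CauchySeq fun n => Φ n (c • g)
        simp only [map_smul]
        exact (uniformContinuous_const_smul c).comp_cauchySeq hg }
  have hV : IsClosed (V : Set C(UI, ℂ)) := by
    refine isClosed_of_closure_subset fun g hg => ?_
    change CauchySeq fun n => Φ n g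
    rw [Metric.cauchySeq_iff']
    intro ε hε
    obtain ⟨f, hf, hfg⟩ := Metric.mem_closure_iff.1 hg (ε / 6) (by positivity)
    obtain ⟨N, hN⟩ := Metric.cauchySeq_iff'.1 (show CauchySeq fun n => Φ n f from hf) (ε / 3)
      (by positivity)
    refine ⟨N, fun n hn => ?_⟩
    have key : ∀ n, dist (Φ n g) (Φ n f) < ε / 3 := by
      intro n
      rw [dist_eq_norm, ← map_sub]
      have := (h n).norm_le (g - f)
      rw [dist_eq_norm] at hfg
      linarith
    calc dist (Φ n g) (Φ N g)
        ≤ dist (Φ n g) (Φ n f) + dist (Φ n f) (Φ N f) + dist (Φ N f) (Φ N g) :=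
          dist_triangle4 _ _ _ _
      _ < ε / 3 + ε / 3 + ε / 3 := by
          have h3 := key N
          rw [dist_comm] at h3
          exact add_lt_add (add_lt_add (key n) (hN n hn)) h3
      _ = ε := by ring
  have := eq_top_of_pow_mem V hV (pow_mem_of_resolvent_mem norm_incl_le V hV hr)
  have hg : g ∈ V := by rw [this]; exact Submodule.mem_top
  exact hg

/-- Projection of the plane onto the parameter interval, by the truncated real part. -/
noncomputable def reUI (w : ℂ) : UI := Set.projIcc (-1 : ℝ) 1 (by norm_num) w.re

lemma continuous_reUI : Continuous reUI := continuous_projIcc.comp Complex.continuous_re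

lemma reUI_of_norm_eq_one {w : ℂ} (hw : ‖w‖ = 1) : ((reUI w : UI) : ℝ) = w.re := by
  have h := abs_le.1 ((Complex.abs_re_le_norm w).trans hw.le)
  rw [reUI, Set.projIcc_of_mem _ ⟨h.1, h.2⟩]

/-- Twice the real part of a Carathéodory function. -/
def twiceRe (H : ℂ → M →L[ℂ] M) (w : ℂ) : M →L[ℂ] M := H w + H (starRingEnd ℂ w)

lemma continuousOn_twiceRe {H : ℂ → M →L[ℂ] M} (h : IsCaratheodory H) {ρ : ℝ}
    (hρ : ρ ∈ Set.Ioo (0 : ℝ) 1) :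
    ContinuousOn (fun w : ℂ => twiceRe H (ρ * w)) (Metric.sphere 0 1) := by
  have hm : ∀ w ∈ Metric.sphere (0 : ℂ) 1, (ρ : ℂ) * w ∈ Metric.ball (0 : ℂ) 1 := by
    intro w hw
    rw [mem_ball_zero_iff, norm_mul, mem_sphere_zero_iff_norm.1 hw, mul_one, Complex.norm_real,
      Real.norm_eq_abs, abs_of_pos hρ.1]
    exact hρ.2
  refine ContinuousOn.add ?_ ?_
  · exact h.holo.continuousOn.comp (by fun_prop) hm
  · refine h.holo.continuousOn.comp (Continuous.continuousOn ?_) fun w hw => ?_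
    · exact Complex.continuous_conj.comp (by fun_prop)
    · have := hm w hw
      rw [mem_ball_zero_iff] at this ⊢
      rwa [RCLike.norm_conj]

lemma circleIntegrable_poisson {H : ℂ → M →L[ℂ] M} (h : IsCaratheodory H) {ρ : ℝ}
    (hρ : ρ ∈ Set.Ioo (0 : ℝ) 1) (g : C(UI, ℂ)) :
    CircleIntegrable (fun w : ℂ => g (reUI w) • ((1 / 2 : ℂ) • twiceRe H (ρ * w))) 0 1 := by
  refine ContinuousOn.circleIntegrable zero_le_one ?_
  have h1 : ContinuousOn (fun w => g (reUI w)) (Metric.sphere (0 : ℂ) 1) :=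
    (g.continuous.comp continuous_reUI).continuousOn
  exact h1.smul ((continuousOn_twiceRe h hρ).fun_const_smul (1 / 2 : ℂ))

/-- The average over the circle of radius `ρ` of the real part of `H`, with the weight `g`
evaluated at the normalized real part of the variable. -/
noncomputable def poissonMap {H : ℂ → M →L[ℂ] M} (h : IsCaratheodory H) {ρ : ℝ}
    (hρ : ρ ∈ Set.Ioo (0 : ℝ) 1) : C(UI, ℂ) →ₗ[ℂ] (M →L[ℂ] M) where
  toFun g := Real.circleAverage
    (fun w : ℂ => g (reUI w) • ((1 / 2 : ℂ) • twiceRe H (ρ * w))) 0 1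
  map_add' f g := by
    rw [← Real.circleAverage_fun_add (circleIntegrable_poisson h hρ f)
      (circleIntegrable_poisson h hρ g)]
    simp only [ContinuousMap.add_apply, add_smul]
  map_smul' c f := by
    rw [RingHom.id_apply, ← Real.circleAverage_fun_smul]
    simp only [ContinuousMap.smul_apply, smul_eq_mul, mul_smul]

lemma poissonMap_nonneg {H : ℂ → M →L[ℂ] M} (h : IsCaratheodory H) {ρ : ℝ}
    (hρ : ρ ∈ Set.Ioo (0 : ℝ) 1) (g : C(UI, ℂ)) (hg : ∀ t, 0 ≤ g t) : 0 ≤ poissonMap h hρ g := by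
  rw [ContinuousLinearMap.nonneg_iff_isPositive, ContinuousLinearMap.isPositive_iff_complex]
  intro x
  let f : ℂ → M →L[ℂ] M := fun w => g (reUI w) • ((1 / 2 : ℂ) • twiceRe H (ρ * w))
  have hf : CircleIntegrable f 0 1 := circleIntegrable_poisson h hρ g
  have hpos : ∀ w ∈ Metric.sphere (0 : ℂ) 1, 0 ≤ f w := by
    intro w hw
    have h1 : (ρ : ℂ) * w ∈ Metric.ball (0 : ℂ) 1 := by
      rw [mem_ball_zero_iff, norm_mul, mem_sphere_zero_iff_norm.1 hw, mul_one, Complex.norm_real,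
        Real.norm_eq_abs, abs_of_pos hρ.1]
      exact hρ.2
    have h2 := h.nonneg _ h1
    have h3 := hg (reUI w)
    have h4 : (0 : ℂ) ≤ 1 / 2 := by norm_num [Complex.le_def]
    rw [ContinuousLinearMap.nonneg_iff_isPositive] at h2 ⊢
    exact (h2.smul_of_nonneg h4).smul_of_nonneg h3
  let L : (M →L[ℂ] M) →L[ℝ] ℂ :=
    ((innerSL ℂ x).comp (ContinuousLinearMap.apply ℂ M x)).restrictScalars ℝ
  let r : ℂ → ℝ := fun w => (⟪f w x, x⟫_ℂ).re
  have hLr : Set.EqOn (L ∘ f) (Complex.ofRealCLM ∘ r) (Metric.sphere 0 |1|) := by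
    intro w hw
    rw [abs_one] at hw
    have h1 := (ContinuousLinearMap.isPositive_iff_complex _).1
      ((ContinuousLinearMap.nonneg_iff_isPositive _).1 (hpos w hw)) x
    change ⟪x, f w x⟫_ℂ = ((r w : ℝ) : ℂ)
    rw [← inner_conj_symm, ← h1.1]
    simp [r]
  have hr : CircleIntegrable r 0 1 := by
    have h1 : ContinuousOn f (Metric.sphere 0 1) := by
      have h2 : ContinuousOn (fun w => g (reUI w)) (Metric.sphere (0 : ℂ) 1) :=
        (g.continuous.comp continuous_reUI).continuousOn
      exact h2.smul ((continuousOn_twiceRe h hρ).fun_const_smul (1 / 2 : ℂ))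
    have h2 : ContinuousOn (fun w => ⟪f w x, x⟫_ℂ) (Metric.sphere 0 1) :=
      ((ContinuousLinearMap.apply ℂ M x).continuous.comp_continuousOn h1).inner continuousOn_const
    exact (Complex.continuous_re.comp_continuousOn h2).circleIntegrable zero_le_one
  have key : ⟪x, poissonMap h hρ g x⟫_ℂ = ((Real.circleAverage r 0 1 : ℝ) : ℂ) := by
    have h1 := L.circleAverage_comp_comm hf
    rw [Real.circleAverage_congr_sphere hLr, Complex.ofRealCLM.circleAverage_comp_comm hr] at h1
    exact h1.symm
  have key' : ⟪poissonMap h hρ g x, x⟫_ℂ = ((Real.circleAverage r 0 1 : ℝ) : ℂ) := by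
    rw [← inner_conj_symm, key, Complex.conj_ofReal]
  have h0 : 0 ≤ Real.circleAverage r 0 1 := by
    refine Real.circleAverage_nonneg_of_nonneg fun w hw => ?_
    rw [abs_one] at hw
    exact re_inner_nonneg_of_nonneg (hpos w hw) x
  rw [key']
  exact ⟨by simp, by simpa using h0⟩

/-- On the unit circle the kernel is `-1 + (1 - ζ w)⁻¹ + (1 - ζ w⁻¹)⁻¹`. The mean value property
evaluates the integral against the first two terms, and Cauchy's formula evaluates it against the
third one. -/
lemma circleAverage_kernel_smul {E : Type*} [NormedAddCommGroup E] [NormedSpace ℂ E]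
    [CompleteSpace E] {f : ℂ → E} (hf : ∀ w ∈ Metric.closedBall (0 : ℂ) 1, DifferentiableAt ℂ f w)
    {ζ : ℂ} (hζ : ‖ζ‖ < 1) :
    Real.circleAverage (fun w => (-1 + (1 - ζ * w)⁻¹ + (1 - ζ * w⁻¹)⁻¹) • f w) 0 1 = f ζ := by
  have hsc : ∀ w ∈ Metric.sphere (0 : ℂ) 1, w ∈ Metric.closedBall (0 : ℂ) 1 :=
    fun w hw => Metric.sphere_subset_closedBall hw
  have hne : ∀ w ∈ Metric.closedBall (0 : ℂ) 1, 1 - ζ * w ≠ 0 := by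
    intro w hw h0
    rw [mem_closedBall_zero_iff] at hw
    have h1 : ‖ζ * w‖ = 1 := by rw [← sub_eq_zero.1 h0, norm_one]
    rw [norm_mul] at h1
    have := mul_le_of_le_one_right (norm_nonneg ζ) hw
    linarith
  have hcl : closure (Metric.ball (0 : ℂ) |1|) = Metric.closedBall 0 1 := by
    rw [abs_one, closure_ball _ one_ne_zero]
  have hd₁ : ∀ w ∈ Metric.closedBall (0 : ℂ) 1,
      DifferentiableAt ℂ (fun w => (-1 + (1 - ζ * w)⁻¹) • f w) w := by
    intro w hw
    have d1 : DifferentiableAt ℂ (fun w : ℂ => (1 - ζ * w)⁻¹) w :=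
      DifferentiableAt.inv (h := fun w : ℂ => 1 - ζ * w) (by fun_prop) (hne w hw)
    exact (d1.const_add (-1)).smul (hf w hw)
  have h₁ : Real.circleAverage (fun w => (-1 + (1 - ζ * w)⁻¹) • f w) 0 1 = 0 := by
    have : DiffContOnCl ℂ (fun w => (-1 + (1 - ζ * w)⁻¹) • f w) (Metric.ball 0 |1|) :=
      DifferentiableOn.diffContOnCl fun w hw =>
        (hd₁ w (by rwa [hcl] at hw)).differentiableWithinAt
    rw [this.circleAverage]
    simp
  have h₂ : Real.circleAverage (fun w => ((w - 0) / (w - ζ)) • f w) 0 1 = f ζ := by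
    have : DiffContOnCl ℂ f (Metric.ball 0 |1|) :=
      DifferentiableOn.diffContOnCl fun w hw =>
        (hf w (by rwa [hcl] at hw)).differentiableWithinAt
    exact this.circleAverage_smul_div (by rw [abs_one]; simpa using hζ)
  have hi₁ : CircleIntegrable (fun w => (-1 + (1 - ζ * w)⁻¹) • f w) 0 1 :=
    ContinuousOn.circleIntegrable zero_le_one fun w hw =>
      (hd₁ w (hsc w hw)).continuousAt.continuousWithinAt
  have hsp : ∀ w ∈ Metric.sphere (0 : ℂ) 1, w - ζ ≠ 0 := by
    intro w hw h0
    rw [mem_sphere_zero_iff_norm, sub_eq_zero.1 h0] at hw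
    linarith
  have hi₂ : CircleIntegrable (fun w => ((w - 0) / (w - ζ)) • f w) 0 1 := by
    refine ContinuousOn.circleIntegrable zero_le_one fun w hw => ?_
    have c1 : ContinuousAt (fun w : ℂ => (w - 0) / (w - ζ)) w :=
      ContinuousAt.div (by fun_prop) (by fun_prop) (hsp w hw)
    exact (c1.smul (hf w (hsc w hw)).continuousAt).continuousWithinAt
  have e : Real.circleAverage (fun w => (-1 + (1 - ζ * w)⁻¹ + (1 - ζ * w⁻¹)⁻¹) • f w) 0 1
      = Real.circleAverage
        (fun w => (-1 + (1 - ζ * w)⁻¹) • f w + ((w - 0) / (w - ζ)) • f w) 0 1 := by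
    refine Real.circleAverage_congr_sphere fun w hw => ?_
    rw [abs_one] at hw
    have hw1 := mem_sphere_zero_iff_norm.1 hw
    have hw0 : w ≠ 0 := by rintro rfl; simp at hw1
    have h2 : (1 - ζ * w⁻¹)⁻¹ = (w - 0) / (w - ζ) := by
      have h3 : 1 - ζ * w⁻¹ = (w - ζ) / w := by field_simp
      rw [h3, inv_div, sub_zero]
    rw [← add_smul, h2]
  rw [e, Real.circleAverage_fun_add hi₁ hi₂, h₁, h₂, zero_add]

lemma poissonMap_kernel {H : ℂ → M →L[ℂ] M} (h : IsCaratheodory H) {ρ : ℝ}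
    (hρ : ρ ∈ Set.Ioo (0 : ℝ) 1) {ζ : ℂ} (hζ : ‖ζ‖ < 1) (g : C(UI, ℂ))
    (hg : ∀ t : UI, g t = (1 - ζ ^ 2) / (1 - 2 * ((t : ℝ) : ℂ) * ζ + ζ ^ 2)) :
    poissonMap h hρ g = H (ρ * ζ) := by
  have hHd : ∀ w ∈ Metric.closedBall (0 : ℂ) 1,
      DifferentiableAt ℂ (fun w : ℂ => H (ρ * w)) w := by
    intro w hw
    have hm : (ρ : ℂ) * w ∈ Metric.ball (0 : ℂ) 1 := by
      rw [mem_closedBall_zero_iff] at hw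
      rw [mem_ball_zero_iff, norm_mul, Complex.norm_real, Real.norm_eq_abs, abs_of_pos hρ.1]
      exact (mul_le_of_le_one_right hρ.1.le hw).trans_lt hρ.2
    have h1 : DifferentiableAt ℂ H (ρ * w) :=
      h.holo.differentiableAt (Metric.isOpen_ball.mem_nhds hm)
    exact DifferentiableAt.comp (f := fun w : ℂ => (ρ : ℂ) * w) w h1 (by fun_prop)
  have hne : ∀ w : ℂ, ‖w‖ = 1 → 1 - ζ * w ≠ 0 := by
    intro w hw h0
    have h1 : ‖ζ * w‖ = 1 := by rw [← sub_eq_zero.1 h0, norm_one]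
    rw [norm_mul, hw, mul_one] at h1
    linarith
  have hk : ∀ w : ℂ, ‖w‖ = 1 → g (reUI w) = -1 + (1 - ζ * w)⁻¹ + (1 - ζ * w⁻¹)⁻¹ := by
    intro w hw1
    have hw0 : w ≠ 0 := by rintro rfl; simp at hw1
    have h1 := hne w hw1
    have h2 := hne w⁻¹ (by rw [norm_inv, hw1, inv_one])
    have h3 : w + w⁻¹ = 2 * (w.re : ℂ) := by
      rw [Complex.inv_eq_conj hw1, Complex.add_conj]; push_cast; ring
    have h4 : 1 - 2 * (w.re : ℂ) * ζ + ζ ^ 2 = (1 - ζ * w) * (1 - ζ * w⁻¹) := by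
      rw [← h3]
      field_simp
      ring
    have h5 : ζ ^ 2 = ζ * w * (ζ * w⁻¹) := by field_simp
    have gen : ∀ p q : ℂ, 1 - p ≠ 0 → 1 - q ≠ 0 →
        (1 - p * q) / ((1 - p) * (1 - q)) = -1 + (1 - p)⁻¹ + (1 - q)⁻¹ := by
      intro p q hp hq
      field_simp
      ring
    rw [hg, reUI_of_norm_eq_one hw1, h4, h5, gen _ _ h1 h2]
  let A : ℂ → M →L[ℂ] M := fun w => g (reUI w) • H (ρ * w)
  have hAc : ContinuousOn A (Metric.sphere 0 1) := by
    have h1 : ContinuousOn (fun w => g (reUI w)) (Metric.sphere (0 : ℂ) 1) :=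
      (g.continuous.comp continuous_reUI).continuousOn
    exact h1.smul fun w hw =>
      (hHd w (Metric.sphere_subset_closedBall hw)).continuousAt.continuousWithinAt
  have hAi : CircleIntegrable A 0 1 := hAc.circleIntegrable zero_le_one
  have hAc' : ContinuousOn (fun w => A w⁻¹) (Metric.sphere 0 1) := by
    refine hAc.comp ?_ fun w hw => ?_
    · refine continuousOn_inv₀.mono fun w hw => ?_
      rintro rfl
      simp at hw
    · rw [mem_sphere_zero_iff_norm] at hw ⊢
      rw [norm_inv, hw, inv_one]
  have hAi' : CircleIntegrable (fun w => A w⁻¹) 0 1 := hAc'.circleIntegrable zero_le_one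
  have e1 : poissonMap h hρ g = Real.circleAverage (fun w => (1 / 2 : ℂ) • (A w + A w⁻¹)) 0 1 := by
    change Real.circleAverage
      (fun w : ℂ => g (reUI w) • ((1 / 2 : ℂ) • twiceRe H (ρ * w))) 0 1 = _
    refine Real.circleAverage_congr_sphere fun w hw => ?_
    rw [abs_one, mem_sphere_zero_iff_norm] at hw
    have hinv : g (reUI w⁻¹) = g (reUI w) := by
      rw [hk w hw, hk w⁻¹ (by rw [norm_inv, hw, inv_one]), inv_inv]; ring
    have hconj : starRingEnd ℂ ((ρ : ℂ) * w) = ρ * w⁻¹ := by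
      rw [map_mul, Complex.conj_ofReal, Complex.inv_eq_conj hw]
    simp only [A, hinv, twiceRe, hconj]
    rw [smul_comm, smul_add]
  have e2 : Real.circleAverage A 0 1 = H (ρ * ζ) := by
    rw [← circleAverage_kernel_smul hHd hζ]
    refine Real.circleAverage_congr_sphere fun w hw => ?_
    rw [abs_one, mem_sphere_zero_iff_norm] at hw
    simp only [A, hk w hw]
  rw [e1, Real.circleAverage_fun_smul, Real.circleAverage_fun_add hAi hAi',
    Real.circleAverage_zero_one_congr_inv, e2, ← two_smul ℂ, smul_smul]
  norm_num

lemma isPosUnital_poissonMap {H : ℂ → M →L[ℂ] M} (h : IsCaratheodory H) {ρ : ℝ}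
    (hρ : ρ ∈ Set.Ioo (0 : ℝ) 1) : IsPosUnital (poissonMap h hρ) := by
  refine ⟨?_, poissonMap_nonneg h hρ⟩
  rw [poissonMap_kernel h hρ (ζ := 0) (by simp) 1 (by simp), mul_zero, h.zero]

lemma caratheodory_mob_apply {ζ : ℂ} (hζ : ‖ζ‖ < 1) (t : UI) :
    caratheodory (mob incl) ζ t = (1 - ζ ^ 2) / (1 - 2 * ((t : ℝ) : ℂ) * ζ + ζ ^ 2) := by
  have h1 := one_add_sq_ne_zero hζ
  have h2 := one_sub_sq_ne_zero hζ
  have h3 := one_add_mul_ne_zero (diskMap_mem hζ) t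
  have h4 : 1 + diskMap ζ * ((t : ℝ) : ℂ)
      = (1 - 2 * ((t : ℝ) : ℂ) * ζ + ζ ^ 2) / (1 + ζ ^ 2) := by
    rw [diskMap]; field_simp; ring
  have h5 : 1 - 2 * ((t : ℝ) : ℂ) * ζ + ζ ^ 2 ≠ 0 := by
    intro h0
    rw [h4, h0, zero_div] at h3
    exact h3 rfl
  rw [caratheodory, ContinuousMap.smul_apply, ContinuousMap.add_apply, ContinuousMap.smul_apply,
    ContinuousMap.smul_apply, mob_incl_apply (diskMap_mem hζ), h4, diskMap]
  simp only [ContinuousMap.one_apply, smul_eq_mul]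
  obtain ⟨d, hd⟩ : ∃ d, d = 1 - 2 * ((t : ℝ) : ℂ) * ζ + ζ ^ 2 := ⟨_, rfl⟩
  rw [← hd] at h5 ⊢
  field_simp
  rw [hd]
  ring

lemma resolvent_eq_smul_caratheodory {ζ : ℂ} (hζ : ‖ζ‖ < 1) (hz : ‖diskMap ζ‖ < 1)
    {b : C(UI, ℂ)} (hb : (1 + diskMap ζ • incl) * b = 1) :
    ∃ c : ℂ, b = c • caratheodory (mob incl) ζ := by
  have h1 := one_add_sq_ne_zero hζ
  have h2 := one_sub_sq_ne_zero hζ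
  refine ⟨((diskMap ζ) ^ 2 - 1)⁻¹ * (-((1 + ζ ^ 2)⁻¹ * (1 - ζ ^ 2))), ?_⟩
  rw [eq_smul_of_resolvent hz (isUnit_one_add_smul_incl (diskMap_mem hζ)) hb, mul_smul,
    caratheodory]
  congr 1
  have e : diskMap ζ = -((1 + ζ ^ 2)⁻¹ * (2 * ζ)) := by rw [diskMap]; ring
  generalize mob incl (diskMap ζ) = m
  rw [e]
  ext t
  simp only [ContinuousMap.sub_apply, ContinuousMap.add_apply, ContinuousMap.smul_apply,
    ContinuousMap.one_apply, smul_eq_mul]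
  field_simp
  ring

/-- The Herglotz representation, for operator functions symmetric with respect to the real axis. -/
theorem exists_isPosUnital_of_isCaratheodory {H : ℂ → M →L[ℂ] M} (h : IsCaratheodory H) :
    ∃ Φ : C(UI, ℂ) →ₗ[ℂ] (M →L[ℂ] M), IsPosUnital Φ ∧
      ∀ ζ : ℂ, ‖ζ‖ < 1 → Φ (caratheodory (mob incl) ζ) = H ζ := by
  let ρ : ℕ → ℝ := fun n => 1 - 1 / ((n : ℝ) + 2)
  have hρ : ∀ n, ρ n ∈ Set.Ioo (0 : ℝ) 1 := by
    intro n
    have h1 : (0 : ℝ) < n + 2 := by positivity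
    have h2 : 1 / ((n : ℝ) + 2) < 1 := by
      rw [div_lt_one h1]
      have : (0 : ℝ) ≤ n := n.cast_nonneg
      linarith
    have h3 : 0 < 1 / ((n : ℝ) + 2) := by positivity
    exact ⟨by simp only [ρ]; linarith, by simp only [ρ]; linarith⟩
  have hlim : Filter.Tendsto ρ Filter.atTop (𝓝 1) := by
    have h1 : Filter.Tendsto (fun n : ℕ => 1 / ((n : ℝ) + 2)) Filter.atTop (𝓝 0) := by
      have := (Filter.tendsto_add_atTop_iff_nat 1).2
        (tendsto_one_div_add_atTop_nhds_zero_nat (𝕜 := ℝ))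
      refine this.congr fun n => ?_
      push_cast
      ring_nf
    have h2 := h1.const_sub 1
    rwa [sub_zero] at h2
  have hk : ∀ ζ : ℂ, ‖ζ‖ < 1 → Filter.Tendsto
      (fun n => poissonMap h (hρ n) (caratheodory (mob incl) ζ)) Filter.atTop (𝓝 (H ζ)) := by
    intro ζ hζ
    have e : ∀ n, poissonMap h (hρ n) (caratheodory (mob incl) ζ) = H (ρ n * ζ) := fun n =>
      poissonMap_kernel h (hρ n) hζ _ (caratheodory_mob_apply hζ)
    simp only [e]
    have hc : ContinuousAt H ζ :=
      (h.holo.differentiableAt (Metric.isOpen_ball.mem_nhds (by simpa using hζ))).continuousAt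
    have h1 : Filter.Tendsto (fun n => (ρ n : ℂ) * ζ) Filter.atTop (𝓝 ζ) := by
      have := ((Complex.continuous_ofReal.tendsto 1).comp hlim).mul_const ζ
      simpa using this
    exact hc.tendsto.comp h1
  obtain ⟨Φ, hΦ, hlimΦ⟩ := IsPosUnital.of_tendsto (fun n => isPosUnital_poissonMap h (hρ n))
    (IsPosUnital.cauchySeq (fun n => isPosUnital_poissonMap h (hρ n)) fun z b hz hb => by
      obtain ⟨ζ, hζ, rfl⟩ := exists_diskMap_eq (mem_slitDomain_of_norm_lt_one hz)
      obtain ⟨c, rfl⟩ := resolvent_eq_smul_caratheodory hζ hz hb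
      simp only [map_smul]
      exact ((hk ζ hζ).const_smul c).cauchySeq)
  exact ⟨Φ, hΦ, fun ζ hζ => tendsto_nhds_unique (hlimΦ _) (hk ζ hζ)⟩

/-- Functions of class `RS` are given by positive unital maps on the continuous functions. -/
theorem exists_isPosUnital_of_isRS {Ω : ℂ → M →L[ℂ] M} (h : IsRS Ω) :
    ∃ Φ : C(UI, ℂ) →ₗ[ℂ] (M →L[ℂ] M), IsPosUnital Φ ∧
      ∀ z ∈ slitDomain, Φ (mob incl z) = Ω z := by
  obtain ⟨Φ, hΦ, hH⟩ := exists_isPosUnital_of_isCaratheodory (isCaratheodory_caratheodory h)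
  have main : ∀ z ∈ slitDomain, z ≠ 0 → Φ (mob incl z) = Ω z := by
    intro z hz hz0
    obtain ⟨ζ, hζ, rfl⟩ := exists_diskMap_eq hz
    have hζ0 : ζ ≠ 0 := by rintro rfl; simp [diskMap] at hz0
    have h1 := hH ζ hζ
    rw [caratheodory, caratheodory, map_smul, map_add, map_smul, map_smul, hΦ.one] at h1
    have h2 := smul_right_injective _ (inv_ne_zero (one_sub_sq_ne_zero hζ)) h1
    exact smul_right_injective _ (mul_ne_zero two_ne_zero hζ0) (add_left_cancel h2)
  refine ⟨Φ, hΦ, fun z hz => ?_⟩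
  by_cases hz0 : z = 0
  · subst hz0
    have c1 : ContinuousAt (fun z => Φ (mob incl z)) 0 :=
      ContinuousAt.comp (f := mob incl) hΦ.continuous.continuousAt
        (differentiableAt_mob (isUnit_one_add_smul_incl hz)).continuousAt
    have c2 : ContinuousAt Ω 0 :=
      (h.holo.differentiableAt (isOpen_slitDomain.mem_nhds hz)).continuousAt
    refine tendsto_nhds_unique_of_eventuallyEq
      (c1.tendsto.mono_left (nhdsWithin_le_nhds (s := {0}ᶜ)))
      (c2.tendsto.mono_left nhdsWithin_le_nhds) ?_
    filter_upwards [self_mem_nhdsWithin, nhdsWithin_le_nhds (isOpen_slitDomain.mem_nhds hz)]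
      with w hw0 hw
    exact main w hw hw0
  · exact main z hz hz0

end

/-! ### From positive maps to distribution functions -/

section

variable {M : Type*} [NormedAddCommGroup M] [InnerProductSpace ℂ M] [CompleteSpace M]

/-- The continuous function on `[-1, 1]` that equals `1` to the left of `t - 1 / n`, equals `0` to
the right of `t`, and is affine in between. -/
def ramp (n : ℕ) (t : ℝ) : C(UI, ℂ) :=
  ⟨fun u => ((max 0 (min 1 (n * (t - u))) : ℝ) : ℂ), by fun_prop⟩

lemma ramp_apply (n : ℕ) (t : ℝ) (u : UI) :
    ramp n t u = ((max 0 (min 1 (n * (t - u))) : ℝ) : ℂ) := rfl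

/-- Continuous approximation, increasing in `n`, of the indicator function of `[-1, t)`, or of
`[-1, 1]` for `1 ≤ t`. -/
noncomputable def cut (n : ℕ) (t : ℝ) : C(UI, ℂ) := if t < 1 then ramp n t else 1

/-- The values of `cut`, as real numbers. -/
noncomputable def cutVal (n : ℕ) (t u : ℝ) : ℝ := if t < 1 then max 0 (min 1 (n * (t - u))) else 1

lemma cut_apply (n : ℕ) (t : ℝ) (u : UI) : cut n t u = (cutVal n t u : ℂ) := by
  unfold cut cutVal
  split_ifs with h
  · exact ramp_apply n t u
  · simp

lemma cutVal_nonneg (n : ℕ) (t u : ℝ) : 0 ≤ cutVal n t u := by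
  unfold cutVal
  split_ifs
  · exact le_max_left _ _
  · exact zero_le_one

lemma cutVal_le_one (n : ℕ) (t u : ℝ) : cutVal n t u ≤ 1 := by
  unfold cutVal
  split_ifs
  · exact max_le zero_le_one (min_le_left _ _)
  · exact le_rfl

lemma cutVal_mono_right (n : ℕ) {s t : ℝ} (h : s ≤ t) (u : ℝ) : cutVal n s u ≤ cutVal n t u := by
  by_cases ht : t < 1
  · unfold cutVal
    rw [if_pos (h.trans_lt ht), if_pos ht]
    gcongr
  · refine (cutVal_le_one n s u).trans ?_
    rw [cutVal, if_neg ht]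

lemma cutVal_mono_left {m n : ℕ} (h : m ≤ n) (t u : ℝ) : cutVal m t u ≤ cutVal n t u := by
  unfold cutVal
  split_ifs
  · rcases le_total u t with hu | hu
    · have : 0 ≤ t - u := sub_nonneg.2 hu
      gcongr
    · refine max_le (le_max_left _ _) (le_trans ?_ (le_max_left _ _))
      exact (min_le_right _ _).trans
        (mul_nonpos_of_nonneg_of_nonpos m.cast_nonneg (sub_nonpos.2 hu))
  · exact le_rfl

lemma cutVal_eq_zero (n : ℕ) {t u : ℝ} (hu1 : u ≤ 1) (hu : t < u) : cutVal n t u = 0 := by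
  rw [cutVal, if_pos (hu.trans_le hu1)]
  refine max_eq_left ((min_le_right _ _).trans ?_)
  exact mul_nonpos_of_nonneg_of_nonpos n.cast_nonneg (sub_nonpos.2 hu.le)

lemma cutVal_eq_one {n : ℕ} (hn : 0 < n) {t u : ℝ} (hu : u + 1 / n ≤ t) : cutVal n t u = 1 := by
  unfold cutVal
  split_ifs
  · have h0 : (0 : ℝ) < n := Nat.cast_pos.2 hn
    have : 1 ≤ n * (t - u) := by
      have := mul_le_mul_of_nonneg_left (le_sub_iff_add_le'.2 hu) h0.le
      rwa [mul_one_div_cancel h0.ne'] at this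
    rw [min_eq_left this, max_eq_right zero_le_one]
  · rfl

lemma cutVal_neg_one (n : ℕ) (u : UI) : cutVal n (-1) u = 0 := by
  rw [cutVal, if_pos (by norm_num)]
  refine max_eq_left ((min_le_right _ _).trans ?_)
  exact mul_nonpos_of_nonneg_of_nonpos n.cast_nonneg (by linarith [u.2.1])

lemma cutVal_sub_le (n : ℕ) {s t : ℝ} (h : s ≤ t) (ht : t < 1) (u : ℝ) :
    cutVal n t u - cutVal n s u ≤ n * (t - s) := by
  unfold cutVal
  rw [if_pos (h.trans_lt ht), if_pos ht]
  have h1 : 0 ≤ n * (t - s) := mul_nonneg n.cast_nonneg (sub_nonneg.2 h)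
  have h2 : n * (t - u) = n * (s - u) + n * (t - s) := by ring
  rw [h2, sub_le_iff_le_add']
  refine max_le (add_nonneg (le_max_left _ _) h1) ?_
  refine le_trans (b := min 1 (n * (s - u)) + n * (t - s)) ?_
    (by gcongr; exact le_max_right _ _)
  rcases le_total 1 (n * (s - u)) with h3 | h3
  · rw [min_eq_left h3]; exact (min_le_left _ _).trans (by linarith)
  · rw [min_eq_right h3]; exact min_le_right _ _

variable {Φ : C(UI, ℂ) →ₗ[ℂ] (M →L[ℂ] M)}

lemma IsPosUnital.cut_mono (h : IsPosUnital Φ) {m n : ℕ} (hmn : m ≤ n) {s t : ℝ} (hst : s ≤ t) :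
    Φ (cut m s) ≤ Φ (cut n t) := by
  refine h.mono fun u => ?_
  rw [cut_apply, cut_apply]
  exact_mod_cast (cutVal_mono_left hmn s u).trans (cutVal_mono_right n hst u)

lemma IsPosUnital.cut_nonneg {E : Type*} [NormedAddCommGroup E] [InnerProductSpace ℂ E]
    {Φ : C(UI, ℂ) →ₗ[ℂ] (E →L[ℂ] E)} (h : IsPosUnital Φ) (n : ℕ) (t : ℝ) : 0 ≤ Φ (cut n t) := by
  refine h.nonneg _ fun u => ?_
  rw [cut_apply]
  exact_mod_cast cutVal_nonneg n t u

lemma IsPosUnital.cut_le_one (h : IsPosUnital Φ) (n : ℕ) (t : ℝ) : Φ (cut n t) ≤ 1 := by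
  rw [← h.one]
  refine h.mono fun u => ?_
  rw [cut_apply, ContinuousMap.one_apply]
  exact_mod_cast cutVal_le_one n t u

/-- The distribution function of `Φ`: its value at `t` is the strong limit of the values of `Φ` on
continuous approximations of the indicator function of `[-1, t)`. -/
def IsCutLimit (Φ : C(UI, ℂ) →ₗ[ℂ] (M →L[ℂ] M)) (σ : ℝ → M →L[ℂ] M) : Prop :=
  ∀ t x, Filter.Tendsto (fun n => Φ (cut n t) x) Filter.atTop (𝓝 (σ t x))

lemma IsPosUnital.exists_isCutLimit (h : IsPosUnital Φ) :
    ∃ σ : ℝ → M →L[ℂ] M, IsCutLimit Φ σ := by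
  choose σ hσ using fun t => exists_strong_limit_of_monotone (T := fun n => Φ (cut n t))
    (fun m n hmn => h.cut_mono hmn le_rfl) (fun n => h.cut_nonneg n t) (fun n => h.cut_le_one n t)
  exact ⟨σ, hσ⟩

lemma IsCutLimit.monotone {σ : ℝ → M →L[ℂ] M} (hσ : IsCutLimit Φ σ) (h : IsPosUnital Φ) :
    Monotone σ := fun s t hst =>
  le_of_tendsto_apply (hσ s) (hσ t) (Filter.Eventually.of_forall fun _ => h.cut_mono le_rfl hst)

lemma IsCutLimit.cut_le {σ : ℝ → M →L[ℂ] M} (hσ : IsCutLimit Φ σ) (h : IsPosUnital Φ) (n : ℕ)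
    (t : ℝ) : Φ (cut n t) ≤ σ t :=
  le_of_tendsto_apply (f := fun _ : ℕ => Φ (cut n t)) (fun _ => tendsto_const_nhds) (hσ t)
    ((Filter.eventually_ge_atTop n).mono fun _ hm => h.cut_mono hm le_rfl)

lemma IsCutLimit.nonneg {σ : ℝ → M →L[ℂ] M} (hσ : IsCutLimit Φ σ) (h : IsPosUnital Φ) (t : ℝ) :
    0 ≤ σ t := (h.cut_nonneg 0 t).trans (hσ.cut_le h 0 t)

lemma IsCutLimit.le_one {σ : ℝ → M →L[ℂ] M} (hσ : IsCutLimit Φ σ) (h : IsPosUnital Φ) (t : ℝ) :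
    σ t ≤ 1 :=
  le_of_tendsto_apply (g := fun _ : ℕ => (1 : M →L[ℂ] M)) (hσ t) (fun _ => tendsto_const_nhds)
    (Filter.Eventually.of_forall fun n => h.cut_le_one n t)

/-- The quadratic forms of `σ` are suprema of continuous functions, hence lower semicontinuous,
and being nondecreasing they are left-continuous. The bound `‖P x‖² ≤ ⟪P x, x⟫` for the increments
`P` of `σ` turns this into strong left-continuity. -/
lemma IsCutLimit.leftCont {σ : ℝ → M →L[ℂ] M} (hσ : IsCutLimit Φ σ) (h : IsPosUnital Φ) {t : ℝ}
    (ht : t < 1) (x : M) : ContinuousWithinAt (fun s => σ s x) (Set.Iic t) t := by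
  rw [Metric.continuousWithinAt_iff]
  intro ε hε
  have hlim : Filter.Tendsto (fun n => (⟪Φ (cut n t) x, x⟫_ℂ).re) Filter.atTop
      (𝓝 (⟪σ t x, x⟫_ℂ).re) :=
    (Complex.continuous_re.tendsto _).comp ((hσ t x).inner tendsto_const_nhds)
  obtain ⟨n, hn⟩ := (hlim.eventually (lt_mem_nhds (show (⟪σ t x, x⟫_ℂ).re - ε ^ 2 / 2 < _ by
    linarith [pow_pos hε 2]))).exists
  refine ⟨ε ^ 2 / 2 / (n * ‖x‖ ^ 2 + 1), by positivity, fun {s} hs hst => ?_⟩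
  rw [Set.mem_Iic] at hs
  rw [Real.dist_eq, abs_sub_comm, abs_of_nonneg (sub_nonneg.2 hs), lt_div_iff₀ (by positivity)]
    at hst
  have h1 := norm_apply_sq_le (P := σ t - σ s) (sub_nonneg.2 (hσ.monotone h hs))
    ((sub_le_self _ (hσ.nonneg h s)).trans (hσ.le_one h t)) x
  have h2 := re_inner_le_of_le (hσ.cut_le h n s) x
  have h3 : (⟪Φ (cut n t) x, x⟫_ℂ).re - (⟪Φ (cut n s) x, x⟫_ℂ).re ≤ n * (t - s) * ‖x‖ ^ 2 := by
    have hle : ‖Φ (cut n t - cut n s)‖ ≤ n * (t - s) := by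
      refine h.norm_le_of_real
        ⟨fun u : UI => (cut n t u - cut n s u).re, by fun_prop⟩ (fun u => ?_) fun u => ?_
      · simp only [ContinuousMap.sub_apply, ContinuousMap.coe_mk, cut_apply]
        rw [← Complex.ofReal_sub, Complex.ofReal_re]
      · simp only [ContinuousMap.coe_mk, cut_apply]
        rw [← Complex.ofReal_sub, Complex.ofReal_re,
          abs_of_nonneg (sub_nonneg.2 (cutVal_mono_right n hs _))]
        exact cutVal_sub_le n hs ht u
    rw [← Complex.sub_re, ← inner_sub_left, ← sub_apply, ← map_sub]
    refine (Complex.re_le_norm _).trans ((norm_inner_le_norm _ _).trans ?_)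
    have h4 := (Φ (cut n t - cut n s)).le_of_opNorm_le hle x
    calc _ ≤ n * (t - s) * ‖x‖ * ‖x‖ := by gcongr
      _ = _ := by ring
  rw [dist_comm, dist_eq_norm, ← sub_apply]
  refine lt_of_pow_lt_pow_left₀ 2 hε.le (h1.trans_lt ?_)
  rw [sub_apply, inner_sub_left, Complex.sub_re]
  have h5 : (t - s) * (n * ‖x‖ ^ 2 + 1) = n * (t - s) * ‖x‖ ^ 2 + (t - s) := by ring
  have h6 := sub_nonneg.2 hs
  linarith

lemma IsCutLimit.isDistribution {σ : ℝ → M →L[ℂ] M} (hσ : IsCutLimit Φ σ) (h : IsPosUnital Φ) :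
    IsDistribution σ where
  mono := (hσ.monotone h).monotoneOn _
  left_cont t ht x := hσ.leftCont h ht.2 x
  left_end := by
    ext x
    refine tendsto_nhds_unique (hσ (-1) x) ?_
    have : ∀ n, cut n (-1) = 0 := fun n => by
      ext u
      rw [cut_apply, cutVal_neg_one]; simp
    simp [this]
  right_end := by
    ext x
    refine tendsto_nhds_unique (hσ 1 x) ?_
    have : ∀ n, cut n 1 = 1 := fun n => by simp [cut]
    simp [this, h.one]

/-- A Riemann-Stieltjes sum for `σ` is the limit of the values of `Φ` on functions close to `F`,
which are built from a partition of unity subordinate to the partition of the interval. -/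
lemma IsCutLimit.norm_sum_sub_le {σ : ℝ → M →L[ℂ] M} (hσ : IsCutLimit Φ σ) (h : IsPosUnital Φ)
    {F : C(UI, ℂ)} {ε δ : ℝ} (hε : 0 ≤ ε) (hδ : 0 < δ)
    (hF : ∀ u v : UI, |(u : ℝ) - v| < δ → ‖F u - F v‖ ≤ ε) (N : ℕ) (t : ℕ → ℝ) (s : ℕ → UI)
    (ht : Monotone t) (h0 : t 0 = -1) (hN : t N = 1) (hmesh : ∀ i < N, t (i + 1) - t i < δ / 2)
    (hs : ∀ i < N, (s i : ℝ) ∈ Set.Icc (t i) (t (i + 1))) :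
    ‖∑ i ∈ Finset.range N, F (s i) • (σ (t (i + 1)) - σ (t i)) - Φ F‖ ≤ 2 * ε := by
  refine ContinuousLinearMap.opNorm_le_bound _ (by positivity) fun x => ?_
  have hlim : Filter.Tendsto (fun n => ‖(∑ i ∈ Finset.range N,
      F (s i) • (Φ (cut n (t (i + 1))) - Φ (cut n (t i))) - Φ F) x‖) Filter.atTop
      (𝓝 ‖(∑ i ∈ Finset.range N, F (s i) • (σ (t (i + 1)) - σ (t i)) - Φ F) x‖) := by
    simp only [sub_apply, sum_apply, smul_apply]
    exact ((tendsto_finsetSum _ fun i _ =>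
      ((hσ _ x).sub (hσ _ x)).const_smul _).sub_const _).norm
  obtain ⟨n₀, hn₀⟩ := exists_nat_gt (2 / δ)
  have hn₀' : 0 < n₀ := Nat.cast_pos.1 ((by positivity : 0 < 2 / δ).trans hn₀)
  refine le_of_tendsto hlim ((Filter.eventually_ge_atTop n₀).mono fun n hn => ?_)
  have hn0 : 0 < n := hn₀'.trans_le hn
  have hn1 : 1 / (n : ℝ) < δ / 2 := by
    have h1 : (0 : ℝ) < n := Nat.cast_pos.2 hn0
    have h2 : 2 / δ < n := hn₀.trans_le (Nat.cast_le.2 hn)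
    rw [div_lt_iff₀ hδ] at h2
    rw [div_lt_iff₀ h1]
    linarith
  refine ContinuousLinearMap.le_of_opNorm_le _ ?_ x
  have e : ∑ i ∈ Finset.range N, F (s i) • (Φ (cut n (t (i + 1))) - Φ (cut n (t i))) - Φ F
      = Φ (∑ i ∈ Finset.range N, F (s i) • (cut n (t (i + 1)) - cut n (t i)) - F) := by
    simp only [map_sub, map_sum, map_smul]
  rw [e]
  refine (h.norm_le _).trans (mul_le_mul_of_nonneg_left ?_ zero_le_two)
  refine (ContinuousMap.norm_le _ hε).2 fun u => ?_
  let g : ℕ → ℝ := fun i => cutVal n (t (i + 1)) u - cutVal n (t i) u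
  have hg0 : ∀ i, 0 ≤ g i := fun i => sub_nonneg.2 (cutVal_mono_right n (ht i.le_succ) u)
  have hgs : ∑ i ∈ Finset.range N, g i = 1 := by
    rw [Finset.sum_range_sub (fun i => cutVal n (t i) u), h0, hN, cutVal_neg_one, sub_zero, cutVal,
      if_neg (lt_irrefl _)]
  have hFu : F u = ∑ i ∈ Finset.range N, F u * (g i : ℂ) := by
    rw [← Finset.mul_sum, ← Complex.ofReal_sum, hgs, Complex.ofReal_one, mul_one]
  have e2 : (∑ i ∈ Finset.range N, F (s i) • (cut n (t (i + 1)) - cut n (t i)) - F) u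
      = ∑ i ∈ Finset.range N, (F (s i) - F u) * (g i : ℂ) := by
    rw [ContinuousMap.sub_apply, ContinuousMap.sum_apply]
    conv_lhs => rw [hFu]
    rw [← Finset.sum_sub_distrib]
    refine Finset.sum_congr rfl fun i _ => ?_
    rw [ContinuousMap.smul_apply, ContinuousMap.sub_apply, cut_apply, cut_apply, smul_eq_mul,
      ← Complex.ofReal_sub, sub_mul]
  rw [e2]
  calc _ ≤ ∑ i ∈ Finset.range N, ‖(F (s i) - F u) * (g i : ℂ)‖ := norm_sum_le _ _
    _ ≤ ∑ i ∈ Finset.range N, ε * g i := by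
        refine Finset.sum_le_sum fun i hi => ?_
        rw [norm_mul, Complex.norm_real, Real.norm_eq_abs, abs_of_nonneg (hg0 i)]
        by_cases hgi : g i = 0
        · simp [hgi]
        refine mul_le_mul_of_nonneg_right (hF _ _ ?_) (hg0 i)
        have hi' := Finset.mem_range.1 hi
        have h1 : (u : ℝ) ≤ t (i + 1) := by
          by_contra! hlt
          have h2 := cutVal_eq_zero n u.2.2 hlt
          have h3 := cutVal_nonneg n (t i) u
          have h4 := hg0 i
          simp only [g, h2] at h4 hgi
          exact hgi (by linarith)
        have h2 : t i ≤ u + 1 / n := by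
          by_contra! hlt
          have h2 := cutVal_eq_one hn0 hlt.le
          have h3 := cutVal_le_one n (t (i + 1)) u
          have h4 := hg0 i
          simp only [g, h2] at h4 hgi
          exact hgi (by linarith)
        have h3 := hs i hi'
        have h4 := hmesh i hi'
        rw [abs_lt]
        constructor <;> linarith [h3.1, h3.2]
    _ = ε := by rw [← Finset.mul_sum, hgs, mul_one]

/-- Continuous functions on the interval are integrated by `σ`, with integral given by `Φ`. -/
lemma IsCutLimit.hasRSIntegral {σ : ℝ → M →L[ℂ] M} (hσ : IsCutLimit Φ σ) (h : IsPosUnital Φ)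
    {f : ℝ → ℂ} {F : C(UI, ℂ)} (hf : ∀ u : UI, f u = F u) : HasRSIntegral f σ (-1) 1 (Φ F) := by
  intro ε hε
  obtain ⟨δ, hδ, hF⟩ := Metric.uniformContinuous_iff.1
    (CompactSpace.uniformContinuous_of_continuous F.continuous) (ε / 4) (by positivity)
  refine ⟨δ / 2, by positivity, fun N t s ht h0 hN hmesh hs => ?_⟩
  have hsU : ∀ i < N, s i ∈ Set.Icc (-1 : ℝ) 1 := fun i hi =>
    ⟨h0 ▸ (ht i.zero_le).trans (hs i hi).1, hN ▸ (hs i hi).2.trans (ht hi)⟩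
  let s' : ℕ → UI := fun i => Set.projIcc (-1) 1 (by norm_num) (s i)
  have hs' : ∀ i < N, ((s' i : UI) : ℝ) = s i := fun i hi => by
    simp only [s', Set.projIcc_of_mem _ (hsU i hi)]
  have key := hσ.norm_sum_sub_le h (F := F) (ε := ε / 4) (by positivity) hδ
    (fun u v huv => by
      rw [← dist_eq_norm]
      exact (hF (by rwa [Subtype.dist_eq, Real.dist_eq])).le) N t s' ht h0 hN hmesh
    (fun i hi => by rw [hs' i hi]; exact hs i hi)
  have e : ∑ i ∈ Finset.range N, f (s i) • (σ (t (i + 1)) - σ (t i))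
      = ∑ i ∈ Finset.range N, F (s' i) • (σ (t (i + 1)) - σ (t i)) := by
    refine Finset.sum_congr rfl fun i hi => ?_
    rw [← hf, hs' i (Finset.mem_range.1 hi)]
  rw [e]
  linarith

end

/-! ### Riemann-Stieltjes integrals of continuous functions -/

section

variable {M : Type*} [NormedAddCommGroup M] [InnerProductSpace ℂ M]

/-- The nearest point to `x` in the interval `[a, b]`. -/
def clamp (a b x : ℝ) : ℝ := max a (min b x)

lemma clamp_mem {a b : ℝ} (h : a ≤ b) (x : ℝ) : clamp a b x ∈ Set.Icc a b :=
  ⟨le_max_left _ _, max_le h (min_le_left _ _)⟩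

lemma clamp_mono (a b : ℝ) : Monotone (clamp a b) := fun _ _ h =>
  max_le_max le_rfl (min_le_min le_rfl h)

lemma clamp_of_le {a b x : ℝ} (h : x ≤ a) : clamp a b x = a :=
  max_eq_left ((min_le_right _ _).trans h)

lemma clamp_of_ge {a b x : ℝ} (hab : a ≤ b) (h : b ≤ x) : clamp a b x = b := by
  rw [clamp, min_eq_left h, max_eq_right hab]

/-- Both sides are the increment of `g` over the intersection of `[a, b]` and `[c, d]`. -/
lemma clamp_sub_clamp {E : Type*} [AddGroup E] (g : ℝ → E) {a b c d : ℝ} (hab : a ≤ b)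
    (hcd : c ≤ d) :
    g (clamp a b d) - g (clamp a b c) = g (clamp c d b) - g (clamp c d a) := by
  rcases le_total d a with h1 | h1
  · rw [clamp_of_le h1, clamp_of_le (hcd.trans h1), clamp_of_ge hcd h1,
      clamp_of_ge hcd (h1.trans hab), sub_self, sub_self]
  rcases le_total b c with h2 | h2
  · rw [clamp_of_ge hab h2, clamp_of_ge hab (h2.trans hcd), clamp_of_le h2,
      clamp_of_le (hab.trans h2), sub_self, sub_self]
  have e1 : clamp a b d = clamp c d b := by
    rw [clamp, clamp, max_eq_right (le_min hab h1), max_eq_right (le_min hcd h2), min_comm]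
  have e2 : clamp a b c = clamp c d a := by
    rw [clamp, clamp, min_eq_right h2, min_eq_right h1, max_comm]
  rw [e1, e2]

/-- The tagged Riemann-Stieltjes sum. -/
def rsSum (f : ℝ → ℂ) (σ : ℝ → M →L[ℂ] M) (n : ℕ) (t s : ℕ → ℝ) : M →L[ℂ] M :=
  ∑ i ∈ Finset.range n, f (s i) • (σ (t (i + 1)) - σ (t i))

/-- The `i`-th node of the partition of `[-1, 1]` into `N + 1` intervals of equal length. -/
noncomputable def node (N i : ℕ) : ℝ := -1 + 2 * i / (N + 1)

lemma node_zero (N : ℕ) : node N 0 = -1 := by simp [node]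

lemma node_last (N : ℕ) : node N (N + 1) = 1 := by
  have : (N : ℝ) + 1 ≠ 0 := by positivity
  rw [node]; push_cast; field_simp; norm_num

lemma node_mono (N : ℕ) : Monotone (node N) := fun i j h => by
  unfold node; gcongr

lemma node_succ_sub (N i : ℕ) : node N (i + 1) - node N i = 2 / (N + 1) := by
  unfold node; push_cast; ring

lemma eventually_node_succ_sub_lt {δ : ℝ} (hδ : 0 < δ) :
    ∀ᶠ N in Filter.atTop, ∀ i, node N (i + 1) - node N i < δ := by
  simp only [node_succ_sub, forall_const]
  have h : Filter.Tendsto (fun N : ℕ => 2 * (1 / ((N : ℝ) + 1))) Filter.atTop (𝓝 (2 * 0)) :=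
    tendsto_one_div_add_atTop_nhds_zero_nat.const_mul 2
  rw [mul_zero] at h
  filter_upwards [h.eventually (gt_mem_nhds hδ)] with N hN
  rwa [mul_one_div] at hN

lemma node_mem {N i : ℕ} (hi : i ≤ N + 1) : node N i ∈ Set.Icc (-1 : ℝ) 1 :=
  ⟨node_zero N ▸ node_mono N i.zero_le, node_last N ▸ node_mono N hi⟩

lemma HasRSIntegral.tendsto_rsSum {f : ℝ → ℂ} {σ : ℝ → M →L[ℂ] M} {S : M →L[ℂ] M}
    (h : HasRSIntegral f σ (-1) 1 S) (s : ℕ → ℕ → ℝ)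
    (hs : ∀ N, ∀ i < N + 1, s N i ∈ Set.Icc (node N i) (node N (i + 1))) :
    Filter.Tendsto (fun N => rsSum f σ (N + 1) (node N) (s N)) Filter.atTop (𝓝 S) := by
  rw [Metric.tendsto_nhds]
  intro ε hε
  obtain ⟨δ, hδ, H⟩ := h ε hε
  filter_upwards [eventually_node_succ_sub_lt hδ] with N hN
  rw [dist_eq_norm]
  exact H (N + 1) (node N) (s N) (node_mono N) (node_zero N) (node_last N) (fun i _ => hN i) (hs N)

lemma HasRSIntegral.unique {f : ℝ → ℂ} {σ : ℝ → M →L[ℂ] M} {S T : M →L[ℂ] M}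
    (hS : HasRSIntegral f σ (-1) 1 S) (hT : HasRSIntegral f σ (-1) 1 T) : S = T :=
  tendsto_nhds_unique
    (hS.tendsto_rsSum node fun N i _ => ⟨le_rfl, node_mono N i.le_succ⟩)
    (hT.tendsto_rsSum node fun N i _ => ⟨le_rfl, node_mono N i.le_succ⟩)

lemma HasRSIntegral.congr {f g : ℝ → ℂ} {σ : ℝ → M →L[ℂ] M} {T : M →L[ℂ] M}
    (h : HasRSIntegral f σ (-1) 1 T)
    (hfg : ∀ u ∈ Set.Icc (-1 : ℝ) 1, f u = g u) : HasRSIntegral g σ (-1) 1 T := by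
  intro ε hε
  obtain ⟨δ, hδ, H⟩ := h ε hε
  refine ⟨δ, hδ, fun n t s ht h0 hn hmesh hs => ?_⟩
  have e : ∑ i ∈ Finset.range n, g (s i) • (σ (t (i + 1)) - σ (t i))
      = ∑ i ∈ Finset.range n, f (s i) • (σ (t (i + 1)) - σ (t i)) := by
    refine Finset.sum_congr rfl fun i hi => ?_
    have hi' := Finset.mem_range.1 hi
    rw [hfg _ ⟨h0 ▸ (ht i.zero_le).trans (hs i hi').1, hn ▸ (hs i hi').2.trans (ht hi')⟩]
  rw [e]
  exact H n t s ht h0 hn hmesh hs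

lemma IsIntegralOf.eqOn {Ω Ω' : ℂ → M →L[ℂ] M} {σ : ℝ → M →L[ℂ] M} (h : IsIntegralOf Ω σ)
    (h' : IsIntegralOf Ω' σ) : Set.EqOn Ω Ω' slitDomain := fun z hz => (h z hz).unique (h' z hz)

variable [CompleteSpace M]

/-- Both sums are rewritten as double sums over the intersections of the intervals of the two
partitions, where the tags are close to each other. -/
lemma norm_rsSum_sub_rsSum_le {σ : ℝ → M →L[ℂ] M} (hσ : IsDistribution σ) {f : ℝ → ℂ} {ε δ : ℝ}
    (hε : 0 ≤ ε)
    (hf : ∀ u ∈ Set.Icc (-1 : ℝ) 1, ∀ v ∈ Set.Icc (-1 : ℝ) 1, |u - v| < δ → ‖f u - f v‖ ≤ ε)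
    {n m : ℕ} {t s t' s' : ℕ → ℝ}
    (ht : Monotone t) (h0 : t 0 = -1) (hn : t n = 1) (hmesh : ∀ i < n, t (i + 1) - t i < δ / 2)
    (hs : ∀ i < n, s i ∈ Set.Icc (t i) (t (i + 1)))
    (ht' : Monotone t') (h0' : t' 0 = -1) (hm' : t' m = 1)
    (hmesh' : ∀ j < m, t' (j + 1) - t' j < δ / 2)
    (hs' : ∀ j < m, s' j ∈ Set.Icc (t' j) (t' (j + 1))) :
    ‖rsSum f σ n t s - rsSum f σ m t' s'‖ ≤ 2 * ε := by
  let D : ℕ → ℕ → M →L[ℂ] M := fun i j =>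
    σ (clamp (t i) (t (i + 1)) (t' (j + 1))) - σ (clamp (t i) (t (i + 1)) (t' j))
  have hD' : ∀ i j, D i j
      = σ (clamp (t' j) (t' (j + 1)) (t (i + 1))) - σ (clamp (t' j) (t' (j + 1)) (t i)) :=
    fun i j => clamp_sub_clamp σ (ht i.le_succ) (ht' j.le_succ)
  have hmem : ∀ i ≤ n, t i ∈ Set.Icc (-1 : ℝ) 1 := fun i hi => ⟨h0 ▸ ht i.zero_le, hn ▸ ht hi⟩
  have hmem' : ∀ j ≤ m, t' j ∈ Set.Icc (-1 : ℝ) 1 := fun j hj => ⟨h0' ▸ ht' j.zero_le, hm' ▸ ht' hj⟩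
  have hrow : ∀ i < n, ∑ j ∈ Finset.range m, D i j = σ (t (i + 1)) - σ (t i) := by
    intro i hi
    rw [Finset.sum_range_sub (fun j => σ (clamp (t i) (t (i + 1)) (t' j))), h0', hm',
      clamp_of_le (hmem i hi.le).1, clamp_of_ge (ht i.le_succ) (hmem (i + 1) hi).2]
  have hcol : ∀ j < m, ∑ i ∈ Finset.range n, D i j = σ (t' (j + 1)) - σ (t' j) := by
    intro j hj
    simp only [hD']
    rw [Finset.sum_range_sub (fun i => σ (clamp (t' j) (t' (j + 1)) (t i))), h0, hn,
      clamp_of_le (hmem' j hj.le).1, clamp_of_ge (ht' j.le_succ) (hmem' (j + 1) hj).2]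
  have e1 : rsSum f σ n t s
      = ∑ p ∈ Finset.range n ×ˢ Finset.range m, f (s p.1) • D p.1 p.2 := by
    rw [Finset.sum_product, rsSum]
    refine Finset.sum_congr rfl fun i hi => ?_
    rw [← hrow i (Finset.mem_range.1 hi), Finset.smul_sum]
  have e2 : rsSum f σ m t' s'
      = ∑ p ∈ Finset.range n ×ˢ Finset.range m, f (s' p.2) • D p.1 p.2 := by
    rw [Finset.sum_product_right, rsSum]
    refine Finset.sum_congr rfl fun j hj => ?_
    rw [← hcol j (Finset.mem_range.1 hj), Finset.smul_sum]
  rw [e1, e2, ← Finset.sum_sub_distrib]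
  simp only [← sub_smul]
  refine norm_sum_smul_le_of_nonneg _ (fun p : ℕ × ℕ => D p.1 p.2) ?_ ?_ _ hε ?_
  · rintro ⟨i, j⟩ hp
    simp only [Finset.mem_product, Finset.mem_range] at hp
    have hsub : Set.Icc (t i) (t (i + 1)) ⊆ Set.Icc (-1 : ℝ) 1 :=
      Set.Icc_subset_Icc (hmem i hp.1.le).1 (hmem (i + 1) hp.1).2
    exact sub_nonneg.2 (hσ.mono (hsub (clamp_mem (ht i.le_succ) _))
      (hsub (clamp_mem (ht i.le_succ) _)) (clamp_mono _ _ (ht' j.le_succ)))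
  · rw [Finset.sum_product, Finset.sum_congr rfl fun i hi => hrow i (Finset.mem_range.1 hi),
      Finset.sum_range_sub (fun i => σ (t i)), h0, hn, hσ.left_end, hσ.right_end, sub_zero]
  · rintro ⟨i, j⟩ hp hne
    simp only [Finset.mem_product, Finset.mem_range] at hp
    have a1 := hs i hp.1
    have a2 := hs' j hp.2
    refine hf _ ⟨(hmem i hp.1.le).1.trans a1.1, a1.2.trans (hmem (i + 1) hp.1).2⟩ _
      ⟨(hmem' j hp.2.le).1.trans a2.1, a2.2.trans (hmem' (j + 1) hp.2).2⟩ ?_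
    have a3 := hmesh i hp.1
    have a4 := hmesh' j hp.2
    have b1 : t i ≤ t' (j + 1) := by
      by_contra! hlt
      refine hne ?_
      simp only [D]
      rw [clamp_of_le hlt.le, clamp_of_le ((ht' j.le_succ).trans hlt.le), sub_self]
    have b2 : t' j ≤ t (i + 1) := by
      by_contra! hlt
      refine hne ?_
      simp only [D]
      rw [clamp_of_ge (ht i.le_succ) hlt.le,
        clamp_of_ge (ht i.le_succ) (hlt.le.trans (ht' j.le_succ)), sub_self]
    rw [abs_lt]
    constructor <;> linarith [a1.1, a1.2, a2.1, a2.2]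

/-- Extension of a function on `[-1, 1]` to the real line, constant on both sides. -/
noncomputable def extend (F : C(UI, ℂ)) : ℝ → ℂ := Set.IccExtend (by norm_num) F

lemma extend_apply (F : C(UI, ℂ)) (u : UI) : extend F u = F u := Set.IccExtend_val _ _ _

lemma exists_delta (F : C(UI, ℂ)) {ε : ℝ} (hε : 0 < ε) :
    ∃ δ > 0, ∀ u ∈ Set.Icc (-1 : ℝ) 1, ∀ v ∈ Set.Icc (-1 : ℝ) 1, |u - v| < δ →
      ‖extend F u - extend F v‖ ≤ ε := by
  obtain ⟨δ, hδ, hF⟩ := Metric.uniformContinuous_iff.1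
    (CompactSpace.uniformContinuous_of_continuous F.continuous) ε hε
  refine ⟨δ, hδ, fun u hu v hv huv => ?_⟩
  rw [extend_apply F ⟨u, hu⟩, extend_apply F ⟨v, hv⟩, ← dist_eq_norm]
  exact (hF (by rwa [Subtype.dist_eq, Real.dist_eq])).le

/-- Riemann-Stieltjes sums over the equidistant partitions, with the left end points as tags. -/
noncomputable def rsSumMap (σ : ℝ → M →L[ℂ] M) (N : ℕ) : C(UI, ℂ) →ₗ[ℂ] (M →L[ℂ] M) where
  toFun F := rsSum (extend F) σ (N + 1) (node N) (node N)
  map_add' F G := by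
    simp only [rsSum, ← Finset.sum_add_distrib, ← add_smul]
    rfl
  map_smul' c F := by
    simp only [rsSum, Finset.smul_sum, smul_smul]
    rfl

lemma isPosUnital_rsSumMap {σ : ℝ → M →L[ℂ] M} (hσ : IsDistribution σ) (N : ℕ) :
    IsPosUnital (rsSumMap σ N) where
  one := by
    change ∑ i ∈ Finset.range (N + 1), (1 : ℂ) • (σ (node N (i + 1)) - σ (node N i)) = 1
    simp only [one_smul]
    rw [Finset.sum_range_sub (fun i => σ (node N i)), node_zero, node_last, hσ.left_end,
      hσ.right_end, sub_zero]
  nonneg f hf := by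
    change (0 : M →L[ℂ] M) ≤ ∑ i ∈ Finset.range (N + 1),
      extend f (node N i) • (σ (node N (i + 1)) - σ (node N i))
    refine Finset.sum_nonneg fun i hi => ?_
    have hi' := Finset.mem_range.1 hi
    exact smul_nonneg (hf _) (sub_nonneg.2
      (hσ.mono (node_mem hi'.le) (node_mem hi') (node_mono N i.le_succ)))

/-- The integral of a continuous function exists, and it depends on the function through a positive
unital map. -/
theorem IsDistribution.exists_isPosUnital {σ : ℝ → M →L[ℂ] M} (hσ : IsDistribution σ) :
    ∃ Φ : C(UI, ℂ) →ₗ[ℂ] (M →L[ℂ] M), IsPosUnital Φ ∧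
      ∀ F, HasRSIntegral (extend F) σ (-1) 1 (Φ F) := by
  have hnode : ∀ N, ∀ i < N + 1, node N i ∈ Set.Icc (node N i) (node N (i + 1)) :=
    fun N i _ => ⟨le_rfl, node_mono N i.le_succ⟩
  obtain ⟨Φ, hΦ, hlim⟩ := IsPosUnital.of_tendsto (isPosUnital_rsSumMap hσ) fun F => by
    rw [Metric.cauchySeq_iff']
    intro ε hε
    obtain ⟨δ, hδ, hF⟩ := exists_delta F (ε := ε / 4) (by positivity)
    obtain ⟨N, hN⟩ := Filter.eventually_atTop.1 (eventually_node_succ_sub_lt (half_pos hδ))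
    refine ⟨N, fun n hn => ?_⟩
    rw [dist_eq_norm]
    have := norm_rsSum_sub_rsSum_le hσ (by positivity) hF (node_mono n) (node_zero n)
      (node_last n) (fun i _ => hN n hn i) (hnode n) (node_mono N) (node_zero N) (node_last N)
      (fun i _ => hN N le_rfl i) (hnode N)
    refine lt_of_le_of_lt this ?_
    linarith
  refine ⟨Φ, hΦ, fun F ε hε => ?_⟩
  obtain ⟨δ, hδ, hF⟩ := exists_delta F (ε := ε / 4) (by positivity)
  refine ⟨δ / 2, by positivity, fun n t s ht h0 hn hmesh hs => ?_⟩
  have h1 : Filter.Tendsto (fun N => ‖rsSum (extend F) σ n t s - rsSumMap σ N F‖) Filter.atTop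
      (𝓝 ‖rsSum (extend F) σ n t s - Φ F‖) := ((hlim F).const_sub _).norm
  have h2 : ‖rsSum (extend F) σ n t s - Φ F‖ ≤ 2 * (ε / 4) := by
    refine le_of_tendsto h1 ((eventually_node_succ_sub_lt (half_pos hδ)).mono fun N hN => ?_)
    exact norm_rsSum_sub_rsSum_le hσ (by positivity) hF ht h0 hn hmesh hs (node_mono N)
      (node_zero N) (node_last N) (fun i _ => hN i) (hnode N)
  refine lt_of_le_of_lt h2 ?_
  linarith

end

/-! ### Uniqueness of the distribution function -/

section

variable {M : Type*} [NormedAddCommGroup M] [InnerProductSpace ℂ M] [CompleteSpace M]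
  {Φ : C(UI, ℂ) →ₗ[ℂ] (M →L[ℂ] M)} {σ : ℝ → M →L[ℂ] M}

/-- The continuous function on `[-1, 1]` that equals `1` to the left of `s`, equals `0` to the right
of `t`, and is affine in between. -/
noncomputable def bridge (s t : ℝ) : C(UI, ℂ) :=
  ⟨fun u => ((max 0 (min 1 ((t - u) / (t - s))) : ℝ) : ℂ), by fun_prop⟩

/-- The sum with the left end points as tags dominates the increment of `σ` up to `s`. -/
lemma IsDistribution.le_of_hasRSIntegral (hσ : IsDistribution σ) {g : ℝ → ℝ} {T : M →L[ℂ] M}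
    (hT : HasRSIntegral (fun u => (g u : ℂ)) σ (-1) 1 T) {s : ℝ} (hs : s ∈ Set.Icc (-1 : ℝ) 1)
    (h0 : ∀ u, 0 ≤ g u) (h1 : ∀ u ≤ s, g u = 1) : σ s ≤ T := by
  refine le_of_tendsto_op (f := fun _ : ℕ => σ s) tendsto_const_nhds
    (hT.tendsto_rsSum node fun N i _ => ⟨le_rfl, node_mono N i.le_succ⟩)
    (Filter.Eventually.of_forall fun N => ?_)
  have e : σ s = ∑ i ∈ Finset.range (N + 1),
      (σ (min (node N (i + 1)) s) - σ (min (node N i) s)) := by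
    rw [Finset.sum_range_sub (fun i => σ (min (node N i) s)), node_zero, node_last,
      min_eq_right hs.2, min_eq_left hs.1, hσ.left_end, sub_zero]
  rw [e]
  refine Finset.sum_le_sum fun i hi => ?_
  have hi' := Finset.mem_range.1 hi
  have hm1 := node_mem hi'.le
  have hm2 := node_mem hi'
  rcases le_total (node N i) s with hle | hle
  · simp only [h1 _ hle, Complex.ofReal_one, one_smul]
    rw [min_eq_left hle]
    refine sub_le_sub_right (hσ.mono ⟨le_min hm2.1 hs.1, min_le_of_left_le hm2.2⟩ hm2
      (min_le_left _ _)) _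
  · rw [min_eq_right hle, min_eq_right (hle.trans (node_mono N i.le_succ)), sub_self]
    exact smul_nonneg (Complex.zero_le_real.2 (h0 _))
      (sub_nonneg.2 (hσ.mono hm1 hm2 (node_mono N i.le_succ)))

/-- The sum with the right end points as tags is dominated by the increment of `σ` up to `t`. -/
lemma IsDistribution.ge_of_hasRSIntegral (hσ : IsDistribution σ) {g : ℝ → ℝ} {T : M →L[ℂ] M}
    (hT : HasRSIntegral (fun u => (g u : ℂ)) σ (-1) 1 T) {t : ℝ} (ht : t ∈ Set.Icc (-1 : ℝ) 1)
    (h1 : ∀ u, g u ≤ 1) (h0 : ∀ u, t ≤ u → g u = 0) : T ≤ σ t := by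
  refine le_of_tendsto_op (g := fun _ : ℕ => σ t)
    (hT.tendsto_rsSum (fun N i => node N (i + 1)) fun N i _ => ⟨node_mono N i.le_succ, le_rfl⟩)
    tendsto_const_nhds (Filter.Eventually.of_forall fun N => ?_)
  have e : σ t = ∑ i ∈ Finset.range (N + 1),
      (σ (min (node N (i + 1)) t) - σ (min (node N i) t)) := by
    rw [Finset.sum_range_sub (fun i => σ (min (node N i) t)), node_zero, node_last,
      min_eq_right ht.2, min_eq_left ht.1, hσ.left_end, sub_zero]
  rw [e]
  refine Finset.sum_le_sum fun i hi => ?_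
  have hi' := Finset.mem_range.1 hi
  have hm1 := node_mem hi'.le
  have hm2 := node_mem hi'
  have hinc := sub_nonneg.2 (hσ.mono hm1 hm2 (node_mono N i.le_succ))
  rcases le_total t (node N (i + 1)) with hle | hle
  · simp only [h0 _ hle, Complex.ofReal_zero, zero_smul]
    exact sub_nonneg.2 (hσ.mono ⟨le_min hm1.1 ht.1, min_le_of_left_le hm1.2⟩
      ⟨le_min hm2.1 ht.1, min_le_of_left_le hm2.2⟩ (min_le_min_right _ (node_mono N i.le_succ)))
  · rw [min_eq_left hle, min_eq_left ((node_mono N i.le_succ).trans hle)]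
    calc _ ≤ (1 : ℂ) • (σ (node N (i + 1)) - σ (node N i)) :=
          smul_le_smul_of_nonneg_right
            (Complex.real_le_real.2 (h1 _) : ((g _ : ℝ) : ℂ) ≤ (1 : ℝ)) hinc
      _ = _ := one_smul _ _

/-- Two distribution functions with the same integrals interlace, by comparison with the integral
of a function that bridges the gap between two points. -/
lemma IsDistribution.le_of_lt {σ' : ℝ → M →L[ℂ] M} (hσ : IsDistribution σ)
    (hσ' : IsDistribution σ') (h : ∀ F, HasRSIntegral (extend F) σ (-1) 1 (Φ F))
    (h' : ∀ F, HasRSIntegral (extend F) σ' (-1) 1 (Φ F)) {s t : ℝ} (hs : s ∈ Set.Icc (-1 : ℝ) 1)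
    (ht : t ∈ Set.Icc (-1 : ℝ) 1) (hst : s < t) : σ s ≤ σ' t := by
  let g : ℝ → ℝ := fun u => max 0 (min 1 ((t - u) / (t - s)))
  have hd : 0 < t - s := sub_pos.2 hst
  have hg : ∀ u ∈ Set.Icc (-1 : ℝ) 1, extend (bridge s t) u = (g u : ℂ) :=
    fun u hu => extend_apply (bridge s t) ⟨u, hu⟩
  refine (hσ.le_of_hasRSIntegral ((h (bridge s t)).congr hg) hs (fun u => le_max_left _ _)
    fun u hu => ?_).trans (hσ'.ge_of_hasRSIntegral ((h' (bridge s t)).congr hg) ht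
      (fun u => max_le zero_le_one (min_le_left _ _)) fun u hu => ?_)
  · have : 1 ≤ (t - u) / (t - s) := by rw [one_le_div hd]; linarith
    simp only [g, min_eq_left this, max_eq_right zero_le_one]
  · have : (t - u) / (t - s) ≤ 0 := div_nonpos_of_nonpos_of_nonneg (by linarith) hd.le
    exact max_eq_left ((min_le_right _ _).trans this)

lemma IsDistribution.le {σ' : ℝ → M →L[ℂ] M} (hσ : IsDistribution σ)
    (hσ' : IsDistribution σ') (h : ∀ F, HasRSIntegral (extend F) σ (-1) 1 (Φ F))
    (h' : ∀ F, HasRSIntegral (extend F) σ' (-1) 1 (Φ F)) {t : ℝ} (ht : t ∈ Set.Ioo (-1 : ℝ) 1) :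
    σ t ≤ σ' t := by
  refine le_of_tendsto_apply (l := 𝓝[<] t) (f := σ) (g := fun _ => σ' t)
    (fun x => ?_) (fun _ => tendsto_const_nhds) ?_
  · exact (hσ.left_cont t ht x).mono_left (nhdsWithin_mono _ Set.Iio_subset_Iic_self)
  · filter_upwards [Ioo_mem_nhdsLT ht.1] with s hs
    exact hσ.le_of_lt hσ' h h' ⟨hs.1.le, (hs.2.trans ht.2).le⟩ ⟨ht.1.le, ht.2.le⟩ hs.2

/-- A distribution function is determined by the integrals of continuous functions. -/
theorem IsDistribution.eqOn {σ' : ℝ → M →L[ℂ] M} (hσ : IsDistribution σ)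
    (hσ' : IsDistribution σ') (h : ∀ F, HasRSIntegral (extend F) σ (-1) 1 (Φ F))
    (h' : ∀ F, HasRSIntegral (extend F) σ' (-1) 1 (Φ F)) :
    Set.EqOn σ σ' (Set.Icc (-1) 1) := by
  intro t ht
  rcases eq_or_lt_of_le ht.1 with h1 | h1
  · rw [← h1, hσ.left_end, hσ'.left_end]
  rcases eq_or_lt_of_le ht.2 with h2 | h2
  · rw [h2, hσ.right_end, hσ'.right_end]
  exact le_antisymm (hσ.le hσ' h h' ⟨h1, h2⟩) (hσ'.le hσ h' h ⟨h1, h2⟩)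

end

/-! ### The dilation -/

section

variable {M : Type u} [NormedAddCommGroup M] [InnerProductSpace ℂ M] [CompleteSpace M]

/-- A positive semidefinite Hankel kernel is the Gram kernel of a total family `k n x`, in its
reproducing kernel Hilbert space. -/
lemma exists_hankel_space (T : ℕ → M →L[ℂ] M) (hT : ∀ n, IsSelfAdjoint (T n))
    (hpos : ∀ f : ℕ →₀ M,
      0 ≤ (f.sum fun m x => f.sum fun n y => ⟪T (m + n) x, y⟫_ℂ).re) :
    ∃ (H : Type u) (_ : NormedAddCommGroup H) (_ : InnerProductSpace ℂ H) (_ : CompleteSpace H)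
      (k : ℕ → M →L[ℂ] H), (∀ m n x y, ⟪k m x, k n y⟫_ℂ = ⟪T (m + n) x, y⟫_ℂ) ∧
      (Submodule.span ℂ {v | ∃ n x, k n x = v}).topologicalClosure = ⊤ := by
  let Q : Matrix ℕ ℕ (M →L[ℂ] M) := Matrix.of fun m n => T (m + n)
  have hQ : Q.IsHermitian := by
    refine Matrix.ext fun m n => ?_
    rw [Matrix.conjTranspose_apply]
    change star (T (n + m)) = T (m + n)
    rw [(hT _).star_eq, add_comm]
  have hP : Q.PosSemidef := by
    refine ((RKHS.posSemidef_tfae (K := Q)).out 2 0).1 (And.intro hQ fun f => ?_)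
    have := hpos f
    simp only [Q, Matrix.of_apply]
    simp only [add_comm]
    exact this
  have : Fact Q.PosSemidef := ⟨hP⟩
  refine ⟨RKHS.OfKernel Q, inferInstance, inferInstance, inferInstance,
    RKHS.kerFun (RKHS.OfKernel Q), fun m n x y => ?_, RKHS.kerFun_dense (RKHS.OfKernel Q)⟩
  rw [← RKHS.kernel_inner, RKHS.OfKernel.kernel_ofKernel]
  simp only [Q, Matrix.of_apply, add_comm]

variable {Φ : C(UI, ℂ) →ₗ[ℂ] (M →L[ℂ] M)}

/-- Positive maps on the commutative algebra of continuous functions are completely positive. For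
Riemann-Stieltjes sums this is a sum of nonnegative quadratic forms of the increments of `σ`. -/
lemma IsPosUnital.sum_inner_nonneg (h : IsPosUnital Φ) (g : C(UI, ℂ)) (hg : ∀ t, 0 ≤ g t)
    (s : Finset ℕ) (x : ℕ → M) :
    0 ≤ (∑ m ∈ s, ∑ n ∈ s, ⟪Φ (g * incl ^ (m + n)) (x m), x n⟫_ℂ).re := by
  obtain ⟨σ, hσ⟩ := h.exists_isCutLimit
  have hd := hσ.isDistribution h
  have hlim : ∀ m n, Filter.Tendsto (fun N => ⟪rsSumMap σ N (g * incl ^ (m + n)) (x m), x n⟫_ℂ)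
      Filter.atTop (𝓝 ⟪Φ (g * incl ^ (m + n)) (x m), x n⟫_ℂ) := by
    intro m n
    have h1 : HasRSIntegral (extend (g * incl ^ (m + n))) σ (-1) 1 (Φ (g * incl ^ (m + n))) :=
      hσ.hasRSIntegral h (extend_apply _)
    have h2 := h1.tendsto_rsSum node fun N i _ => ⟨le_rfl, node_mono N i.le_succ⟩
    exact (((ContinuousLinearMap.apply ℂ M (x m)).continuous.tendsto _).comp h2).inner
      tendsto_const_nhds
  have hlim' := (Complex.continuous_re.tendsto _).comp
    (tendsto_finsetSum s fun m _ => tendsto_finsetSum s fun n _ => hlim m n)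
  refine ge_of_tendsto hlim' (Filter.Eventually.of_forall fun N => ?_)
  simp only [Function.comp_apply]
  let P : ℕ → M →L[ℂ] M := fun i => σ (node N (i + 1)) - σ (node N i)
  let y : ℕ → M := fun i => ∑ m ∈ s, (node N i : ℂ) ^ m • x m
  have e : ∑ m ∈ s, ∑ n ∈ s, ⟪rsSumMap σ N (g * incl ^ (m + n)) (x m), x n⟫_ℂ
      = ∑ i ∈ Finset.range (N + 1), extend g (node N i) * ⟪P i (y i), y i⟫_ℂ := by
    have e1 : ∀ m n, ⟪rsSumMap σ N (g * incl ^ (m + n)) (x m), x n⟫_ℂ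
        = ∑ i ∈ Finset.range (N + 1),
          extend g (node N i) * ((node N i : ℂ) ^ m * (node N i : ℂ) ^ n * ⟪P i (x m), x n⟫_ℂ) := by
      intro m n
      change ⟪(∑ i ∈ Finset.range (N + 1), extend (g * incl ^ (m + n)) (node N i) • P i) (x m),
        x n⟫_ℂ = _
      rw [sum_apply, sum_inner]
      refine Finset.sum_congr rfl fun i hi => ?_
      have hi' := node_mem (Finset.mem_range.1 hi).le
      have hr := hg ⟨_, hi'⟩
      rw [extend_apply _ ⟨_, hi'⟩, extend_apply _ ⟨_, hi'⟩, smul_apply, inner_smul_left,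
        ContinuousMap.mul_apply, ContinuousMap.pow_apply, incl_apply, map_mul, map_pow,
        Complex.conj_ofReal, Complex.conj_eq_iff_im.2 (Complex.le_def.1 hr).2.symm, pow_add]
      ring
    simp only [e1]
    rw [Finset.sum_congr rfl fun m _ => Finset.sum_comm, Finset.sum_comm]
    refine Finset.sum_congr rfl fun i _ => ?_
    simp only [← Finset.mul_sum]
    congr 1
    simp only [y]
    rw [map_sum, sum_inner]
    refine Finset.sum_congr rfl fun m _ => ?_
    rw [inner_sum]
    refine Finset.sum_congr rfl fun n _ => ?_
    rw [map_smul, inner_smul_left, inner_smul_right, map_pow, Complex.conj_ofReal]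
    ring
  rw [e, Complex.re_sum]
  refine Finset.sum_nonneg fun i hi => ?_
  have hi' := Finset.mem_range.1 hi
  have hr := Complex.le_def.1 (hg ⟨_, node_mem hi'.le⟩)
  have hP : 0 ≤ P i := sub_nonneg.2 (hd.mono (node_mem hi'.le) (node_mem hi')
    (node_mono N i.le_succ))
  rw [extend_apply _ ⟨_, node_mem hi'.le⟩, Complex.mul_re, ← hr.2, Complex.zero_im, zero_mul,
    sub_zero]
  exact mul_nonneg hr.1 (re_inner_nonneg_of_nonneg hP _)

lemma isSelfAdjoint_apply_incl_pow (h : IsPosUnital Φ) (n : ℕ) : IsSelfAdjoint (Φ (incl ^ n)) := by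
  have e : incl ^ n = (1 + incl ^ n) - 1 := by abel
  rw [e, map_sub, h.one]
  refine IsSelfAdjoint.sub (isSelfAdjoint_of_nonneg (h.nonneg _ fun t => ?_)) (IsSelfAdjoint.one _)
  rw [ContinuousMap.add_apply, ContinuousMap.one_apply, ContinuousMap.pow_apply, incl_apply,
    ← Complex.ofReal_pow, ← Complex.ofReal_one, ← Complex.ofReal_add, Complex.zero_le_real]
  have h1 : |(t : ℝ) ^ n| ≤ 1 := by
    rw [abs_pow]
    exact pow_le_one₀ (abs_nonneg _) (abs_le.2 t.2)
  linarith [(abs_le.1 h1).1]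

/-- The shift `k n x ↦ k (n + 1) x` is contractive, by complete positivity with the weight
`1 - t ^ 2`, and selfadjoint, because the kernel depends on `m + n` only. -/
lemma exists_shift (h : IsPosUnital Φ) {H : Type u} [NormedAddCommGroup H] [InnerProductSpace ℂ H]
    [CompleteSpace H] (k : ℕ → M →L[ℂ] H)
    (hk : ∀ m n x y, ⟪k m x, k n y⟫_ℂ = ⟪Φ (incl ^ (m + n)) x, y⟫_ℂ)
    (hd : (Submodule.span ℂ {v | ∃ n x, k n x = v}).topologicalClosure = ⊤) :
    ∃ A : H →L[ℂ] H, IsSelfAdjointContraction A ∧ ∀ n x, A (k n x) = k (n + 1) x := by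
  have hT := isSelfAdjoint_apply_incl_pow h
  let L : (ℕ →₀ M) →ₗ[ℂ] H := Finsupp.lsum ℂ fun n => (k n).toLinearMap
  let S : (ℕ →₀ M) →ₗ[ℂ] H := Finsupp.lsum ℂ fun n => (k (n + 1)).toLinearMap
  have hL1 : ∀ n x, L (Finsupp.single n x) = k n x := fun n x => by simp [L]
  have hS1 : ∀ n x, S (Finsupp.single n x) = k (n + 1) x := fun n x => by simp [S]
  have hL : ∀ f, L f = ∑ n ∈ f.support, k n (f n) := fun f => rfl
  have hS : ∀ f, S f = ∑ n ∈ f.support, k (n + 1) (f n) := fun f => rfl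
  have dL : DenseRange L := by
    rw [← Submodule.dense_iff_topologicalClosure_eq_top] at hd
    refine hd.mono ?_
    have : Submodule.span ℂ {v | ∃ n x, k n x = v} ≤ LinearMap.range L := by
      refine Submodule.span_le.2 ?_
      rintro _ ⟨n, x, rfl⟩
      exact ⟨Finsupp.single n x, hL1 n x⟩
    exact this
  have hle : ∀ f, ‖S f‖ ≤ 1 * ‖L f‖ := by
    intro f
    rw [one_mul]
    have e1 : ⟪L f, L f⟫_ℂ - ⟪S f, S f⟫_ℂ = ∑ m ∈ f.support, ∑ n ∈ f.support,
        ⟪Φ ((1 - incl ^ 2) * incl ^ (m + n)) (f m), f n⟫_ℂ := by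
      rw [hL, hS, sum_inner, sum_inner, ← Finset.sum_sub_distrib]
      refine Finset.sum_congr rfl fun m _ => ?_
      rw [inner_sum, inner_sum, ← Finset.sum_sub_distrib]
      refine Finset.sum_congr rfl fun n _ => ?_
      rw [hk, hk, ← inner_sub_left, ← sub_apply, ← map_sub]
      congr 4
      ring
    have e2 := h.sum_inner_nonneg (1 - incl ^ 2) (fun t => by
      rw [ContinuousMap.sub_apply, ContinuousMap.one_apply, ContinuousMap.pow_apply, incl_apply,
        ← Complex.ofReal_pow, ← Complex.ofReal_one, ← Complex.ofReal_sub, Complex.zero_le_real]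
      nlinarith [t.2.1, t.2.2]) f.support f
    rw [← e1, inner_self_eq_norm_sq_to_K, inner_self_eq_norm_sq_to_K] at e2
    have e3 : 0 ≤ ‖L f‖ ^ 2 - ‖S f‖ ^ 2 := by
      simpa [← Complex.ofReal_pow] using e2
    exact le_of_sq_le_sq (by linarith) (norm_nonneg _)
  have hA : ∀ n x, S.extendOfNorm L (k n x) = k (n + 1) x := fun n x => by
    rw [← hL1, ← hS1]
    exact LinearMap.extendOfNorm_eq dL ⟨1, hle⟩ _
  refine ⟨S.extendOfNorm L, ⟨?_, ?_⟩, hA⟩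
  · refine ContinuousLinearMap.ext_on (Submodule.dense_iff_topologicalClosure_eq_top.2 hd) ?_
    rintro _ ⟨n, x, rfl⟩
    refine dL.eq_of_inner_left ℂ fun f => ?_
    rw [ContinuousLinearMap.star_eq_adjoint, ContinuousLinearMap.adjoint_inner_left, hA,
      LinearMap.extendOfNorm_eq dL ⟨1, hle⟩, hL, hS, inner_sum, inner_sum]
    refine Finset.sum_congr rfl fun m _ => ?_
    rw [hk, hk, add_right_comm, add_assoc]
  · exact LinearMap.opNorm_extendOfNorm_le dL zero_le_one hle

/-- Every positive unital map is the compression of the functional calculus of a selfadjoint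
contraction. -/
theorem IsPosUnital.exists_dilation (h : IsPosUnital Φ) :
    ∃ (K : Type u) (_ : NormedAddCommGroup K) (_ : InnerProductSpace ℂ K) (_ : CompleteSpace K)
      (J : M →ₗᵢ[ℂ] K) (A : K →L[ℂ] K), IsSelfAdjointContraction A ∧ IsSimple J A ∧
      ∀ z ∈ slitDomain, Φ (mob incl z) = compression J (mobius A z) := by
  obtain ⟨K, _, _, _, k, hk, hd⟩ := exists_hankel_space (fun n => Φ (incl ^ n))
    (isSelfAdjoint_apply_incl_pow h) fun f => by
      have := h.sum_inner_nonneg 1 (fun t => zero_le_one) f.support f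
      simp only [one_mul] at this
      exact this
  obtain ⟨A, hA, hAk⟩ := exists_shift h k hk hd
  have hn : ∀ x, ‖k 0 x‖ = ‖x‖ := fun x => by
    have h1 := hk 0 0 x x
    rw [add_zero, pow_zero, h.one, one_apply_eq_self, inner_self_eq_norm_sq_to_K,
      inner_self_eq_norm_sq_to_K] at h1
    have h2 : ‖k 0 x‖ ^ 2 = ‖x‖ ^ 2 := by exact_mod_cast h1
    exact (sq_eq_sq₀ (norm_nonneg _) (norm_nonneg _)).1 h2
  let J : M →ₗᵢ[ℂ] K := ⟨(k 0).toLinearMap, hn⟩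
  have hJ : ∀ x, J x = k 0 x := fun x => rfl
  have hp : ∀ n x, (A ^ n) (J x) = k n x := by
    intro n x
    induction n with
    | zero => simp [hJ]
    | succ n ih => rw [pow_succ', mul_apply_eq_comp, ih, hAk]
  have hc : ∀ n, compressionL J (A ^ n) = Φ (incl ^ n) := by
    intro n
    ext y
    refine ext_inner_left ℂ fun x => ?_
    rw [compressionL_apply, inner_compression, hp, hJ, hk, zero_add]
    exact (isSelfAdjoint_apply_incl_pow h n).isSymmetric x y
  refine ⟨K, inferInstance, inferInstance, inferInstance, J, A, hA, ?_, ?_⟩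
  · have e : {y : K | ∃ (n : ℕ) (x : M), y = (A ^ n) (J x)} = {v | ∃ n x, k n x = v} := by
      ext y
      constructor
      · rintro ⟨n, x, rfl⟩; exact ⟨n, x, (hp n x).symm⟩
      · rintro ⟨n, x, rfl⟩; exact ⟨n, x, (hp n x).symm⟩
    rw [IsSimple, e, hd]
  · let Φ' : C(UI, ℂ) →L[ℂ] (M →L[ℂ] M) := ⟨Φ, h.continuous⟩
    refine eqOn_slitDomain (f := fun z => Φ' (mob incl z))
      (g := fun z => compressionL J (mobius A z)) ?_ ?_ fun z hz => ?_
    · exact Φ'.differentiable.comp_differentiableOn fun z hz =>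
        (differentiableAt_mob (isUnit_one_add_smul_incl hz)).differentiableWithinAt
    · exact (compressionL J).differentiable.comp_differentiableOn (differentiableOn_mobius hA)
    · have h1 := (hasSum_mob norm_incl_le hz).mapL Φ'
      have h2 := (hasSum_mob hA.2 hz).mapL (compressionL J)
      refine h1.unique (h2.congr_fun fun n => ?_)
      simp only [map_smul, map_add, hc]
      rfl

end

/-! ### The integral representation -/

section

variable {M : Type*} [NormedAddCommGroup M] [InnerProductSpace ℂ M]
  {Φ : C(UI, ℂ) →ₗ[ℂ] (M →L[ℂ] M)} {σ : ℝ → M →L[ℂ] M} {Ω : ℂ → M →L[ℂ] M}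

lemma extend_mob_incl {z : ℂ} (hz : z ∈ slitDomain) :
    ∀ u ∈ Set.Icc (-1 : ℝ) 1, extend (mob incl z) u = (z + (u : ℂ)) / (1 + z * (u : ℂ)) :=
  fun u hu => by rw [extend_apply _ ⟨u, hu⟩, mob_incl_apply hz]

lemma isIntegralOf_of_apply_mob_eq (hσ : ∀ F, HasRSIntegral (extend F) σ (-1) 1 (Φ F))
    (hΩ : ∀ z ∈ slitDomain, Φ (mob incl z) = Ω z) : IsIntegralOf Ω σ := by
  intro z hz
  rw [← hΩ z hz]
  exact (hσ _).congr (extend_mob_incl hz)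

lemma apply_mob_eq_of_isIntegralOf (hσ : ∀ F, HasRSIntegral (extend F) σ (-1) 1 (Φ F))
    (hΩ : IsIntegralOf Ω σ) {z : ℂ} (hz : z ∈ slitDomain) : Φ (mob incl z) = Ω z :=
  ((hσ _).congr (extend_mob_incl hz)).unique (hΩ z hz)

variable [CompleteSpace M]

lemma exists_isIntegralOf_of_isRS (hΩ : IsRS Ω) :
    ∃ σ : ℝ → M →L[ℂ] M, IsDistribution σ ∧ IsIntegralOf Ω σ := by
  obtain ⟨Φ, hΦ, hΦΩ⟩ := exists_isPosUnital_of_isRS hΩ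
  obtain ⟨σ, hσ⟩ := hΦ.exists_isCutLimit
  exact ⟨σ, hσ.isDistribution hΦ,
    isIntegralOf_of_apply_mob_eq (fun F => hσ.hasRSIntegral hΦ (extend_apply F)) hΦΩ⟩

/-- The kernels span a dense subspace of the continuous functions, so `Ω` determines the integrals
of all continuous functions. -/
lemma IsDistribution.eqOn_of_isIntegralOf {σ' : ℝ → M →L[ℂ] M} (hσ : IsDistribution σ)
    (hσ' : IsDistribution σ') (h : IsIntegralOf Ω σ) (h' : IsIntegralOf Ω σ') :
    Set.EqOn σ' σ (Set.Icc (-1) 1) := by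
  obtain ⟨Φ, hΦ, hΦσ⟩ := hσ.exists_isPosUnital
  obtain ⟨Φ', hΦ', hΦσ'⟩ := hσ'.exists_isPosUnital
  have : Φ = Φ' := eq_of_eq_on_mob hΦ.continuous hΦ'.continuous (by rw [hΦ.one, hΦ'.one])
    fun z hz => by
      rw [apply_mob_eq_of_isIntegralOf hΦσ h hz,
        apply_mob_eq_of_isIntegralOf hΦσ' h' hz]
  subst this
  exact hσ'.eqOn hσ hΦσ' hΦσ

end

lemma IsDistribution.exists_isRS {M : Type u} [NormedAddCommGroup M] [InnerProductSpace ℂ M]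
    [CompleteSpace M] {σ : ℝ → M →L[ℂ] M} (hσ : IsDistribution σ) :
    ∃ Ω : ℂ → M →L[ℂ] M, IsRS Ω ∧ IsIntegralOf Ω σ := by
  obtain ⟨Φ, hΦ, hΦσ⟩ := hσ.exists_isPosUnital
  obtain ⟨K, _, _, _, J, A, hA, -, hc⟩ := hΦ.exists_dilation
  exact ⟨_, isRS_compression hA J, isIntegralOf_of_apply_mob_eq hΦσ hc⟩

end NevanlinnaSchur

theorem theorem6p3 {M : Type u} [NormedAddCommGroup M] [InnerProductSpace ℂ M]
    [CompleteSpace M] :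
    -- representation as a compression of a bi-inner function, inner functions, uniqueness
    (∀ Ω : ℂ → M →L[ℂ] M, IsRS Ω →
      (∃ (K : Type u) (_ : NormedAddCommGroup K) (_ : InnerProductSpace ℂ K)
          (_ : CompleteSpace K) (J : M →ₗᵢ[ℂ] K) (A : K →L[ℂ] K),
        IsSelfAdjointContraction A ∧
        (∀ z ∈ slitDomain, IsUnit (1 + z • A)) ∧
        IsRS (mobius A) ∧ IsBiInner (mobius A) ∧
        IsCompressionOf Ω J A ∧ IsSimple J A) ∧
      (∀ (K : Type v) [NormedAddCommGroup K] [InnerProductSpace ℂ K] [CompleteSpace K]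
          (J : M →ₗᵢ[ℂ] K) (A : K →L[ℂ] K),
        IsSelfAdjointContraction A → IsCompressionOf Ω J A → IsSimple J A →
        (IsInner Ω ↔ Function.Surjective J)) ∧
      (∀ (K₁ : Type v) [NormedAddCommGroup K₁] [InnerProductSpace ℂ K₁] [CompleteSpace K₁]
          (K₂ : Type w) [NormedAddCommGroup K₂] [InnerProductSpace ℂ K₂] [CompleteSpace K₂]
          (J₁ : M →ₗᵢ[ℂ] K₁) (A₁ : K₁ →L[ℂ] K₁) (J₂ : M →ₗᵢ[ℂ] K₂) (A₂ : K₂ →L[ℂ] K₂),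
        IsSelfAdjointContraction A₁ → IsCompressionOf Ω J₁ A₁ → IsSimple J₁ A₁ →
        IsSelfAdjointContraction A₂ → IsCompressionOf Ω J₂ A₂ → IsSimple J₂ A₂ →
        ∃ U : K₁ ≃ₗᵢ[ℂ] K₂, (∀ x : M, U (J₁ x) = J₂ x) ∧ ∀ y : K₁, A₂ (U y) = U (A₁ y))) ∧
    -- the integral formula is a one-to-one correspondence
    (∀ Ω : ℂ → M →L[ℂ] M, IsRS Ω →
      ∃ σ : ℝ → M →L[ℂ] M, IsDistribution σ ∧ IsIntegralOf Ω σ ∧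
        ∀ σ' : ℝ → M →L[ℂ] M, IsDistribution σ' → IsIntegralOf Ω σ' →
          Set.EqOn σ' σ (Set.Icc (-1) 1)) ∧
    (∀ σ : ℝ → M →L[ℂ] M, IsDistribution σ →
      ∃ Ω : ℂ → M →L[ℂ] M, IsRS Ω ∧ IsIntegralOf Ω σ ∧
        ∀ Ω' : ℂ → M →L[ℂ] M, IsIntegralOf Ω' σ → Set.EqOn Ω' Ω slitDomain) := by
  refine ⟨fun Ω hΩ => ⟨?_, ?_, ?_⟩, fun Ω hΩ => ?_, fun σ hσ => ?_⟩
  · obtain ⟨Φ, hΦ, hΦΩ⟩ := exists_isPosUnital_of_isRS hΩ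
    obtain ⟨K, i₁, i₂, i₃, J, A, hA, hs, hc⟩ := hΦ.exists_dilation
    exact ⟨K, i₁, i₂, i₃, J, A, hA, fun z hz => isUnit_one_add_smul hA hz, isRS_mobius hA,
      isBiInner_mobius hA, fun z hz => (hΦΩ z hz).symm.trans (hc z hz), hs⟩
  · intro K _ _ _ J A hA hc hs
    exact ⟨surjective_of_isInner hA hc hs, isInner_of_surjective hA hc⟩
  · intro K₁ _ _ _ K₂ _ _ _ J₁ A₁ J₂ A₂ hA₁ h₁ hs₁ hA₂ h₂ hs₂
    exact exists_unitary_of_isSimple hA₁ h₁ hs₁ hA₂ h₂ hs₂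
  · obtain ⟨σ, hσ, hΩσ⟩ := exists_isIntegralOf_of_isRS hΩ
    exact ⟨σ, hσ, hΩσ, fun σ' hσ' h' => hσ.eqOn_of_isIntegralOf hσ' hΩσ h'⟩
  · obtain ⟨Ω, hΩ, hΩσ⟩ := hσ.exists_isRS
    exact ⟨Ω, hΩ, hΩσ, fun Ω' h' => h'.eqOn hΩσ⟩
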